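/- Fix integers $d,n\ge 1$ and $1<p<\infty$, and let $p'=p/(p-1)$. A matrix weight is a measurable $n\times n$ complex matrix valued function on $\mathbb R^d$ that is a.e. positive definite. For matrix weights $U,V$ put $$[U,V]_{A_p}=\sup_I \frac1{|I|}\int_I\Big(\frac1{|I|}\int_I\|V^{-1/p}(y)U^{1/p}(x)\|^{p'}\,dy\Big)^{p/p'}dx,$$ where $I$ ranges over all cubes (cubes have sides parallel to the axes), and, for $1<q<\infty$, $$[U]_{A_q^{wk}}=\sup_{0\ne e\in\mathbb C^n}\big[\,|U^{1/q}e|^q\,\big]_{A_\infty},\qquad [w]_{A_\infty}=\sup_Q\frac1{w(Q)}\int_Q M(w1_Q)\,dx,$$ where $Q$ ranges over all cubes, $w(Q)=\int_Q w$, and $M$ is the Hardy–Littlewood maximal operator over cubes ($[w]_{A_\infty}=\infty$ if $w$ is not locally integrable). Let $\|f\|_{L^p(V)}=\big(\int_{\mathbb R^d}|V^{1/p}f|^p\big)^{1/p}$ for measurable $f:\mathbb R^d\to\mathbb C^n$. A dyadic grid $\mathcal D$ is a collection of half-open cubes $\prod_i[a_i,a_i+\ell)$ with side lengths in $\{2^k:k\in\mathbb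 Z\}$, any two of which are nested or disjoint, such that for each $k$ those of side length $2^k$ partition $\mathbb R^d$. A Haar system for $\mathcal D$ is an orthonormal system $\{h_J^k:J\in\mathcal D,\ 1\le k\le 2^d-1\}$ in $L^2(\mathbb R^d)$ with $h_J^k$ supported on $J$, $\int_J h_J^k=0$, and $h_J^k$ constant on each $L\in\mathcal D$ with $L\subsetneq J$. Define $$S_{U,p}f(x)=\Big(\sum_{J\in\mathcal D}\sum_{k}\frac{|U^{1/p}(x)f_J^k|^2\,1_J(x)}{|J|}\Big)^{1/2},\qquad f_J^k=\int_J f\,h_J^k\,dx .$$ **Theorem.** There is a constant $C=C(d,n,p)$ such that for every dyadic grid, every Haar system and all matrix weights $U,V$ with $[U,V]_{A_p}<\infty$ and $[V^{-p'/p}]_{A_{p'}^{wk}}<\infty$: * if $1<p\le 2$, then $\|S_{U,p}\|_{L^p(V)\to L^p}\le C\,[U,V]_{A_p}^{1/p}\,[V^{-p'/p}]_{A_{p'}^{wk}}^{1/p}$; * if $2<p<\infty$, then $\|S_{U,p}\|_{L^p(V)\to L^p}\le C\,[U,V]_{A_p}^{1/p}\,[V^{-p'/p}]_{A_{p'}^{wk}}^{1/p}\,[U]_{A_p^{wk}}^{1/2-1/p}$.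 For $1<p\le2$ the estimate is sharp, already when $U=V$: there is $c=c(d,n,p)>0$ such that for every dyadic grid, every Haar system and every $N$ there is a matrix weight $W$ with $[W,W]_{A_p}<\infty$, $N\le[W^{-p'/p}]_{A_{p'}^{wk}}<\infty$ and $$\|S_{W,p}\|_{L^p(W)\to L^p}\ \ge\ c\,[W,W]_{A_p}^{1/p}\,[W^{-p'/p}]_{A_{p'}^{wk}}^{1/p}.$$ -/

import Mathlib

open MeasureTheory
open scoped ENNReal NNReal ComplexOrder

noncomputable section

namespace MatrixSquare

/-- A (half-open, axis-parallel) cube in `ℝ^d`, of positive side length. -/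
structure Cube (d : ℕ) where
  corner : Fin d → ℝ
  side : ℝ
  side_pos : 0 < side

namespace Cube

variable {d : ℕ}

/-- The points of a cube: `∏ i, [corner i, corner i + side)`. -/
def toSet (Q : Cube d) : Set (Fin d → ℝ) :=
  Set.univ.pi fun i => Set.Ico (Q.corner i) (Q.corner i + Q.side)

instance : CoeOut (Cube d) (Set (Fin d → ℝ)) := ⟨toSet⟩

end Cube

/-- A dyadic grid: side lengths are integer powers of `2`, the cubes of each generation `2 ^ k`
partition `ℝ^d`, and any two cubes are nested or disjoint. -/
structure IsDyadicGrid {d : ℕ} (D : Set (Cube d)) : Prop where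
  side_eq : ∀ Q ∈ D, ∃ k : ℤ, Q.side = (2 : ℝ) ^ k
  partition : ∀ (k : ℤ) (x : Fin d → ℝ), ∃! Q : Cube d, Q ∈ D ∧ Q.side = (2 : ℝ) ^ k ∧ x ∈ Q.toSet
  nested : ∀ P ∈ D, ∀ Q ∈ D,
    P.toSet ⊆ Q.toSet ∨ Q.toSet ⊆ P.toSet ∨ Disjoint P.toSet Q.toSet

/-- A Haar system for the grid `D`: a family `h J k` (`J ∈ D`, `k` ranging over `2 ^ d - 1`
indices), orthonormal in `L²`, with `h J k` supported on `J`, of mean zero, and constant on the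
proper dyadic subcubes of `J`. The functions `h J k` are finite-valued step functions, hence
automatically square-integrable. -/
structure IsHaarSystem {d : ℕ} (D : Set (Cube d))
    (h : Cube d → Fin (2 ^ d - 1) → (Fin d → ℝ) → ℂ) : Prop where
  support : ∀ J ∈ D, ∀ k, ∀ x, x ∉ J.toSet → h J k x = 0
  mean_zero : ∀ J ∈ D, ∀ k, ∫ x in J.toSet, h J k x = 0
  const : ∀ J ∈ D, ∀ k, ∀ L ∈ D, L.toSet ⊂ J.toSet →
    ∀ x ∈ L.toSet, ∀ y ∈ L.toSet, h J k x = h J k y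
  norm_one : ∀ J ∈ D, ∀ k, ∫ x, h J k x * (starRingEnd ℂ) (h J k x) = 1
  orthogonal : ∀ J ∈ D, ∀ k, ∀ J' ∈ D, ∀ k', (J, k) ≠ (J', k') →
    ∫ x, h J k x * (starRingEnd ℂ) (h J' k' x) = 0

/-- A matrix weight: a (Lebesgue) measurable, almost everywhere positive definite,
`n × n` complex matrix valued function on `ℝ^d`. -/
structure IsMatrixWeight {d n : ℕ} (W : (Fin d → ℝ) → Matrix (Fin n) (Fin n) ℂ) : Prop where
  aemeasurable : ∀ i j, AEMeasurable (fun x => W x i j) volume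
  posDef : ∀ᵐ x, (W x).PosDef

/-- The real power `A ^ s` of a positive definite matrix, by the functional calculus. -/
def matrixPow {n : ℕ} (A : Matrix (Fin n) (Fin n) ℂ) (s : ℝ) : Matrix (Fin n) (Fin n) ℂ :=
  cfc (fun t : ℝ => t ^ s) A

/-- A matrix acting as an operator on `ℂ^n` with its Euclidean norm. -/
abbrev op {n : ℕ} (A : Matrix (Fin n) (Fin n) ℂ) :
    EuclideanSpace ℂ (Fin n) →L[ℂ] EuclideanSpace ℂ (Fin n) :=
  Matrix.toEuclideanCLM (n := Fin n) (𝕜 := ℂ) A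

/-- The dual exponent `p' = p / (p - 1)`. -/
abbrev dual (p : ℝ) : ℝ := p.conjExponent

/-- The two-weight matrix `A_p` characteristic `[U, V]_{A_p}`, the supremum being over all cubes. -/
def apChar {d n : ℕ} (p : ℝ) (U V : (Fin d → ℝ) → Matrix (Fin n) (Fin n) ℂ) : ℝ≥0∞ :=
  ⨆ I : Cube d, ⨍⁻ x in I.toSet,
    (⨍⁻ y in I.toSet,
      ‖op (matrixPow (V y) (-1 / p) * matrixPow (U x) (1 / p))‖ₑ ^ dual p ∂volume) ^ (p / dual p)
    ∂volume

/-- The (uncentered, over cubes) Hardy-Littlewood maximal function of a nonnegative function. -/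
def maximalFn {d : ℕ} (w : (Fin d → ℝ) → ℝ≥0∞) (x : Fin d → ℝ) : ℝ≥0∞ :=
  ⨆ (Q : Cube d) (_ : x ∈ Q.toSet), ⨍⁻ y in Q.toSet, w y ∂volume

open Classical in
/-- The Fujii-Wilson `A_∞` characteristic
`sup_Q (1 / w(Q)) ∫_Q M(w 1_Q)` of a scalar weight `w`; it is `∞` if `w` is not
locally integrable. -/
def aInftyChar {d : ℕ} (w : (Fin d → ℝ) → ℝ≥0∞) : ℝ≥0∞ :=
  ⨆ Q : Cube d,
    if ∫⁻ x in Q.toSet, w x = ∞ then ∞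
    else (∫⁻ x in Q.toSet, maximalFn (Q.toSet.indicator w) x) / ∫⁻ x in Q.toSet, w x

/-- The weak characteristic `[U]_{A_p^{wk}} = sup_e [ |U^{1/p} e|^p ]_{A_∞}`, over
nonzero vectors `e`. -/
def apWkChar {d n : ℕ} (p : ℝ) (U : (Fin d → ℝ) → Matrix (Fin n) (Fin n) ℂ) : ℝ≥0∞ :=
  ⨆ (e : EuclideanSpace ℂ (Fin n)) (_ : e ≠ 0),
    aInftyChar fun x => ‖op (matrixPow (U x) (1 / p)) e‖ₑ ^ p

/-- The norm of the matrix weighted space `L^p(V)`. -/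
def weightedNorm {d n : ℕ} (p : ℝ) (V : (Fin d → ℝ) → Matrix (Fin n) (Fin n) ℂ)
    (f : (Fin d → ℝ) → EuclideanSpace ℂ (Fin n)) : ℝ≥0∞ :=
  (∫⁻ x, ‖op (matrixPow (V x) (1 / p)) (f x)‖ₑ ^ p) ^ (1 / p)

/-- The Haar coefficient `f_J^k = ∫_J f h_J^k`. -/
def haarCoeff {d n : ℕ} (h : Cube d → Fin (2 ^ d - 1) → (Fin d → ℝ) → ℂ)
    (f : (Fin d → ℝ) → EuclideanSpace ℂ (Fin n)) (J : Cube d) (k : Fin (2 ^ d - 1)) :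
    EuclideanSpace ℂ (Fin n) :=
  ∫ x in J.toSet, h J k x • f x

/-- The matrix weighted dyadic square function `S_{U,p} f`, with values in `[0, ∞]`. -/
def squareFn {d n : ℕ} (D : Set (Cube d)) (h : Cube d → Fin (2 ^ d - 1) → (Fin d → ℝ) → ℂ)
    (p : ℝ) (U : (Fin d → ℝ) → Matrix (Fin n) (Fin n) ℂ)
    (f : (Fin d → ℝ) → EuclideanSpace ℂ (Fin n)) (x : Fin d → ℝ) : ℝ≥0∞ :=
  (∑' J : D, ∑ k : Fin (2 ^ d - 1),
    (J : Cube d).toSet.indicator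
      (fun y => ‖op (matrixPow (U y) (1 / p)) (haarCoeff h f J k)‖ₑ ^ 2 /
        volume (J : Cube d).toSet) x) ^ (1 / 2 : ℝ)

/-- The operator norm of `S_{U,p} : L^p(V) → L^p`: the least `K ∈ [0, ∞]` such that
`‖S_{U,p} f‖_{L^p} ≤ K ‖f‖_{L^p(V)}` for all `f ∈ L^p(V)`. -/
def squareFnNorm {d n : ℕ} (D : Set (Cube d))
    (h : Cube d → Fin (2 ^ d - 1) → (Fin d → ℝ) → ℂ)
    (p : ℝ) (U V : (Fin d → ℝ) → Matrix (Fin n) (Fin n) ℂ) : ℝ≥0∞ :=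
  sInf {K : ℝ≥0∞ | ∀ f : (Fin d → ℝ) → EuclideanSpace ℂ (Fin n),
    AEStronglyMeasurable f volume → weightedNorm p V f < ∞ →
      (∫⁻ x, squareFn D h p U f x ^ p) ^ (1 / p) ≤ K * weightedNorm p V f}

end MatrixSquare

end

noncomputable section

namespace MatrixSquare

/-! ### Dyadic geometry of cubes -/

namespace Cube

variable {d : ℕ}

/-! Upper bounds. Write `K` for `[U,V]_{A_p}`, `A` for the weak `A_∞` characteristic of the dual
weight, and `S` for the square of the square function truncated to finitely many generations below a
cube. Each cube `Q` gets a reducing operator `M_Q`: `|M_Q⁻¹ v|` is comparable to the `L^p` average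
of `|U^{1/p} v|` over `Q`, hence `|U^{1/p}(x) v| ≤ u_Q(x) |M_Q⁻¹ v|` with a scalar `u_Q` of bounded
`L^p` average. Constant matrices commute with Haar coefficients, so below `Q` one may trade `U` for
`u_Q²` times the unweighted square function of `M_Q⁻¹ f`. The latter is of weak type `(1,1)`, by
Parseval on each cube and a Calderón-Zygmund stopping time (`exists_stopping`,
`volume_pathSum_gt_le`). Stopping where it exceeds a multiple of the average of `|M_Q⁻¹ f|`, and
passing to new reducing operators there, gives for `t ≤ 1` the sparse bound `lintegral_pathSum_le`:
`∫ S^t φ ≤ C ∫ sup_{Q ∋ x} ⟨|M_Q⁻¹ f|⟩_Q^{2t} ⟨u_Q^{2t} φ⟩_Q`.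

To use it, write `M_Q⁻¹ f = (M_Q⁻¹ V^{-1/p})(V^{1/p} f)`. The adjoint of the first factor has
columns `V^{-1/p} M_Q^{-*} e_i`; the `p'`-th powers of their lengths are scalar weights with `A_∞`
characteristic at most `A` and averages at most a constant times `K^{p'/p}`
(`exists_reducing_pair`). The sharp reverse Hölder inequality then bounds `⟨|M_Q⁻¹ f|⟩` by `c
K^{1/p} ⟨|V^{1/p} f|^r⟩^{1/r}` with `p - r` of order `1/A`, and Doob's inequality for the maximal
function of order `r` costs a factor `A` at the level of `p`-th powers (`exists_exponent`).

For `p ≤ 2` the choice `t = p/2`, `φ = 1` gives `K A`. For `p > 2` take `t = 1` and `φ = S^{p/2-1}`: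
the averages of `u_Q² φ` are handled in the same way through the weights `|U^{1/p} e|^p`, and
Hölder's inequality lets a power of the finite quantity `∫ S^{p/2}` be absorbed. Finite trees
exhaust the grid by monotone convergence.

Sharpness. Take `W = σ^{1-p} Id` with `σ` a truncation of `|x - x₀|^{-d}` at about `2m` dyadic
scales, `x₀` a corner of a grid cube. Then `σ` is an `A_1` weight with constant of order `m`, so
`[W]_{A_p}` is at most of order `m^{p-1}` and the dual characteristic at most of order `m`; their
product is at most of order `m^p`. Testing on `σ` restricted to a unit cube at `x₀` and using one
Haar term per dyadic ring gives a norm of order at least `m`. -/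

theorem ext' {P Q : Cube d} (h : P.corner = Q.corner) (h' : P.side = Q.side) : P = Q := by
  cases P; cases Q; simp_all

theorem mem_toSet {Q : Cube d} {x : Fin d → ℝ} :
    x ∈ Q.toSet ↔ ∀ i, Q.corner i ≤ x i ∧ x i < Q.corner i + Q.side := by
  simp [toSet]

theorem corner_mem (Q : Cube d) : Q.corner ∈ Q.toSet :=
  mem_toSet.2 fun i => ⟨le_rfl, by linarith [Q.side_pos]⟩

theorem measurableSet (Q : Cube d) : MeasurableSet Q.toSet :=
  MeasurableSet.univ_pi fun _ => measurableSet_Ico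

theorem volume_toSet (Q : Cube d) : volume Q.toSet = ENNReal.ofReal Q.side ^ d := by
  simp [toSet, Real.volume_pi_Ico]

theorem volume_ne_zero (Q : Cube d) : volume Q.toSet ≠ 0 := by
  rw [volume_toSet]
  exact pow_ne_zero _ (by simpa using Q.side_pos)

theorem volume_ne_top (Q : Cube d) : volume Q.toSet ≠ ∞ := by
  rw [volume_toSet]
  exact ENNReal.pow_ne_top ENNReal.ofReal_ne_top

/-- The dyadic children of a cube, indexed by the sides of the bisecting hyperplanes. -/
def child (Q : Cube d) (ε : Fin d → Bool) : Cube d where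
  corner i := Q.corner i + if ε i then Q.side / 2 else 0
  side := Q.side / 2
  side_pos := half_pos Q.side_pos

/-- The index of the child of `Q` in which `x` lies. -/
def loc (Q : Cube d) (x : Fin d → ℝ) : Fin d → Bool :=
  fun i => decide (Q.corner i + Q.side / 2 ≤ x i)

/-- The child of `Q` containing `x`. -/
def sub (Q : Cube d) (x : Fin d → ℝ) : Cube d := Q.child (Q.loc x)

theorem mem_child {Q : Cube d} {ε : Fin d → Bool} {x : Fin d → ℝ} :
    x ∈ (Q.child ε).toSet ↔ x ∈ Q.toSet ∧ Q.loc x = ε := by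
  have hs := Q.side_pos
  simp only [mem_toSet, child, loc, funext_iff, ← forall_and]
  refine forall_congr' fun i => ?_
  cases h : ε i
  · simp only [Bool.false_eq_true, if_false, decide_eq_false_iff_not, not_le]
    constructor
    · rintro ⟨h1, h2⟩; exact ⟨⟨by linarith, by linarith⟩, by linarith⟩
    · rintro ⟨⟨h1, h2⟩, h3⟩; exact ⟨by linarith, by linarith⟩
  · simp only [if_true, decide_eq_true_eq]
    constructor
    · rintro ⟨h1, h2⟩; exact ⟨⟨by linarith, by linarith⟩, by linarith⟩
    · rintro ⟨⟨h1, h2⟩, h3⟩; exact ⟨by linarith, by linarith⟩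

theorem child_subset (Q : Cube d) (ε : Fin d → Bool) : (Q.child ε).toSet ⊆ Q.toSet :=
  fun _ hx => (mem_child.1 hx).1

theorem sub_eq_child {Q : Cube d} {ε : Fin d → Bool} {x : Fin d → ℝ}
    (hx : x ∈ (Q.child ε).toSet) : Q.sub x = Q.child ε := by
  rw [sub, (mem_child.1 hx).2]

theorem mem_sub {Q : Cube d} {x : Fin d → ℝ} (hx : x ∈ Q.toSet) : x ∈ (Q.sub x).toSet :=
  mem_child.2 ⟨hx, rfl⟩

theorem iUnion_child (Q : Cube d) : ⋃ ε, (Q.child ε).toSet = Q.toSet := by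
  ext x
  simp only [Set.mem_iUnion, mem_child]
  exact ⟨fun ⟨_, h, _⟩ => h, fun h => ⟨_, h, rfl⟩⟩

theorem child_disjoint (Q : Cube d) :
    Pairwise (Function.onFun Disjoint fun ε => (Q.child ε).toSet) := by
  intro ε ε' h
  refine Set.disjoint_left.2 fun x hx hx' => h ?_
  rw [← (mem_child.1 hx).2, ← (mem_child.1 hx').2]

theorem volume_child (Q : Cube d) (ε : Fin d → Bool) :
    2 ^ d * volume (Q.child ε).toSet = volume Q.toSet := by
  rw [volume_toSet, volume_toSet, ← mul_pow]
  congr 1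
  rw [show (2 : ℝ≥0∞) = ENNReal.ofReal 2 by simp, ← ENNReal.ofReal_mul (by norm_num)]
  congr 1
  simp only [child]; ring

theorem lintegral_children (Q : Cube d) (F : (Fin d → ℝ) → ℝ≥0∞) :
    ∫⁻ x in Q.toSet, F x = ∑ ε, ∫⁻ x in (Q.child ε).toSet, F x := by
  rw [← iUnion_child, lintegral_iUnion (fun ε => measurableSet _) Q.child_disjoint, tsum_fintype]

theorem volume_children (Q : Cube d) : volume Q.toSet = ∑ ε, volume (Q.child ε).toSet := by
  simpa using Q.lintegral_children fun _ => 1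

theorem integral_children {E : Type*} [NormedAddCommGroup E] [NormedSpace ℝ E] (Q : Cube d)
    {F : (Fin d → ℝ) → E} (hF : IntegrableOn F Q.toSet) :
    ∫ x in Q.toSet, F x = ∑ ε, ∫ x in (Q.child ε).toSet, F x := by
  rw [← iUnion_child, integral_iUnion_fintype (fun ε => measurableSet _) Q.child_disjoint]
  exact fun ε => hF.mono_set (Q.child_subset ε)

theorem measurable_loc (Q : Cube d) : Measurable Q.loc := by
  refine measurable_pi_lambda _ fun i => ?_
  refine measurable_to_bool ?_
  have : (fun x : Fin d → ℝ => Q.loc x i) ⁻¹' {true} = {x | Q.corner i + Q.side / 2 ≤ x i} := by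
    ext x; simp [loc]
  rw [this]
  exact measurableSet_le measurable_const (measurable_pi_apply i)

/-- The average of a nonnegative function over a cube. -/
abbrev avg (Q : Cube d) (F : (Fin d → ℝ) → ℝ≥0∞) : ℝ≥0∞ := ⨍⁻ x in Q.toSet, F x ∂volume

theorem avg_eq_div (Q : Cube d) (F : (Fin d → ℝ) → ℝ≥0∞) :
    Q.avg F = (∫⁻ x in Q.toSet, F x) / volume Q.toSet :=
  setLAverage_eq _ _ _

theorem avg_mul_volume (Q : Cube d) (F : (Fin d → ℝ) → ℝ≥0∞) :
    Q.avg F * volume Q.toSet = ∫⁻ x in Q.toSet, F x := by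
  rw [avg_eq_div, ENNReal.div_mul_cancel Q.volume_ne_zero Q.volume_ne_top]

theorem setLIntegral_const (Q : Cube d) (c : ℝ≥0∞) :
    ∫⁻ _ in Q.toSet, c = c * volume Q.toSet := by
  simp

end Cube

/-! ### Sums and maxima along the dyadic descent to a point -/

section Paths

variable {d : ℕ}

/-- The sum of `F Q x` over the first `k` cubes `Q` of the dyadic descent from `L` to `x`. -/
def pathSum : ℕ → (Cube d → (Fin d → ℝ) → ℝ≥0∞) → Cube d → (Fin d → ℝ) → ℝ≥0∞
  | 0, _, _, _ => 0
  | k + 1, F, L, x => F L x + pathSum k F (L.sub x) x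

/-- The maximum of `b Q` over the first `k + 1` cubes `Q` of the dyadic descent from `L` to `x`. -/
def pathSup : ℕ → (Cube d → ℝ≥0∞) → Cube d → (Fin d → ℝ) → ℝ≥0∞
  | 0, b, L, _ => b L
  | k + 1, b, L, x => b L ⊔ pathSup k b (L.sub x) x

theorem pathSum_succ_of_mem (k : ℕ) (F : Cube d → (Fin d → ℝ) → ℝ≥0∞) {L : Cube d}
    {ε : Fin d → Bool} {x : Fin d → ℝ} (hx : x ∈ (L.child ε).toSet) :
    pathSum (k + 1) F L x = F L x + pathSum k F (L.child ε) x := by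
  rw [pathSum, Cube.sub_eq_child hx]

theorem pathSup_succ_of_mem (k : ℕ) (b : Cube d → ℝ≥0∞) {L : Cube d}
    {ε : Fin d → Bool} {x : Fin d → ℝ} (hx : x ∈ (L.child ε).toSet) :
    pathSup (k + 1) b L x = b L ⊔ pathSup k b (L.child ε) x := by
  rw [pathSup, Cube.sub_eq_child hx]

theorem le_pathSup (k : ℕ) (b : Cube d → ℝ≥0∞) (L : Cube d) (x : Fin d → ℝ) :
    b L ≤ pathSup k b L x := by
  cases k
  · exact le_rfl
  · exact le_sup_left

theorem aemeasurable_comp_loc (L : Cube d) {g : (Fin d → Bool) → (Fin d → ℝ) → ℝ≥0∞}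
    (hg : ∀ ε, AEMeasurable (g ε) volume) : AEMeasurable (fun x => g (L.loc x) x) volume := by
  classical
  have : (fun x => g (L.loc x) x) =
      fun x => ∑ ε, (L.loc ⁻¹' {ε}).indicator (g ε) x := by
    ext x
    rw [Finset.sum_eq_single (L.loc x)]
    · simp
    · intro ε _ h
      exact Set.indicator_of_notMem (by simpa using h.symm) _
    · simp
  rw [this]
  exact Finset.aemeasurable_fun_sum _ fun ε _ =>
    (hg ε).indicator (L.measurable_loc (measurableSet_singleton ε))

theorem aemeasurable_pathSum (k : ℕ) {F : Cube d → (Fin d → ℝ) → ℝ≥0∞}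
    (hF : ∀ Q, AEMeasurable (F Q) volume) (L : Cube d) :
    AEMeasurable (pathSum k F L) volume := by
  induction k generalizing L with
  | zero => exact aemeasurable_const
  | succ k ih => exact (hF L).add (aemeasurable_comp_loc L fun ε => ih (L.child ε))

theorem aemeasurable_pathSup (k : ℕ) (b : Cube d → ℝ≥0∞) (L : Cube d) :
    AEMeasurable (pathSup k b L) volume := by
  induction k generalizing L with
  | zero => exact aemeasurable_const
  | succ k ih => exact aemeasurable_const.sup (aemeasurable_comp_loc L fun ε => ih (L.child ε))

/-- Only finitely many cubes are reached in `k` generations. This finiteness is what allows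
cancellation in `ℝ≥0∞` in the absorption arguments for maximal functions. -/
theorem pathSup_lt_top (k : ℕ) {b : Cube d → ℝ≥0∞} {L : Cube d}
    (hb : ∀ Q : Cube d, Q.toSet ⊆ L.toSet → b Q < ∞) :
    ∃ K < ∞, ∀ x ∈ L.toSet, pathSup k b L x ≤ K := by
  induction k generalizing L with
  | zero => exact ⟨b L, hb L subset_rfl, fun x _ => le_rfl⟩
  | succ k ih =>
    choose K hK hK' using fun ε : Fin d → Bool =>
      ih (L := L.child ε) fun Q hQ => hb Q (hQ.trans (L.child_subset ε))
    refine ⟨b L ⊔ ∑ ε, K ε, max_lt (hb L subset_rfl) (ENNReal.sum_lt_top.2 fun ε _ => hK ε), ?_⟩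
    intro x hx
    refine sup_le_sup_left ?_ _
    exact (hK' _ x (Cube.mem_sub hx)).trans
      (Finset.single_le_sum (f := K) (fun _ _ => zero_le) (Finset.mem_univ _))

theorem pathSup_mono (k : ℕ) {b c : Cube d → ℝ≥0∞} (L : Cube d) {x : Fin d → ℝ}
    (hx : x ∈ L.toSet)
    (h : ∀ Q : Cube d, Q.toSet ⊆ L.toSet → x ∈ Q.toSet → b Q ≤ c Q) :
    pathSup k b L x ≤ pathSup k c L x := by
  induction k generalizing L with
  | zero => exact h L subset_rfl hx
  | succ k ih =>
    exact sup_le_sup (h L subset_rfl hx) (ih _ (Cube.mem_sub hx) fun Q hQ =>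
      h Q (hQ.trans (L.child_subset _)))

theorem pathSup_le (k : ℕ) {b : Cube d → ℝ≥0∞} (L : Cube d) {x : Fin d → ℝ} {c : ℝ≥0∞}
    (hx : x ∈ L.toSet) (h : ∀ Q : Cube d, Q.toSet ⊆ L.toSet → x ∈ Q.toSet → b Q ≤ c) :
    pathSup k b L x ≤ c := by
  induction k generalizing L with
  | zero => exact h L subset_rfl hx
  | succ k ih =>
    exact sup_le (h L subset_rfl hx) (ih _ (Cube.mem_sub hx) fun Q hQ =>
      h Q (hQ.trans (L.child_subset _)))

/-- Monotone maps commute with maxima along a path. -/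
theorem pathSup_comp (k : ℕ) {φ : ℝ≥0∞ → ℝ≥0∞} (hφ : Monotone φ) (b : Cube d → ℝ≥0∞)
    (L : Cube d) (x : Fin d → ℝ) :
    pathSup k (fun Q => φ (b Q)) L x = φ (pathSup k b L x) := by
  induction k generalizing L with
  | zero => rfl
  | succ k ih => rw [pathSup, pathSup, ih, hφ.map_sup]

end Paths

/-! ### Dyadic grids -/

section Grid

variable {d : ℕ} {D : Set (Cube d)}

theorem IsDyadicGrid.eq_of_mem (hD : IsDyadicGrid D) {P Q : Cube d} (hP : P ∈ D) (hQ : Q ∈ D)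
    (hs : P.side = Q.side) {x : Fin d → ℝ} (hxP : x ∈ P.toSet) (hxQ : x ∈ Q.toSet) : P = Q := by
  obtain ⟨k, hk⟩ := hD.side_eq P hP
  exact (hD.partition k x).unique ⟨hP, hk, hxP⟩ ⟨hQ, hs ▸ hk, hxQ⟩

theorem Cube.side_le_of_subset [NeZero d] {P Q : Cube d} (h : P.toSet ⊆ Q.toSet) :
    P.side ≤ Q.side := by
  by_contra! hlt
  have hs := P.side_pos
  have h0 := Q.side_pos
  have hc := Cube.mem_toSet.1 (h P.corner_mem) 0
  have hx : (fun i => P.corner i + Q.side) ∈ P.toSet :=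
    Cube.mem_toSet.2 fun i => ⟨by linarith, by linarith⟩
  have := Cube.mem_toSet.1 (h hx) 0
  linarith

theorem IsDyadicGrid.subset_of_side_le [NeZero d] (hD : IsDyadicGrid D) {P Q : Cube d} (hP : P ∈ D)
    (hQ : Q ∈ D) (hs : P.side ≤ Q.side) {x : Fin d → ℝ} (hxP : x ∈ P.toSet)
    (hxQ : x ∈ Q.toSet) : P.toSet ⊆ Q.toSet := by
  rcases hD.nested P hP Q hQ with h | h | h
  · exact h
  · have : P = Q := hD.eq_of_mem hP hQ (le_antisymm hs (Cube.side_le_of_subset h)) hxP hxQ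
    exact this ▸ subset_rfl
  · exact absurd hxQ (Set.disjoint_left.1 h hxP)

/-- The axioms of a grid speak of nestedness, not of bisection. The grid cube of half the side
through the corner of the child lies in `Q`. If it were displaced in a direction where the child
sits in the upper half, a grid cube of the same side touching the lower face of `Q` would overlap
it. -/
theorem IsDyadicGrid.child_mem [NeZero d] (hD : IsDyadicGrid D) {Q : Cube d} (hQ : Q ∈ D)
    (ε : Fin d → Bool) : Q.child ε ∈ D := by
  obtain ⟨k, hk⟩ := hD.side_eq Q hQ
  have hhalf : Q.side / 2 = (2 : ℝ) ^ (k - 1) := by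
    rw [hk, zpow_sub₀ (by norm_num)]; norm_num
  have hs := Q.side_pos
  -- cubes of the next generation meeting `Q`
  have key : ∀ z ∈ Q.toSet, ∃ P ∈ D, P.side = Q.side / 2 ∧ z ∈ P.toSet ∧ P.toSet ⊆ Q.toSet := by
    intro z hz
    obtain ⟨P, ⟨hP, hPs, hzP⟩, -⟩ := hD.partition (k - 1) z
    exact ⟨P, hP, hPs.trans hhalf.symm, hzP,
      hD.subset_of_side_le hP hQ (by rw [hPs, ← hhalf]; linarith) hzP hz⟩
  have hcQ : (Q.child ε).corner ∈ Q.toSet := Q.child_subset ε (Q.child ε).corner_mem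
  obtain ⟨P, hP, hPs, hzP, hPQ⟩ := key _ hcQ
  suffices P.corner = (Q.child ε).corner by
    have hPe : P = Q.child ε := Cube.ext' this hPs
    rwa [← hPe]
  funext i
  have h1 := Cube.mem_toSet.1 (hPQ P.corner_mem)
  have h2 := Cube.mem_toSet.1 hzP i
  have hle : P.corner i + P.side ≤ Q.corner i + Q.side := by
    by_contra! hlt
    have hy : (fun j => if j = i then max (P.corner i) (Q.corner i + Q.side) else P.corner j) ∈
        P.toSet := by
      refine Cube.mem_toSet.2 fun j => ?_
      have := P.side_pos
      by_cases hj : j = i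
      · subst hj
        simp only [if_true]
        exact ⟨le_max_left _ _, max_lt (by linarith) hlt⟩
      · simp only [hj, if_false]
        exact ⟨le_rfl, by linarith⟩
    have h3 := (Cube.mem_toSet.1 (hPQ hy) i).2
    simp only [if_true] at h3
    linarith [le_max_right (P.corner i) (Q.corner i + Q.side)]
  cases hε : ε i
  · simp only [Cube.child, hε] at h2 ⊢
    have := (h1 i).1
    simp at h2 ⊢
    linarith
  · by_contra hne
    simp only [Cube.child, hε, if_true] at h2 hne
    have hlt : P.corner i < Q.corner i + Q.side / 2 := lt_of_le_of_ne h2.1 hne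
    have hgt : Q.corner i < P.corner i := by
      rcases (h1 i).1.lt_or_eq with h | h
      · exact h
      · rw [hPs] at h2; linarith
    -- the neighbour of `P` on the left would overlap `P`
    have hz : Function.update P.corner i (Q.corner i) ∈ Q.toSet := by
      refine Cube.mem_toSet.2 fun j => ?_
      by_cases hj : j = i
      · subst hj; simp [hs]
      · rw [Function.update_of_ne hj]; exact h1 j
    obtain ⟨R, hR, hRs, hzR, hRQ⟩ := key _ hz
    have hRi : R.corner i = Q.corner i := by
      have h3 := (Cube.mem_toSet.1 (hRQ R.corner_mem) i).1
      have h4 := (Cube.mem_toSet.1 hzR i).1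
      simp at h4
      linarith
    have hPR : P.corner ∈ R.toSet := by
      refine Cube.mem_toSet.2 fun j => ?_
      by_cases hj : j = i
      · subst hj; rw [hRi, hRs]; exact ⟨hgt.le, hlt⟩
      · simpa [Function.update_of_ne hj] using Cube.mem_toSet.1 hzR j
    have := hD.eq_of_mem hP hR (hPs.trans hRs.symm) P.corner_mem hPR
    rw [this, hRi] at hgt
    exact lt_irrefl _ hgt

theorem Cube.child_ssubset [NeZero d] (Q : Cube d) (ε : Fin d → Bool) :
    (Q.child ε).toSet ⊂ Q.toSet := by
  refine ⟨Q.child_subset ε, fun h => ?_⟩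
  have h1 := Cube.side_le_of_subset h
  have h2 := Q.side_pos
  simp only [Cube.child] at h1
  linarith

end Grid

end MatrixSquare

end

noncomputable section

namespace MatrixSquare

/-! ### Haar systems -/

section Haar

variable {d n : ℕ} {D : Set (Cube d)}
  {h : Cube d → Fin (2 ^ d - 1) → (Fin d → ℝ) → ℂ}

theorem Cube.volume_real_child (Q : Cube d) (ε : Fin d → Bool) :
    volume.real (Q.child ε).toSet = (Q.side / 2) ^ d := by
  rw [Measure.real, Cube.volume_toSet, ENNReal.toReal_pow,
    ENNReal.toReal_ofReal (Q.child ε).side_pos.le]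
  rfl

/-- Integrals against functions which are constant on the children of a cube. -/
theorem Cube.integral_step_smul {E : Type*} [NormedAddCommGroup E] [NormedSpace ℂ E]
    [CompleteSpace E] (J : Cube d) {g : (Fin d → ℝ) → ℂ} {c : (Fin d → Bool) → ℂ}
    (hg : ∀ ε, ∀ x ∈ (J.child ε).toSet, g x = c ε) {v : (Fin d → ℝ) → E}
    (hv : IntegrableOn v J.toSet) :
    ∫ x in J.toSet, g x • v x = ∑ ε, c ε • ∫ x in (J.child ε).toSet, v x := by
  have key : ∀ ε, Set.EqOn (fun x => g x • v x) (fun x => c ε • v x) (J.child ε).toSet :=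
    fun ε x hx => by simp only [hg ε x hx]
  have hint : IntegrableOn (fun x => g x • v x) J.toSet := by
    rw [← Cube.iUnion_child, integrableOn_finite_iUnion]
    intro ε
    exact (integrableOn_congr_fun (key ε) (J.child ε).measurableSet).2
      ((hv.mono_set (J.child_subset ε)).smul (c ε))
  rw [J.integral_children hint]
  refine Finset.sum_congr rfl fun ε _ => ?_
  rw [setIntegral_congr_fun (J.child ε).measurableSet (key ε), integral_smul]

variable [NeZero d]

theorem IsHaarSystem.eq_on_child (hh : IsHaarSystem D h) (hD : IsDyadicGrid D) {J : Cube d}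
    (hJ : J ∈ D) (κ : Fin (2 ^ d - 1)) (ε : Fin d → Bool) {x : Fin d → ℝ}
    (hx : x ∈ (J.child ε).toSet) : h J κ x = h J κ (J.child ε).corner :=
  hh.const J hJ κ _ (hD.child_mem hJ ε) (J.child_ssubset ε) _ hx _ (J.child ε).corner_mem

theorem IsHaarSystem.haarCoeff_eq (hh : IsHaarSystem D h) (hD : IsDyadicGrid D) {J : Cube d}
    (hJ : J ∈ D) {v : (Fin d → ℝ) → EuclideanSpace ℂ (Fin n)} (hv : IntegrableOn v J.toSet)
    (κ : Fin (2 ^ d - 1)) :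
    haarCoeff h v J κ = ∑ ε, h J κ (J.child ε).corner • ∫ x in (J.child ε).toSet, v x :=
  J.integral_step_smul (fun ε _ hx => hh.eq_on_child hD hJ κ ε hx) hv

theorem IsHaarSystem.sum_corner (hh : IsHaarSystem D h) (hD : IsDyadicGrid D) {J : Cube d}
    (hJ : J ∈ D) (κ : Fin (2 ^ d - 1)) : ∑ ε, h J κ (J.child ε).corner = 0 := by
  have h0 := hh.mean_zero J hJ κ
  have h1 := J.integral_step_smul (v := fun _ => (1 : ℂ))
    (fun ε _ hx => hh.eq_on_child hD hJ κ ε hx)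
    (integrableOn_const (J.volume_ne_top))
  simp only [smul_eq_mul, mul_one, h0, setIntegral_const, Cube.volume_real_child] at h1
  rw [← Finset.sum_mul] at h1
  have : (((J.side / 2) ^ d : ℝ) • (1 : ℂ)) ≠ 0 := by
    have := J.side_pos
    exact smul_ne_zero (by positivity) one_ne_zero
  exact (mul_eq_zero.1 h1.symm).resolve_right this

theorem IsHaarSystem.sum_corner_mul (hh : IsHaarSystem D h) (hD : IsDyadicGrid D) {J : Cube d}
    (hJ : J ∈ D) (κ κ' : Fin (2 ^ d - 1)) :
    (∑ ε, h J κ (J.child ε).corner * (starRingEnd ℂ) (h J κ' (J.child ε).corner)) *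
      ((J.side / 2) ^ d : ℝ) = if κ = κ' then 1 else 0 := by
  have h0 : ∫ x, h J κ x * (starRingEnd ℂ) (h J κ' x) = if κ = κ' then 1 else 0 := by
    split_ifs with hκ
    · subst hκ; exact hh.norm_one J hJ κ
    · exact hh.orthogonal J hJ κ J hJ κ' fun h => hκ (Prod.ext_iff.1 h).2
  have h1 := J.integral_step_smul (v := fun _ => (1 : ℂ))
    (g := fun x => h J κ x * (starRingEnd ℂ) (h J κ' x))
    (c := fun ε => h J κ (J.child ε).corner * (starRingEnd ℂ) (h J κ' (J.child ε).corner))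
    (fun ε x hx => by
      simp only [hh.eq_on_child hD hJ κ ε hx, hh.eq_on_child hD hJ κ' ε hx])
    (integrableOn_const (J.volume_ne_top))
  simp only [smul_eq_mul, mul_one, setIntegral_const, Cube.volume_real_child] at h1
  rw [setIntegral_eq_integral_of_forall_compl_eq_zero, h0] at h1
  · rw [h1, Finset.sum_mul]
    simp
  · intro x hx
    rw [hh.support J hJ κ x hx, zero_mul]

/-- **Parseval's identity** on a single cube: together with the constants, the Haar functions of
a cube form an orthonormal basis of the functions which are constant on its children. -/
theorem IsHaarSystem.parseval_scalar (hh : IsHaarSystem D h) (hD : IsDyadicGrid D) {J : Cube d}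
    (hJ : J ∈ D) (y : (Fin d → Bool) → ℂ) :
    (∑ κ, ‖∑ ε, h J κ (J.child ε).corner * y ε‖ ^ 2) * (J.side / 2) ^ d +
      ‖∑ ε, y ε‖ ^ 2 / 2 ^ d = ∑ ε, ‖y ε‖ ^ 2 := by
  classical
  have hs := J.side_pos
  set m : ℝ := (J.side / 2) ^ d with hm
  have hm0 : 0 < m := by positivity
  have hsq : ((√m : ℝ) : ℂ) * (√m : ℝ) = (m : ℝ) := by
    rw [← Complex.ofReal_mul, Real.mul_self_sqrt hm0.le]
  have h2 : ((√((2 : ℝ) ^ d)⁻¹ : ℝ) : ℂ) * (√((2 : ℝ) ^ d)⁻¹ : ℝ) = (((2 : ℝ) ^ d)⁻¹ : ℝ) := by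
    rw [← Complex.ofReal_mul, Real.mul_self_sqrt (by positivity)]
  -- The value vectors of the Haar functions, conjugated so that inner products give coefficients
  -- and scaled by the square root of the volume of a child, together with the normalized constant
  -- vector.
  let w : Option (Fin (2 ^ d - 1)) → EuclideanSpace ℂ (Fin d → Bool) := fun o =>
    match o with
    | none => WithLp.toLp 2 fun _ => ((√((2 : ℝ) ^ d)⁻¹ : ℝ) : ℂ)
    | some κ => WithLp.toLp 2 fun ε =>
        (starRingEnd ℂ) (h J κ (J.child ε).corner) * (√m : ℝ)
  have hw : Orthonormal ℂ w := by
    rw [orthonormal_iff_ite]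
    rintro (_ | κ) (_ | κ')
    · simp only [w, PiLp.inner_apply, RCLike.inner_apply, Complex.conj_ofReal, if_true,
        Finset.sum_const, h2]
      simp
    · have := hh.sum_corner hD hJ κ'
      simp only [w, PiLp.inner_apply, RCLike.inner_apply, Complex.conj_ofReal, reduceCtorEq,
        if_false]
      rw [← Finset.sum_mul, ← Finset.sum_mul, ← map_sum, this]
      simp
    · have := hh.sum_corner hD hJ κ
      simp only [w, PiLp.inner_apply, RCLike.inner_apply, Complex.conj_ofReal, reduceCtorEq,
        if_false, map_mul, Complex.conj_conj]
      rw [← Finset.mul_sum, ← Finset.sum_mul, this]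
      simp
    · have := hh.sum_corner_mul hD hJ κ κ'
      simp only [w, PiLp.inner_apply, RCLike.inner_apply, Complex.conj_ofReal,
        map_mul, Complex.conj_conj, Option.some.injEq]
      rw [← this, ← hm, ← hsq, Finset.sum_mul]
      refine Finset.sum_congr rfl fun ε _ => ?_
      ring
  -- Here the number `2 ^ d - 1` of Haar functions per cube matters: with the constant vector the
  -- orthonormal family is complete.
  have hcard : Module.finrank ℂ (EuclideanSpace ℂ (Fin d → Bool)) =
      Fintype.card (Option (Fin (2 ^ d - 1))) := by
    have : 1 ≤ 2 ^ d := Nat.one_le_two_pow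
    simp
    omega
  obtain ⟨b, hb⟩ := Orthonormal.exists_orthonormalBasis_extension_of_card_eq hcard
    (s := Set.univ) (v := w) (hw.comp _ Subtype.val_injective)
  have hP := b.sum_sq_norm_inner_right (WithLp.toLp 2 y)
  rw [Fintype.sum_option, EuclideanSpace.norm_sq_eq] at hP
  simp only [hb _ (Set.mem_univ _)] at hP
  rw [← hP, add_comm, Finset.sum_mul]
  congr 1
  · simp only [w, PiLp.inner_apply, RCLike.inner_apply, Complex.conj_ofReal]
    rw [← Finset.sum_mul, norm_mul, mul_pow, Complex.norm_real, Real.norm_eq_abs, sq_abs,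
      Real.sq_sqrt (by positivity), div_eq_mul_inv]
  · refine Finset.sum_congr rfl fun κ _ => ?_
    simp only [w, PiLp.inner_apply, RCLike.inner_apply, Complex.conj_ofReal, map_mul,
      Complex.conj_conj]
    have : ∀ ε, y ε * (h J κ (J.child ε).corner * ((√m : ℝ) : ℂ)) =
        h J κ (J.child ε).corner * y ε * ((√m : ℝ) : ℂ) := fun ε => by ring
    simp only [this]
    rw [← Finset.sum_mul, norm_mul, mul_pow, Complex.norm_real, Real.norm_eq_abs, sq_abs,
      Real.sq_sqrt hm0.le]

theorem IsHaarSystem.parseval (hh : IsHaarSystem D h) (hD : IsDyadicGrid D) {J : Cube d}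
    (hJ : J ∈ D) {v : (Fin d → ℝ) → EuclideanSpace ℂ (Fin n)} (hv : IntegrableOn v J.toSet) :
    (∑ κ, ‖haarCoeff h v J κ‖ ^ 2) * (J.side / 2) ^ d + ‖∫ x in J.toSet, v x‖ ^ 2 / 2 ^ d =
      ∑ ε, ‖∫ x in (J.child ε).toSet, v x‖ ^ 2 := by
  simp only [hh.haarCoeff_eq hD hJ hv, J.integral_children hv, EuclideanSpace.norm_sq_eq,
    WithLp.ofLp_sum, Finset.sum_apply, WithLp.ofLp_smul, Pi.smul_apply, smul_eq_mul]
  rw [Finset.sum_comm, Finset.sum_comm (s := Finset.univ (α := Fin d → Bool)), Finset.sum_mul,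
    Finset.sum_div, ← Finset.sum_add_distrib]
  exact Finset.sum_congr rfl fun i _ => hh.parseval_scalar hD hJ fun ε =>
    (∫ x in (J.child ε).toSet, v x) i

/-- The contribution of the cube `J` to the square of the unweighted square function of `v`. -/
def haarSq (h : Cube d → Fin (2 ^ d - 1) → (Fin d → ℝ) → ℂ)
    (v : (Fin d → ℝ) → EuclideanSpace ℂ (Fin n)) (J : Cube d) : ℝ≥0∞ :=
  (∑ κ, ‖haarCoeff h v J κ‖ₑ ^ 2) / volume J.toSet

theorem enorm_sq_eq_ofReal {E : Type*} [SeminormedAddGroup E] (v : E) :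
    ‖v‖ₑ ^ 2 = ENNReal.ofReal (‖v‖ ^ 2) := by
  rw [← ofReal_norm, ENNReal.ofReal_pow (norm_nonneg _)]

/-- The telescoping form of Parseval: the Haar part of `J` is the increment of `|∫ v|² / |·|` from
`J` to its children. -/
theorem IsHaarSystem.parseval_enorm (hh : IsHaarSystem D h) (hD : IsDyadicGrid D) {J : Cube d}
    (hJ : J ∈ D) {v : (Fin d → ℝ) → EuclideanSpace ℂ (Fin n)} (hv : IntegrableOn v J.toSet) :
    haarSq h v J * volume J.toSet + ‖∫ x in J.toSet, v x‖ₑ ^ 2 / volume J.toSet =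
      ∑ ε, ‖∫ x in (J.child ε).toSet, v x‖ₑ ^ 2 / volume (J.child ε).toSet := by
  have hs := J.side_pos
  have hP := hh.parseval hD hJ hv
  have hm : 0 < (J.side / 2) ^ d := by positivity
  have hvol : ∀ ε, volume (J.child ε).toSet = ENNReal.ofReal ((J.side / 2) ^ d) := by
    intro ε
    rw [Cube.volume_toSet, ENNReal.ofReal_pow (by positivity)]; rfl
  have hvolJ : volume J.toSet = ENNReal.ofReal (2 ^ d * (J.side / 2) ^ d) := by
    rw [Cube.volume_toSet, ← ENNReal.ofReal_pow hs.le, ← mul_pow]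
    congr 2; ring
  rw [haarSq, ENNReal.div_mul_cancel J.volume_ne_zero J.volume_ne_top]
  simp only [hvol, hvolJ, enorm_sq_eq_ofReal]
  rw [← ENNReal.ofReal_sum_of_nonneg fun _ _ => by positivity,
    ← ENNReal.ofReal_div_of_pos (by positivity), ← ENNReal.ofReal_add
      (Finset.sum_nonneg fun _ _ => by positivity) (by positivity)]
  simp only [← ENNReal.ofReal_div_of_pos hm]
  rw [← ENNReal.ofReal_sum_of_nonneg fun _ _ => by positivity]
  congr 1
  rw [← Finset.sum_div, ← hP]
  field_simp

end Haar

end MatrixSquare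

end

noncomputable section

namespace MatrixSquare

/-! ### Weak type estimate and sparse domination -/

section Sparse

variable {d n : ℕ} {D : Set (Cube d)}
  {h : Cube d → Fin (2 ^ d - 1) → (Fin d → ℝ) → ℂ}

theorem Cube.inv_volume_child (Q : Cube d) (ε : Fin d → Bool) :
    (volume (Q.child ε).toSet)⁻¹ = 2 ^ d * (volume Q.toSet)⁻¹ := by
  rw [← Q.volume_child ε, ENNReal.mul_inv (Or.inl (by simp)) (Or.inl (by simp)), ← mul_assoc,
    ENNReal.mul_inv_cancel (by simp) (by simp), one_mul]

theorem haarSq_eq_zero {v : (Fin d → ℝ) → EuclideanSpace ℂ (Fin n)} {J : Cube d}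
    (hv : ∀ᵐ x ∂volume.restrict J.toSet, v x = 0) : haarSq h v J = 0 := by
  have : ∀ κ, haarCoeff h v J κ = 0 := fun κ => by
    rw [haarCoeff]
    refine integral_eq_zero_of_ae ?_
    filter_upwards [hv] with x hx
    simp [hx]
  simp [haarSq, this]

theorem pathSum_haarSq_eq_zero {v : (Fin d → ℝ) → EuclideanSpace ℂ (Fin n)} (k : ℕ) {J : Cube d}
    (hv : ∀ᵐ x ∂volume.restrict J.toSet, v x = 0) (x : Fin d → ℝ) :
    pathSum k (fun Q _ => haarSq h v Q) J x = 0 := by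
  induction k generalizing J with
  | zero => rfl
  | succ k ih =>
    rw [pathSum, haarSq_eq_zero hv, ih, zero_add]
    exact ae_mono (Measure.restrict_mono (J.child_subset _) le_rfl) hv

variable [NeZero d]

/-- The Calderón-Zygmund stopping argument, as an induction along the tree. -/
theorem IsHaarSystem.exists_stopping (hh : IsHaarSystem D h) (hD : IsDyadicGrid D)
    {v : (Fin d → ℝ) → EuclideanSpace ℂ (Fin n)} {Λ : ℝ≥0∞} (k : ℕ) {J : Cube d} (hJ : J ∈ D)
    (hv : IntegrableOn v J.toSet) (hΛ : ∫⁻ x in J.toSet, ‖v x‖ₑ ≤ Λ * volume J.toSet) :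
    ∃ B ⊆ J.toSet, MeasurableSet B ∧ Λ * volume B ≤ ∫⁻ x in B, ‖v x‖ₑ ∧
      (∫⁻ x in J.toSet \ B, pathSum k (fun Q _ => haarSq h v Q) J x) +
        ‖∫ x in J.toSet, v x‖ₑ ^ 2 / volume J.toSet ≤
      2 ^ d * Λ * ∫⁻ x in J.toSet, ‖v x‖ₑ := by
  induction k generalizing J with
  | zero =>
    refine ⟨∅, Set.empty_subset _, MeasurableSet.empty, by simp, ?_⟩
    have h1 : ‖∫ x in J.toSet, v x‖ₑ ≤ ∫⁻ x in J.toSet, ‖v x‖ₑ := enorm_integral_le_lintegral_enorm _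
    simp only [pathSum, lintegral_zero, zero_add]
    calc ‖∫ x in J.toSet, v x‖ₑ ^ 2 / volume J.toSet
        ≤ (∫⁻ x in J.toSet, ‖v x‖ₑ) * (Λ * volume J.toSet) / volume J.toSet := by
          rw [sq]; gcongr; exact h1.trans hΛ
      _ = Λ * ∫⁻ x in J.toSet, ‖v x‖ₑ := by
          rw [← mul_assoc, ENNReal.mul_div_cancel_right J.volume_ne_zero J.volume_ne_top, mul_comm]
      _ ≤ _ := by
          gcongr
          exact le_mul_of_one_le_left zero_le (one_le_pow₀ (by norm_num))
  | succ k ih =>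
    have step : ∀ ε, ∃ B ⊆ (J.child ε).toSet, MeasurableSet B ∧
        Λ * volume B ≤ ∫⁻ x in B, ‖v x‖ₑ ∧
        (∫⁻ x in (J.child ε).toSet \ B, pathSum k (fun Q _ => haarSq h v Q) (J.child ε) x) +
          ‖∫ x in (J.child ε).toSet, v x‖ₑ ^ 2 / volume (J.child ε).toSet ≤
        2 ^ d * Λ * ∫⁻ x in (J.child ε).toSet, ‖v x‖ₑ := by
      intro ε
      have hvε := hv.mono_set (J.child_subset ε)
      rcases le_total (∫⁻ x in (J.child ε).toSet, ‖v x‖ₑ) (Λ * volume (J.child ε).toSet) with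
        hle | hle
      · exact ih (hD.child_mem hJ ε) hvε hle
      -- A stopping child goes entirely into `B`. Its Parseval term is paid for by the parent, whose
      -- average is still at most `Λ`; passing to the volume of the parent costs `2 ^ d`.
      · refine ⟨_, subset_rfl, (J.child ε).measurableSet, hle, ?_⟩
        have h1 : ‖∫ x in (J.child ε).toSet, v x‖ₑ ≤ ∫⁻ x in (J.child ε).toSet, ‖v x‖ₑ :=
          enorm_integral_le_lintegral_enorm _
        have h2 : ‖∫ x in (J.child ε).toSet, v x‖ₑ ≤ Λ * volume J.toSet :=
          (h1.trans (lintegral_mono_set (J.child_subset ε))).trans hΛ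
        simp only [Set.sdiff_self, Measure.restrict_empty, lintegral_zero_measure, zero_add]
        calc ‖∫ x in (J.child ε).toSet, v x‖ₑ ^ 2 / volume (J.child ε).toSet
            ≤ (∫⁻ x in (J.child ε).toSet, ‖v x‖ₑ) * (Λ * volume J.toSet) *
                (2 ^ d * (volume J.toSet)⁻¹) := by
              rw [sq, div_eq_mul_inv, J.inv_volume_child ε]; gcongr
          _ = 2 ^ d * Λ * (∫⁻ x in (J.child ε).toSet, ‖v x‖ₑ) *
                (volume J.toSet * (volume J.toSet)⁻¹) := by ring
          _ = _ := by rw [ENNReal.mul_inv_cancel J.volume_ne_zero J.volume_ne_top, mul_one]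
    choose B hBs hBm hB1 hB2 using step
    have hBd : Pairwise (Function.onFun Disjoint B) := fun ε ε' hne =>
      (J.child_disjoint hne).mono (hBs ε) (hBs ε')
    have hdiff : J.toSet \ ⋃ ε, B ε = ⋃ ε, ((J.child ε).toSet \ B ε) := by
      ext x
      simp only [← J.iUnion_child, Set.mem_sdiff, Set.mem_iUnion, not_exists]
      constructor
      · rintro ⟨⟨ε, hx⟩, hxB⟩; exact ⟨ε, hx, hxB ε⟩
      · rintro ⟨ε, hx, hxB⟩
        refine ⟨⟨ε, hx⟩, fun ε' hx' => ?_⟩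
        by_cases hne : ε' = ε
        · exact hxB (hne ▸ hx')
        · exact Set.disjoint_left.1 (J.child_disjoint hne) (hBs ε' hx') hx
    refine ⟨⋃ ε, B ε, ?_, MeasurableSet.iUnion hBm, ?_, ?_⟩
    · exact Set.iUnion_subset fun ε => (hBs ε).trans (J.child_subset ε)
    · rw [measure_iUnion hBd hBm, lintegral_iUnion hBm hBd, tsum_fintype, tsum_fintype,
        Finset.mul_sum]
      exact Finset.sum_le_sum fun ε _ => hB1 ε
    · have hm : ∀ ε, MeasurableSet ((J.child ε).toSet \ B ε) := fun ε =>
        (J.child ε).measurableSet.diff (hBm ε)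
      rw [hdiff, lintegral_iUnion hm fun ε ε' hne => (J.child_disjoint hne).mono Set.sdiff_subset
        Set.sdiff_subset, tsum_fintype, J.lintegral_children, Finset.mul_sum]
      have h1 : ∀ ε, ∫⁻ x in (J.child ε).toSet \ B ε, pathSum (k + 1) (fun Q _ => haarSq h v Q) J x ≤
          haarSq h v J * volume (J.child ε).toSet + ∫⁻ x in (J.child ε).toSet \ B ε,
            pathSum k (fun Q _ => haarSq h v Q) (J.child ε) x := by
        intro ε
        rw [setLIntegral_congr_fun (hm ε) fun x hx => pathSum_succ_of_mem k _ hx.1,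
          lintegral_add_left measurable_const]
        gcongr
        rw [setLIntegral_const]
        gcongr
        exact Set.sdiff_subset
      calc _ ≤ ∑ ε, (haarSq h v J * volume (J.child ε).toSet + ∫⁻ x in (J.child ε).toSet \ B ε,
            pathSum k (fun Q _ => haarSq h v Q) (J.child ε) x) +
            ‖∫ x in J.toSet, v x‖ₑ ^ 2 / volume J.toSet := by
            gcongr with ε; exact h1 ε
        _ = (∑ ε, ∫⁻ x in (J.child ε).toSet \ B ε,
              pathSum k (fun Q _ => haarSq h v Q) (J.child ε) x) +
            (haarSq h v J * volume J.toSet + ‖∫ x in J.toSet, v x‖ₑ ^ 2 / volume J.toSet) := by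
            rw [Finset.sum_add_distrib, ← Finset.mul_sum, ← J.volume_children]
            ring
        -- Parseval turns the Haar part of `J` plus its mean term into the mean terms of the
        -- children, which the children's bounds contain.
        _ ≤ _ := by
            rw [hh.parseval_enorm hD hJ hv, ← Finset.sum_add_distrib]
            exact Finset.sum_le_sum fun ε _ => hB2 ε

/-- The first term of the square function is controlled by the average. -/
theorem IsHaarSystem.haarSq_le (hh : IsHaarSystem D h) (hD : IsDyadicGrid D)
    {v : (Fin d → ℝ) → EuclideanSpace ℂ (Fin n)} {J : Cube d} (hJ : J ∈ D)
    (hv : IntegrableOn v J.toSet) :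
    haarSq h v J ≤ 2 ^ d * (J.avg fun x => ‖v x‖ₑ) ^ 2 := by
  have hP := (le_self_add.trans_eq (hh.parseval_enorm hD hJ hv))
  have h1 : ∑ ε, ‖∫ x in (J.child ε).toSet, v x‖ₑ ^ 2 / volume (J.child ε).toSet ≤
      2 ^ d * (J.avg fun x => ‖v x‖ₑ) ^ 2 * volume J.toSet := by
    calc ∑ ε, ‖∫ x in (J.child ε).toSet, v x‖ₑ ^ 2 / volume (J.child ε).toSet
        ≤ ∑ ε, (∫⁻ x in J.toSet, ‖v x‖ₑ) * (∫⁻ x in (J.child ε).toSet, ‖v x‖ₑ) *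
            (2 ^ d * (volume J.toSet)⁻¹) := by
          refine Finset.sum_le_sum fun ε _ => ?_
          have h2 : ‖∫ x in (J.child ε).toSet, v x‖ₑ ≤ ∫⁻ x in (J.child ε).toSet, ‖v x‖ₑ :=
            enorm_integral_le_lintegral_enorm _
          rw [sq, div_eq_mul_inv, J.inv_volume_child ε]
          gcongr
          exact h2.trans (lintegral_mono_set (J.child_subset ε))
      _ = (∫⁻ x in J.toSet, ‖v x‖ₑ) * (∫⁻ x in J.toSet, ‖v x‖ₑ) *
            (2 ^ d * (volume J.toSet)⁻¹) := by
          rw [← Finset.sum_mul, ← Finset.mul_sum, ← J.lintegral_children]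
      _ = 2 ^ d * (J.avg fun x => ‖v x‖ₑ) ^ 2 * volume J.toSet := by
          rw [← J.avg_mul_volume]
          calc _ = 2 ^ d * (J.avg fun x => ‖v x‖ₑ) ^ 2 * volume J.toSet *
                (volume J.toSet * (volume J.toSet)⁻¹) := by ring
            _ = _ := by rw [ENNReal.mul_inv_cancel J.volume_ne_zero J.volume_ne_top, mul_one]
  have := hP.trans h1
  rwa [ENNReal.mul_le_mul_iff_left J.volume_ne_zero J.volume_ne_top] at this

/-- Weak type `(1, 1)` of the square function, at the level of the average. -/
theorem IsHaarSystem.volume_pathSum_gt_le (hh : IsHaarSystem D h) (hD : IsDyadicGrid D)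
    {v : (Fin d → ℝ) → EuclideanSpace ℂ (Fin n)} (k : ℕ) {J : Cube d} (hJ : J ∈ D)
    (hv : IntegrableOn v J.toSet) :
    2 * volume {x ∈ J.toSet | 2 ^ (d + 4) * (J.avg fun x => ‖v x‖ₑ) ^ 2 <
      pathSum k (fun Q _ => haarSq h v Q) J x} ≤ volume J.toSet := by
  set a := J.avg fun x => ‖v x‖ₑ with ha
  set S := pathSum k (fun Q _ => haarSq h v Q) J with hS
  have hint : ∫⁻ x in J.toSet, ‖v x‖ₑ = a * volume J.toSet := (J.avg_mul_volume _).symm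
  have haf : a ≠ ∞ := by
    rw [ha, Cube.avg_eq_div]
    exact (ENNReal.div_lt_top hv.2.ne J.volume_ne_zero).ne
  rcases eq_or_ne a 0 with ha0 | ha0
  · have hv0 : ∀ᵐ x ∂volume.restrict J.toSet, v x = 0 := by
      rw [ha0, zero_mul, lintegral_eq_zero_iff' hv.1.enorm] at hint
      filter_upwards [hint] with x hx
      simpa using hx
    have : ∀ x, S x = 0 := pathSum_haarSq_eq_zero k hv0
    simp [this]
  -- Level `4a`: the stopped set occupies at most a quarter of `J`.
  obtain ⟨B, hBJ, hBm, hB1, hB2⟩ := hh.exists_stopping hD (Λ := 4 * a) k hJ hv (by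
    rw [hint]; gcongr
    exact le_mul_of_one_le_left zero_le (by norm_num))
  have hSm : AEMeasurable S volume := aemeasurable_pathSum k (fun Q => aemeasurable_const) J
  have hB3 : 4 * volume B ≤ volume J.toSet := by
    have : a * (4 * volume B) ≤ a * volume J.toSet := by
      rw [← hint]
      calc a * (4 * volume B) = 4 * a * volume B := by ring
        _ ≤ _ := hB1.trans (lintegral_mono_set hBJ)
    rwa [ENNReal.mul_le_mul_iff_right ha0 haf] at this
  -- Chebyshev off `B`: the integral is at most `2 ^ d * 4a * a|J|`, so the level `2 ^ (d + 4) * a ^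
  -- 2` loses another quarter.
  have hG : 4 * volume {x ∈ J.toSet \ B | 2 ^ (d + 4) * a ^ 2 < S x} ≤ volume J.toSet := by
    have hc := mul_meas_ge_le_lintegral₀ (hSm.restrict (s := J.toSet \ B)) (2 ^ (d + 4) * a ^ 2)
    have hle : volume {x ∈ J.toSet \ B | 2 ^ (d + 4) * a ^ 2 < S x} ≤
        (volume.restrict (J.toSet \ B)) {x | 2 ^ (d + 4) * a ^ 2 ≤ S x} := by
      rw [Measure.restrict_apply' (J.measurableSet.diff hBm)]
      exact measure_mono fun x hx => ⟨hx.2.le, hx.1⟩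
    have h3 : (2 ^ (d + 2) * a ^ 2) * (4 * volume {x ∈ J.toSet \ B | 2 ^ (d + 4) * a ^ 2 < S x}) ≤
        (2 ^ (d + 2) * a ^ 2) * volume J.toSet := by
      calc _ = 2 ^ (d + 4) * a ^ 2 * volume {x ∈ J.toSet \ B | 2 ^ (d + 4) * a ^ 2 < S x} := by
            ring
        _ ≤ 2 ^ d * (4 * a) * (a * volume J.toSet) := by
            rw [← hint]
            exact ((mul_le_mul_right hle _).trans hc).trans (le_self_add.trans hB2)
        _ = _ := by ring
    rwa [ENNReal.mul_le_mul_iff_right (by simp [ha0]) (by finiteness)] at h3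
  have hsub : {x ∈ J.toSet | 2 ^ (d + 4) * a ^ 2 < S x} ⊆
      B ∪ {x ∈ J.toSet \ B | 2 ^ (d + 4) * a ^ 2 < S x} := by
    rintro x ⟨hxJ, hx⟩
    by_cases hxB : x ∈ B
    · exact Or.inl hxB
    · exact Or.inr ⟨⟨hxJ, hxB⟩, hx⟩
  have h4 : 4 * volume {x ∈ J.toSet | 2 ^ (d + 4) * a ^ 2 < S x} ≤ 2 * volume J.toSet := by
    calc _ ≤ 4 * (volume B + volume {x ∈ J.toSet \ B | 2 ^ (d + 4) * a ^ 2 < S x}) := by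
          gcongr; exact (measure_mono hsub).trans (measure_union_le _ _)
      _ ≤ volume J.toSet + volume J.toSet := by rw [mul_add]; gcongr
      _ = _ := by ring
  rw [show (4 : ℝ≥0∞) = 2 * 2 by norm_num, mul_assoc,
    ENNReal.mul_le_mul_iff_right (by simp) (by simp)] at h4
  exact h4

/-- The contribution of the cube `J` to the square of the square function with weight `U`. -/
def weightedHaarSq (h : Cube d → Fin (2 ^ d - 1) → (Fin d → ℝ) → ℂ)
    (U : (Fin d → ℝ) → EuclideanSpace ℂ (Fin n) →L[ℂ] EuclideanSpace ℂ (Fin n))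
    (f : (Fin d → ℝ) → EuclideanSpace ℂ (Fin n)) (J : Cube d) (x : Fin d → ℝ) : ℝ≥0∞ :=
  (∑ κ, ‖U x (haarCoeff h f J κ)‖ₑ ^ 2) / volume J.toSet

variable {U : (Fin d → ℝ) → EuclideanSpace ℂ (Fin n) →L[ℂ] EuclideanSpace ℂ (Fin n)}
  {f : (Fin d → ℝ) → EuclideanSpace ℂ (Fin n)}

theorem IsHaarSystem.haarCoeff_clm (hh : IsHaarSystem D h) (hD : IsDyadicGrid D)
    (T : EuclideanSpace ℂ (Fin n) →L[ℂ] EuclideanSpace ℂ (Fin n)) {J : Cube d} (hJ : J ∈ D)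
    (hf : IntegrableOn f J.toSet) (κ : Fin (2 ^ d - 1)) :
    haarCoeff h (fun x => T (f x)) J κ = T (haarCoeff h f J κ) := by
  rw [hh.haarCoeff_eq hD hJ hf, hh.haarCoeff_eq hD hJ (T.integrable_comp hf), map_sum]
  refine Finset.sum_congr rfl fun ε _ => ?_
  rw [map_smul, T.integral_comp_comm (hf.mono_set (J.child_subset ε))]

/-- A constant operator `T` passes through Haar coefficients, so the matrix weight is frozen into
`T` and only the scalar factor `u` still depends on `x`. -/
theorem IsHaarSystem.weightedHaarSq_le (hh : IsHaarSystem D h) (hD : IsDyadicGrid D)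
    (T : EuclideanSpace ℂ (Fin n) →L[ℂ] EuclideanSpace ℂ (Fin n)) {J : Cube d} (hJ : J ∈ D)
    (hf : IntegrableOn f J.toSet) {x : Fin d → ℝ} {u : ℝ≥0∞} (hu : ∀ v, ‖U x v‖ₑ ≤ u * ‖T v‖ₑ) :
    weightedHaarSq h U f J x ≤ haarSq h (fun x => T (f x)) J * u ^ 2 := by
  rw [weightedHaarSq, haarSq, ENNReal.div_eq_inv_mul, ENNReal.div_eq_inv_mul, mul_assoc,
    Finset.sum_mul]
  gcongr with κ
  rw [hh.haarCoeff_clm hD T hJ hf, ← mul_pow, mul_comm]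
  gcongr
  exact hu _

/-- **Sparse domination** in integrated form. The stopping cubes enter only through the set `E`
which they cover, and the disjoint major subsets of a sparse family through a maximal function. -/
theorem IsHaarSystem.lintegral_pathSum_le (hh : IsHaarSystem D h) (hD : IsDyadicGrid D)
    {T : Cube d → EuclideanSpace ℂ (Fin n) →L[ℂ] EuclideanSpace ℂ (Fin n)}
    {u : Cube d → (Fin d → ℝ) → ℝ≥0∞} (hum : ∀ Q, AEMeasurable (u Q) volume)
    (hu : ∀ Q x v, ‖U x v‖ₑ ≤ u Q x * ‖T Q v‖ₑ)
    {φ : (Fin d → ℝ) → ℝ≥0∞} (hφ : AEMeasurable φ volume) {t : ℝ} (ht0 : 0 < t) (ht1 : t ≤ 1)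
    (k : ℕ) {L : Cube d} (hL : L ∈ D) (hf : IntegrableOn f L.toSet) :
    ∫⁻ x in L.toSet, pathSum k (weightedHaarSq h U f) L x ^ t * φ x ≤
      2 * (2 ^ (d + 4)) ^ t * ∫⁻ x in L.toSet, pathSup k
        (fun Q => (Q.avg fun x => ‖T Q (f x)‖ₑ) ^ (2 * t) *
          Q.avg fun x => u Q x ^ (2 * t) * φ x) L x := by
  set b : Cube d → ℝ≥0∞ := fun Q => (Q.avg fun x => ‖T Q (f x)‖ₑ) ^ (2 * t) *
          Q.avg fun x => u Q x ^ (2 * t) * φ x with hb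
  set C : ℝ≥0∞ := 2 * (2 ^ (d + 4)) ^ t with hC
  -- Strong induction on the depth: each stopping cube becomes a new stopping parent with fewer
  -- generations below it.
  induction k using Nat.strong_induction_on generalizing L with
  | _ k IH =>
  set G : Cube d → ℝ≥0∞ := haarSq h (fun x => T L (f x)) with hG
  set m : ℝ≥0∞ := 2 ^ (d + 4) * (L.avg fun x => ‖T L (f x)‖ₑ) ^ 2 with hm
  have hTf : IntegrableOn (fun x => T L (f x)) L.toSet := (T L).integrable_comp hf
  -- the inner induction, below the stopping parent `L`
  have inner : ∀ k' ≤ k, ∀ J ∈ D, J.toSet ⊆ L.toSet → ∀ s ≤ m, (k' < k ∨ s + G J ≤ m) →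
      ∃ E ⊆ J.toSet, MeasurableSet E ∧ (∀ x ∈ E, m < s + pathSum k' (fun Q _ => G Q) J x) ∧
        ∫⁻ x in J.toSet, (s * u L x ^ 2 + pathSum k' (weightedHaarSq h U f) J x) ^ t * φ x ≤
          (∫⁻ x in J.toSet, (m * u L x ^ 2) ^ t * φ x) + C * ∫⁻ x in E, pathSup k' b J x := by
    intro k'
    induction k' with
    | zero =>
      intro _ J _ _ s hs _
      refine ⟨∅, Set.empty_subset _, MeasurableSet.empty, by simp, ?_⟩
      refine le_add_right (lintegral_mono fun x => ?_)
      simp only [pathSum, add_zero]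
      gcongr
    | succ k' ih =>
      intro hk J hJ hJL s hs hcond
      -- `s` is the part of the unweighted square function of `T L f` accumulated between `L` and
      -- `J`. The cube `J` is a stopping cube when its own term pushes the sum above `m`.
      rcases lt_or_ge m (s + G J) with hlt | hgo
      · refine ⟨J.toSet, subset_rfl, J.measurableSet, fun x _ => ?_, ?_⟩
        · refine hlt.trans_le ?_
          rw [pathSum]
          gcongr
          exact le_self_add
        -- The disjunction carried along guarantees that a stopping cube lies strictly below `L`. On
        -- it the accumulated part is still at most `m`, subadditivity of `y ^ t` separates it from
        -- the rest, and the outer induction treats the rest.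
        · have hk' : k' + 1 < k := hcond.resolve_right (not_le.2 hlt)
          calc ∫⁻ x in J.toSet, (s * u L x ^ 2 + pathSum (k' + 1) (weightedHaarSq h U f) J x) ^ t * φ x
              ≤ ∫⁻ x in J.toSet, ((m * u L x ^ 2) ^ t * φ x +
                  pathSum (k' + 1) (weightedHaarSq h U f) J x ^ t * φ x) := by
                refine lintegral_mono fun x => ?_
                simp only
                rw [← add_mul]
                gcongr
                refine (ENNReal.rpow_add_le_add_rpow _ _ ht0.le ht1).trans ?_
                gcongr
            _ = (∫⁻ x in J.toSet, (m * u L x ^ 2) ^ t * φ x) +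
                  ∫⁻ x in J.toSet, pathSum (k' + 1) (weightedHaarSq h U f) J x ^ t * φ x := by
                refine lintegral_add_left' (AEMeasurable.restrict ?_) _
                exact ((((hum L).pow_const 2).const_mul m).pow_const t).mul hφ
            _ ≤ _ := by
                gcongr
                exact IH _ hk' hJ (hf.mono_set hJL)
      · have step : ∀ ε, ∃ E ⊆ (J.child ε).toSet, MeasurableSet E ∧
            (∀ x ∈ E, m < s + G J + pathSum k' (fun Q _ => G Q) (J.child ε) x) ∧
            ∫⁻ x in (J.child ε).toSet, ((s + G J) * u L x ^ 2 +
              pathSum k' (weightedHaarSq h U f) (J.child ε) x) ^ t * φ x ≤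
            (∫⁻ x in (J.child ε).toSet, (m * u L x ^ 2) ^ t * φ x) +
              C * ∫⁻ x in E, pathSup k' b (J.child ε) x := fun ε =>
          ih (by omega) _ (hD.child_mem hJ ε) ((J.child_subset ε).trans hJL) _ hgo
            (Or.inl (by omega))
        choose E hEs hEm hE1 hE2 using step
        have hEd : Pairwise (Function.onFun Disjoint E) := fun ε ε' hne =>
          (J.child_disjoint hne).mono (hEs ε) (hEs ε')
        refine ⟨⋃ ε, E ε, Set.iUnion_subset fun ε => (hEs ε).trans (J.child_subset ε),
          MeasurableSet.iUnion hEm, ?_, ?_⟩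
        · intro x hx
          obtain ⟨ε, hx⟩ := Set.mem_iUnion.1 hx
          rw [pathSum_succ_of_mem _ _ (hEs ε hx), ← add_assoc]
          exact hE1 ε x hx
        · rw [J.lintegral_children, J.lintegral_children, lintegral_iUnion hEm hEd, tsum_fintype,
            Finset.mul_sum, ← Finset.sum_add_distrib]
          refine Finset.sum_le_sum fun ε _ => ?_
          calc _ ≤ ∫⁻ x in (J.child ε).toSet, ((s + G J) * u L x ^ 2 +
              pathSum k' (weightedHaarSq h U f) (J.child ε) x) ^ t * φ x := by
                refine setLIntegral_mono' (J.child ε).measurableSet fun x hx => ?_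
                rw [pathSum_succ_of_mem _ _ hx, add_mul, add_assoc (s * _)]
                gcongr
                exact hh.weightedHaarSq_le hD (T L) hJ (hf.mono_set hJL) (hu L x)
            _ ≤ _ := hE2 ε
            _ ≤ _ := by
                gcongr _ + C * ?_
                refine setLIntegral_mono' (hEm ε) fun x hx => ?_
                rw [pathSup_succ_of_mem _ _ (hEs ε hx)]
                exact le_sup_right
  -- The root itself never stops, since its Haar term is at most `2 ^ d` times the squared average,
  -- below `m`.
  obtain ⟨E, hEL, hEm, hE1, hE2⟩ := inner k le_rfl L hL subset_rfl 0 zero_le (Or.inr (by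
    rw [zero_add]
    refine (hh.haarSq_le hD hL hTf).trans ?_
    rw [hm]
    gcongr
    · norm_num
    · omega))
  simp only [zero_mul, zero_add] at hE1 hE2
  have hE : 2 * volume E ≤ volume L.toSet := by
    refine le_trans ?_ (hh.volume_pathSum_gt_le hD k hL hTf)
    gcongr
    exact fun x hx => ⟨hEL hx, hE1 x hx⟩
  have hEf : volume E ≠ ∞ := ((measure_mono hEL).trans_lt L.volume_ne_top.lt_top).ne
  have hhalf : volume L.toSet ≤ 2 * volume (L.toSet \ E) := by
    rw [measure_sdiff hEL hEm.nullMeasurableSet hEf, ENNReal.mul_sub (by simp)]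
    refine ENNReal.le_sub_of_add_le_left (by finiteness) ?_
    calc _ ≤ volume L.toSet + volume L.toSet := by gcongr
      _ = _ := by ring
  -- The contribution of `L` is a constant times `b L` times the volume of `L`. Half of `L` survives
  -- outside `E`, and there `b L` is at most the maximal function; the stopped cubes use only `E`,
  -- so nothing is counted twice.
  have hmain : ∫⁻ x in L.toSet, (m * u L x ^ 2) ^ t * φ x ≤
      C * ∫⁻ x in L.toSet \ E, pathSup k b L x := by
    have h1 : ∀ x, (m * u L x ^ 2) ^ t * φ x =
        (2 ^ (d + 4)) ^ t * (L.avg fun x => ‖T L (f x)‖ₑ) ^ (2 * t) * (u L x ^ (2 * t) * φ x) := by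
      intro x
      rw [ENNReal.mul_rpow_of_nonneg _ _ ht0.le, hm, ENNReal.mul_rpow_of_nonneg _ _ ht0.le,
        ENNReal.rpow_mul, ENNReal.rpow_mul, ENNReal.rpow_two, ENNReal.rpow_two]
      ring
    simp only [h1]
    rw [lintegral_const_mul'' (f := fun x => u L x ^ (2 * t) * φ x) _
        (AEMeasurable.restrict (((hum L).pow_const _).mul hφ)),
      ← L.avg_mul_volume]
    calc _ = (2 ^ (d + 4)) ^ t * b L * volume L.toSet := by rw [hb]; ring
      _ ≤ (2 ^ (d + 4)) ^ t * b L * (2 * volume (L.toSet \ E)) := by gcongr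
      _ = C * ∫⁻ x in L.toSet \ E, b L := by
          rw [setLIntegral_const]; ring
      _ ≤ _ := by
          gcongr with x
          exact le_pathSup k b L x
  calc _ ≤ _ := hE2
    _ ≤ C * (∫⁻ x in L.toSet \ E, pathSup k b L x) + C * ∫⁻ x in E, pathSup k b L x := by gcongr
    _ = C * ∫⁻ x in L.toSet, pathSup k b L x := by
        rw [← mul_add, add_comm, ← lintegral_inter_add_sdiff _ L.toSet hEm,
          Set.inter_eq_self_of_subset_right hEL]

end Sparse

end MatrixSquare

end

noncomputable section

namespace MatrixSquare

/-! ### Dyadic maximal functions, reverse Hölder inequality -/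

section Maximal

variable {d : ℕ}

theorem Cube.avg_child_le (J : Cube d) (ε : Fin d → Bool) (F : (Fin d → ℝ) → ℝ≥0∞) :
    (J.child ε).avg F ≤ 2 ^ d * J.avg F := by
  rw [Cube.avg_eq_div, Cube.avg_eq_div, div_eq_mul_inv, div_eq_mul_inv, J.inv_volume_child ε]
  calc _ ≤ (∫⁻ x in J.toSet, F x) * (2 ^ d * (volume J.toSet)⁻¹) := by
        gcongr; exact J.child_subset ε
    _ = _ := by ring

theorem Cube.avg_ne_top {J : Cube d} {F : (Fin d → ℝ) → ℝ≥0∞} (h : ∫⁻ x in J.toSet, F x ≠ ∞) :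
    J.avg F ≠ ∞ := by
  rw [Cube.avg_eq_div]
  exact (ENNReal.div_lt_top h J.volume_ne_zero).ne

/-- By Bernoulli's inequality a jump from `y` to `x` changes the `ε`-th power by a factor of order
`ε`, as long as `x / y` is bounded by `K`. The gain of `ε` is what later beats the `A_∞` constant.
-/
theorem rpow_sub_mul_le {x y ε K : ℝ} (hy : 0 < y) (hyx : y ≤ x) (hxK : x ≤ K * y) (hε : 0 < ε)
    (hε1 : ε ≤ 1) : (x ^ ε - y ^ ε) * x ≤ K * ε * (x ^ (1 + ε) - y ^ (1 + ε)) := by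
  have hx : 0 < x := hy.trans_le hyx
  have h1 : x ^ ε * (x - y) ≤ x ^ (1 + ε) - y ^ (1 + ε) := by
    rw [Real.rpow_add hx, Real.rpow_add hy, Real.rpow_one, Real.rpow_one]
    have := Real.rpow_le_rpow hy.le hyx hε.le
    nlinarith
  have h2 : (x / y) ^ ε ≤ 1 + ε * (x / y - 1) := by
    have := rpow_one_add_le_one_add_mul_self (s := x / y - 1) (p := ε)
      (by have := div_pos hx hy; linarith) hε.le hε1
    simpa using this
  have h3 : x ^ ε - y ^ ε ≤ ε * x ^ ε * ((x - y) / y) := by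
    have hz : 1 ≤ x / y := (one_le_div hy).2 hyx
    have hxy : x ^ ε = y ^ ε * (x / y) ^ ε := by
      rw [← Real.mul_rpow hy.le (by positivity), mul_div_cancel₀ _ hy.ne']
    have hyε : 0 < y ^ ε := by positivity
    have hzε : 1 ≤ (x / y) ^ ε := Real.one_le_rpow hz hε.le
    have hd : (x - y) / y = x / y - 1 := by rw [sub_div, div_self hy.ne']
    rw [hxy, hd]
    have h4 : (x / y) ^ ε - 1 ≤ ε * (x / y) ^ ε * (x / y - 1) := by
      have : 0 ≤ ε * (x / y - 1) := mul_nonneg hε.le (by linarith)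
      nlinarith
    nlinarith
  have h5 : 0 ≤ x ^ ε * (x - y) := mul_nonneg (by positivity) (by linarith)
  calc (x ^ ε - y ^ ε) * x ≤ ε * x ^ ε * ((x - y) / y) * x := by gcongr
    _ = ε * (x ^ ε * (x - y)) * (x / y) := by ring
    _ ≤ ε * (x ^ ε * (x - y)) * K := by
        gcongr
        rwa [div_le_iff₀ hy]
    _ ≤ ε * (x ^ (1 + ε) - y ^ (1 + ε)) * K := by
        have hK : 0 ≤ K := by
          have := (one_le_div hy).2 hyx
          have := (div_le_iff₀ hy).2 hxK
          linarith
        gcongr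
    _ = _ := by ring

/-- Extended nonnegative form of `rpow_sub_mul_le`: `r` plays the role of the difference of the
powers. -/
theorem exists_rpow_eq_add {x y : ℝ≥0∞} {ε : ℝ} {K : ℝ≥0} (hyx : y ≤ x) (hxK : x ≤ K * y)
    (hy : y ≠ ∞) (hε : 0 < ε) (hε1 : ε ≤ 1) :
    ∃ r, x ^ ε = y ^ ε + r ∧ r * x + K * ENNReal.ofReal ε * y ^ (1 + ε) ≤
      K * ENNReal.ofReal ε * x ^ (1 + ε) := by
  have hx : x ≠ ∞ := (hxK.trans_lt (by finiteness)).ne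
  rcases eq_or_ne y 0 with rfl | hy0
  · have hx0 : x = 0 := by simpa using hxK
    exact ⟨0, by simp [hx0], by simp [hx0]⟩
  lift x to ℝ≥0 using hx
  lift y to ℝ≥0 using hy
  have hy' : (0 : ℝ) < y := by exact_mod_cast pos_iff_ne_zero.2 hy0
  have hyx' : (y : ℝ) ≤ x := by exact_mod_cast hyx
  have hxK' : (x : ℝ) ≤ K * y := by exact_mod_cast hxK
  have key := rpow_sub_mul_le hy' hyx' hxK' hε hε1
  have hmono : (y : ℝ) ^ ε ≤ (x : ℝ) ^ ε := Real.rpow_le_rpow hy'.le hyx' hε.le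
  have conv : ∀ (z : ℝ≥0) (s : ℝ), 0 ≤ s → (z : ℝ≥0∞) ^ s = ENNReal.ofReal ((z : ℝ) ^ s) := by
    intro z s hs
    rw [← ENNReal.ofReal_rpow_of_nonneg z.coe_nonneg hs, ENNReal.ofReal_coe_nnreal]
  refine ⟨ENNReal.ofReal ((x : ℝ) ^ ε - (y : ℝ) ^ ε), ?_, ?_⟩
  · rw [conv _ _ hε.le, conv _ _ hε.le, ← ENNReal.ofReal_add (by positivity) (by linarith)]
    congr 1; ring
  · rw [conv _ _ (by positivity), conv _ _ (by positivity),
      show (x : ℝ≥0∞) = ENNReal.ofReal x by simp, show (K : ℝ≥0∞) = ENNReal.ofReal K by simp,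
      ← ENNReal.ofReal_mul (by linarith), ← ENNReal.ofReal_mul (by positivity),
      ← ENNReal.ofReal_mul (by positivity), ← ENNReal.ofReal_mul (by positivity),
      ← ENNReal.ofReal_add (mul_nonneg (by linarith) (by positivity)) (by positivity)]
    refine ENNReal.ofReal_le_ofReal ?_
    linarith

theorem rpow_eq_rpow_sub_one_mul {s : ℝ} (hs : 1 ≤ s) (x : ℝ≥0∞) : x ^ s = x ^ (s - 1) * x := by
  conv_rhs => rw [← ENNReal.rpow_one x, ← ENNReal.rpow_mul, one_mul]
  rw [← ENNReal.rpow_add_of_nonneg _ _ (by linarith) zero_le_one, sub_add_cancel]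

/-- Adding the two inequalities and cancelling `α'` and `β'` in effect; stated so that nothing is
subtracted and only `α'` need be finite. -/
theorem add_le_add_of_cross {P Q α α' β β' : ℝ≥0∞} (hα' : α' ≠ ∞) (h1 : P + α' ≤ β' + Q)
    (h2 : β' + α ≤ β + α') : P + α ≤ β + Q := by
  refine (ENNReal.add_le_add_iff_right hα').1 ?_
  calc P + α + α' = P + α' + α := by ring
    _ ≤ β' + Q + α := by gcongr
    _ = β' + α + Q := by ring
    _ ≤ β + α' + Q := by gcongr
    _ = _ := by ring

/-- A record `m` that already dominates the average of `J` makes the running maximum start afresh at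
the child, from the updated record. This drives both inductions below. -/
theorem sup_pathSup_succ (F : (Fin d → ℝ) → ℝ≥0∞) (k : ℕ) {J : Cube d} {m : ℝ≥0∞}
    (hm : J.avg F ≤ m) {ε : Fin d → Bool} {x : Fin d → ℝ} (hx : x ∈ (J.child ε).toSet) :
    m ⊔ pathSup (k + 1) (fun Q => Q.avg F) J x =
      (m ⊔ (J.child ε).avg F) ⊔ pathSup k (fun Q => Q.avg F) (J.child ε) x := by
  rw [pathSup_succ_of_mem _ _ hx, ← sup_assoc, sup_eq_left.2 hm, sup_assoc,
    sup_eq_right.2 (le_pathSup k (fun Q => Q.avg F) _ x)]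

/-- Integration of the increments of the running maximum against `G`, by induction on the tree. -/
theorem lintegral_mul_sup_pathSup_rpow_le {F : (Fin d → ℝ) → ℝ≥0∞} {A : ℝ≥0} {ε : ℝ} (hε : 0 < ε)
    (hε1 : ε ≤ 1) {G : ℕ → Cube d → ℝ≥0∞ → (Fin d → ℝ) → ℝ≥0∞}
    (hG1 : ∀ k J m η x, x ∈ (J.child η).toSet → J.avg F ≤ m →
      G (k + 1) J m x = G k (J.child η) (m ⊔ (J.child η).avg F) x)
    (hG2 : ∀ k J, ∫⁻ x in J.toSet, G k J (J.avg F) x ≤ A * ∫⁻ x in J.toSet, F x)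
    (k : ℕ) (J : Cube d) (m : ℝ≥0∞) (hm : J.avg F ≤ m) (hmt : m ≠ ∞) :
    (∫⁻ x in J.toSet, G k J m x * (m ⊔ pathSup k (fun Q => Q.avg F) J x) ^ ε) +
        A * (2 ^ d * ENNReal.ofReal ε) * m ^ (1 + ε) * volume J.toSet ≤
      m ^ ε * (∫⁻ x in J.toSet, G k J m x) +
        A * (2 ^ d * ENNReal.ofReal ε) *
          ∫⁻ x in J.toSet, (m ⊔ pathSup k (fun Q => Q.avg F) J x) ^ (1 + ε) := by
  induction k generalizing J m with
  | zero =>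
    simp only [pathSup, sup_eq_left.2 hm]
    rw [lintegral_mul_const' _ _ (by finiteness), setLIntegral_const, mul_comm (m ^ ε), mul_assoc (_ * _)]
  | succ k ih =>
    simp only [J.lintegral_children, J.volume_children, Finset.mul_sum]
    rw [← Finset.sum_add_distrib, ← Finset.sum_add_distrib]
    refine Finset.sum_le_sum fun η _ => ?_
    set m' := m ⊔ (J.child η).avg F with hm'
    have hcm : (J.child η).avg F ≤ 2 ^ d * m := (J.avg_child_le η F).trans (by gcongr)
    have hm't : m' ≠ ∞ := by
      refine (max_lt hmt.lt_top (hcm.trans_lt (by finiteness))).ne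
    have e1 : ∫⁻ x in (J.child η).toSet,
        G (k + 1) J m x * (m ⊔ pathSup (k + 1) (fun Q => Q.avg F) J x) ^ ε =
        ∫⁻ x in (J.child η).toSet, G k (J.child η) m' x *
          (m' ⊔ pathSup k (fun Q => Q.avg F) (J.child η) x) ^ ε :=
      setLIntegral_congr_fun (J.child η).measurableSet
        (fun x hx => by simp only [hG1 k J m η x hx hm, sup_pathSup_succ F k hm hx, hm'])
    have e2 : ∫⁻ x in (J.child η).toSet, G (k + 1) J m x =
        ∫⁻ x in (J.child η).toSet, G k (J.child η) m' x :=
      setLIntegral_congr_fun (J.child η).measurableSet (fun x hx => hG1 k J m η x hx hm)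
    have e3 : ∫⁻ x in (J.child η).toSet, (m ⊔ pathSup (k + 1) (fun Q => Q.avg F) J x) ^ (1 + ε) =
        ∫⁻ x in (J.child η).toSet,
          (m' ⊔ pathSup k (fun Q => Q.avg F) (J.child η) x) ^ (1 + ε) :=
      setLIntegral_congr_fun (J.child η).measurableSet
        (fun x hx => by simp only [sup_pathSup_succ F k hm hx, hm'])
    rw [e1, e2, e3]
    have h1 := ih (J.child η) m' le_sup_right hm't
    -- Without a new record the induction hypothesis is the claim. At a record the maximum jumps
    -- from `m` to the child's average, by a factor at most `2 ^ d`, and the jump inequality applies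
    -- with `K = 2 ^ d`.
    rcases le_total ((J.child η).avg F) m with hle | hle
    · rw [show m' = m from sup_eq_left.2 hle] at h1 ⊢
      exact h1
    · have hm'e : m' = (J.child η).avg F := sup_eq_right.2 hle
      refine add_le_add_of_cross ?_ h1 ?_
      · have := (J.child η).volume_ne_top
        finiteness
      · obtain ⟨r, hr1, hr2⟩ := exists_rpow_eq_add (K := 2 ^ d) (x := m') (y := m) (hm'e ▸ hle)
          (by rw [hm'e]; exact_mod_cast hcm) hmt hε hε1
        have hg : ∫⁻ x in (J.child η).toSet, G k (J.child η) m' x ≤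
            A * (m' * volume (J.child η).toSet) := by
          rw [hm'e, Cube.avg_mul_volume]; exact hG2 k _
        push_cast at hr2
        rw [hr1]
        calc _ ≤ m ^ ε * (∫⁻ x in (J.child η).toSet, G k (J.child η) m' x) +
              r * (A * (m' * volume (J.child η).toSet)) +
              A * (2 ^ d * ENNReal.ofReal ε) * m ^ (1 + ε) * volume (J.child η).toSet := by
              rw [add_mul]; gcongr
          _ = m ^ ε * (∫⁻ x in (J.child η).toSet, G k (J.child η) m' x) +
              A * volume (J.child η).toSet * (r * m' + 2 ^ d * ENNReal.ofReal ε * m ^ (1 + ε)) := by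
              ring
          _ ≤ m ^ ε * (∫⁻ x in (J.child η).toSet, G k (J.child η) m' x) +
              A * volume (J.child η).toSet * (2 ^ d * ENNReal.ofReal ε * m' ^ (1 + ε)) := by
              gcongr
          _ = _ := by ring

/-- Young's inequality for `x * y ^ (s - 1)`, multiplied by the conjugate exponent of `s`. It is the
balance of Doob's inequality at a jump of the running maximum from `y` to `x`. -/
theorem young_records {x y s : ℝ} (hs : 1 < s) (hx : 0 ≤ x) (hy : 0 ≤ y) :
    x ^ s + s / (s - 1) * y ^ (s - 1) * x ≤ y ^ s + s / (s - 1) * x ^ s := by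
  have hs0 : 0 < s - 1 := by linarith
  have hY := Real.young_inequality_of_nonneg (a := x) (b := y ^ (s - 1)) (p := s) (q := s / (s - 1))
    hx (by positivity) (by
      rw [Real.holderConjugate_iff]
      refine ⟨hs, ?_⟩
      field_simp
      ring)
  rw [← Real.rpow_mul hy, mul_div_cancel₀ _ hs0.ne'] at hY
  have h1 : s / (s - 1) * (x ^ s / s + y ^ s / (s / (s - 1))) = x ^ s / (s - 1) + y ^ s := by
    field_simp
  have h2 : s / (s - 1) * x ^ s = x ^ s + x ^ s / (s - 1) := by field_simp; ring
  have h3 := mul_le_mul_of_nonneg_left hY (by positivity : 0 ≤ s / (s - 1))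
  rw [h1] at h3
  rw [h2]
  nlinarith

/-- The inequality behind Doob's maximal inequality, by induction on the tree. -/
theorem lintegral_sup_pathSup_rpow_add_le {F : (Fin d → ℝ) → ℝ≥0∞} {s : ℝ} (hs : 1 < s)
    (k : ℕ) (J : Cube d) (m : ℝ≥0∞) (hm : J.avg F ≤ m) (hmt : m ≠ ∞) :
    (∫⁻ x in J.toSet, (m ⊔ pathSup k (fun Q => Q.avg F) J x) ^ s) +
        ENNReal.ofReal (s / (s - 1)) * m ^ (s - 1) * (∫⁻ x in J.toSet, F x) ≤
      m ^ s * volume J.toSet + ENNReal.ofReal (s / (s - 1)) *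
        ∫⁻ x in J.toSet, F x * (m ⊔ pathSup k (fun Q => Q.avg F) J x) ^ (s - 1) := by
  have hs0 : 0 < s - 1 := by linarith
  induction k generalizing J m with
  | zero =>
    simp only [pathSup, sup_eq_left.2 hm]
    rw [lintegral_mul_const' _ _ (by finiteness), setLIntegral_const, mul_comm (∫⁻ x in J.toSet, F x), ← mul_assoc]
  | succ k ih =>
    simp only [J.lintegral_children, J.volume_children, Finset.mul_sum]
    rw [← Finset.sum_add_distrib, ← Finset.sum_add_distrib]
    refine Finset.sum_le_sum fun η _ => ?_
    set m' := m ⊔ (J.child η).avg F with hm'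
    have hcm : (J.child η).avg F ≤ 2 ^ d * m := (J.avg_child_le η F).trans (by gcongr)
    have hm't : m' ≠ ∞ := by
      refine (max_lt hmt.lt_top (hcm.trans_lt (by finiteness))).ne
    have e1 : ∫⁻ x in (J.child η).toSet, (m ⊔ pathSup (k + 1) (fun Q => Q.avg F) J x) ^ s =
        ∫⁻ x in (J.child η).toSet, (m' ⊔ pathSup k (fun Q => Q.avg F) (J.child η) x) ^ s :=
      setLIntegral_congr_fun (J.child η).measurableSet
        (fun x hx => by simp only [sup_pathSup_succ F k hm hx, hm'])
    have e2 : ∫⁻ x in (J.child η).toSet,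
        F x * (m ⊔ pathSup (k + 1) (fun Q => Q.avg F) J x) ^ (s - 1) =
        ∫⁻ x in (J.child η).toSet,
          F x * (m' ⊔ pathSup k (fun Q => Q.avg F) (J.child η) x) ^ (s - 1) :=
      setLIntegral_congr_fun (J.child η).measurableSet
        (fun x hx => by simp only [sup_pathSup_succ F k hm hx, hm'])
    rw [e1, e2]
    have h1 := ih (J.child η) m' le_sup_right hm't
    rcases le_total ((J.child η).avg F) m with hle | hle
    · rw [show m' = m from sup_eq_left.2 hle] at h1 ⊢
      exact h1
    · have hm'e : m' = (J.child η).avg F := sup_eq_right.2 hle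
      have hv := (J.child η).volume_ne_top
      rw [← (J.child η).avg_mul_volume F, ← hm'e] at h1 ⊢
      refine add_le_add_of_cross (by finiteness) h1 ?_
      have key : m' ^ s + ENNReal.ofReal (s / (s - 1)) * m ^ (s - 1) * m' ≤
          m ^ s + ENNReal.ofReal (s / (s - 1)) * m' ^ s := by
        clear_value m'
        lift m' to ℝ≥0 using hm't
        lift m to ℝ≥0 using hmt
        have conv : ∀ (z : ℝ≥0) (s : ℝ), 0 ≤ s →
            (z : ℝ≥0∞) ^ s = ENNReal.ofReal ((z : ℝ) ^ s) := by
          intro z s hs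
          rw [← ENNReal.ofReal_rpow_of_nonneg z.coe_nonneg hs, ENNReal.ofReal_coe_nnreal]
        rw [conv _ _ (by linarith), conv _ _ (by linarith), conv _ _ (by linarith),
          show (m' : ℝ≥0∞) = ENNReal.ofReal m' by simp, ← ENNReal.ofReal_mul (by positivity),
          ← ENNReal.ofReal_mul (by positivity), ← ENNReal.ofReal_mul (by positivity),
          ← ENNReal.ofReal_add (by positivity) (by positivity),
          ← ENNReal.ofReal_add (by positivity) (by positivity)]
        exact ENNReal.ofReal_le_ofReal (young_records hs m'.2 m.2)
      have hpow : m' ^ s = m' ^ (s - 1) * m' := rpow_eq_rpow_sub_one_mul hs.le _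
      calc _ = (m' ^ s + ENNReal.ofReal (s / (s - 1)) * m ^ (s - 1) * m') *
            volume (J.child η).toSet := by ring
        _ ≤ (m ^ s + ENNReal.ofReal (s / (s - 1)) * m' ^ s) * volume (J.child η).toSet := by
            gcongr
        _ = _ := by rw [hpow]; ring

end Maximal

end MatrixSquare

end

noncomputable section

namespace MatrixSquare

/-! ### Doob's inequality, Lebesgue differentiation and the reverse Hölder inequality -/

section MaximalBounds

variable {d : ℕ}

theorem pathSup_le_succ (k : ℕ) (b : Cube d → ℝ≥0∞) (L : Cube d) (x : Fin d → ℝ) :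
    pathSup k b L x ≤ pathSup (k + 1) b L x := by
  induction k generalizing L with
  | zero => exact le_sup_left
  | succ k ih => exact sup_le_sup_left (ih _) _

/-- Doob's maximal inequality for the dyadic maximal function. -/
theorem lintegral_pathSup_rpow_le {F : (Fin d → ℝ) → ℝ≥0∞} (hF : AEMeasurable F volume) {s : ℝ}
    (hs : 1 < s) (k : ℕ) (L : Cube d) :
    ∫⁻ x in L.toSet, pathSup k (fun Q => Q.avg F) L x ^ s ≤
      ENNReal.ofReal (s / (s - 1)) ^ s * ∫⁻ x in L.toSet, F x ^ s := by
  have hs0 : 0 < s - 1 := by linarith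
  have hc : 0 < s / (s - 1) := by positivity
  set c := ENNReal.ofReal (s / (s - 1)) with hcdef
  have hc0 : c ≠ 0 := by simpa [hcdef] using hc
  have hc1 : 1 ≤ c := by
    rw [hcdef, ENNReal.one_le_ofReal, le_div_iff₀ hs0]; linarith
  rcases eq_or_ne (∫⁻ x in L.toSet, F x ^ s) ∞ with htop | hfin
  · rw [htop, ENNReal.mul_top
      (ENNReal.rpow_pos (pos_iff_ne_zero.2 hc0) ENNReal.ofReal_ne_top).ne']
    exact le_top
  have hconj : s.HolderConjugate (s / (s - 1)) := by
    rw [Real.holderConjugate_iff]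
    refine ⟨hs, ?_⟩
    field_simp; ring
  have hFint : ∫⁻ x in L.toSet, F x ≠ ∞ := by
    have := ENNReal.lintegral_mul_le_Lp_mul_Lq (volume.restrict L.toSet) hconj hF.restrict
      (g := fun _ => 1) aemeasurable_const
    simp only [Pi.mul_apply, mul_one, ENNReal.one_rpow, lintegral_one,
      Measure.restrict_apply_univ] at this
    refine (this.trans_lt ?_).ne
    have h1 : 0 ≤ 1 / s := by positivity
    have h2 : 0 ≤ 1 / (s / (s - 1)) := by positivity
    have := L.volume_ne_top
    finiteness
  set N := pathSup k (fun Q => Q.avg F) L with hN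
  set m := L.avg F with hm
  have hmt : m ≠ ∞ := Cube.avg_ne_top hFint
  have hNm : ∀ x, m ⊔ N x = N x := fun x => sup_eq_right.2 (le_pathSup k (fun Q => Q.avg F) L x)
  have hNae : AEMeasurable N volume := aemeasurable_pathSup k _ L
  have h1 := lintegral_sup_pathSup_rpow_add_le (F := F) hs k L m le_rfl hmt
  simp only [← hN, hNm] at h1
  -- The truncated maximal function is bounded on `L`; hence a power of its norm may be divided out
  -- at the end.
  have hRf : ∫⁻ x in L.toSet, N x ^ s ≠ ∞ := by
    obtain ⟨K, hK, hK'⟩ := pathSup_lt_top k (b := fun Q => Q.avg F) (L := L) fun Q hQ =>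
      (Cube.avg_ne_top ((lintegral_mono_set hQ).trans_lt hFint.lt_top).ne).lt_top
    refine ((setLIntegral_mono' L.measurableSet fun x hx =>
      ENNReal.rpow_le_rpow (hK' x hx) (by linarith : (0 : ℝ) ≤ s)).trans_lt ?_).ne
    rw [Cube.setLIntegral_const]
    have := L.volume_ne_top
    finiteness
  set R := ∫⁻ x in L.toSet, N x ^ s with hR
  set B := ∫⁻ x in L.toSet, F x ^ s with hB
  -- The initial record is the average over `L` itself, so the initial term equals `m ^ (s - 1) * ∫
  -- F` and is swallowed by the extra term on the left, because `c ≥ 1`.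
  have h2 : R ≤ c * ∫⁻ x in L.toSet, F x * N x ^ (s - 1) := by
    have hv := L.volume_ne_top
    have hpow : m ^ s = m ^ (s - 1) * m := rpow_eq_rpow_sub_one_mul hs.le _
    have h3 : m ^ s * volume L.toSet ≤ c * m ^ (s - 1) * ∫⁻ x in L.toSet, F x := by
      rw [← L.avg_mul_volume, ← hm, hpow, mul_assoc, mul_assoc]
      exact le_mul_of_one_le_left zero_le hc1
    refine (ENNReal.add_le_add_iff_left (a := m ^ s * volume L.toSet) (by finiteness)).1 ?_
    refine le_trans ?_ h1
    rw [add_comm]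
    gcongr
  have h3 : ∫⁻ x in L.toSet, F x * N x ^ (s - 1) ≤ B ^ (1 / s) * R ^ (1 - 1 / s) := by
    have := ENNReal.lintegral_mul_le_Lp_mul_Lq (volume.restrict L.toSet) hconj hF.restrict
      (g := fun x => N x ^ (s - 1)) (hNae.restrict.pow_const _)
    simp only [Pi.mul_apply, ← ENNReal.rpow_mul] at this
    rw [mul_div_cancel₀ _ hs0.ne'] at this
    convert this using 3
    field_simp
  have h4 : R ^ (1 / s) ≤ c * B ^ (1 / s) := by
    rcases eq_or_ne R 0 with hR0 | hR0
    · rw [hR0, ENNReal.zero_rpow_of_pos (by positivity)]; exact zero_le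
    have hsplit : R = R ^ (1 / s) * R ^ (1 - 1 / s) := by
      rw [← ENNReal.rpow_add _ _ hR0 hRf]; simp
    have hX0 : R ^ (1 - 1 / s) ≠ 0 := by
      simp [hR0, hRf]
    have hXt : R ^ (1 - 1 / s) ≠ ∞ := by
      have : 1 / s ≤ 1 := by rw [div_le_one (by linarith)]; linarith
      exact ENNReal.rpow_ne_top_of_nonneg (by linarith) hRf
    rw [← ENNReal.mul_le_mul_iff_left hX0 hXt, ← hsplit, mul_assoc]
    exact h2.trans (by gcongr)
  have h5 := ENNReal.rpow_le_rpow h4 (by linarith : (0 : ℝ) ≤ s)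
  rw [ENNReal.mul_rpow_of_nonneg _ _ (by linarith), ← ENNReal.rpow_mul, ← ENNReal.rpow_mul,
    one_div_mul_cancel (by linarith), ENNReal.rpow_one, ENNReal.rpow_one] at h5
  exact h5

/-- The `k`-th cube of the dyadic descent from `L` to `x`. -/
def descend : ℕ → Cube d → (Fin d → ℝ) → Cube d
  | 0, L, _ => L
  | k + 1, L, x => descend k (L.sub x) x

theorem mem_descend (k : ℕ) {L : Cube d} {x : Fin d → ℝ} (hx : x ∈ L.toSet) :
    x ∈ (descend k L x).toSet := by
  induction k generalizing L with
  | zero => exact hx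
  | succ k ih => exact ih (Cube.mem_sub hx)

theorem side_descend (k : ℕ) (L : Cube d) (x : Fin d → ℝ) :
    (descend k L x).side = L.side / 2 ^ k := by
  induction k generalizing L with
  | zero => simp [descend]
  | succ k ih =>
    rw [descend, ih, Cube.sub, Cube.child, pow_succ]
    field_simp

theorem le_pathSup_descend (k : ℕ) (b : Cube d → ℝ≥0∞) (L : Cube d) (x : Fin d → ℝ) :
    b (descend k L x) ≤ pathSup k b L x := by
  induction k generalizing L with
  | zero => exact le_rfl
  | succ k ih => exact (ih _).trans le_sup_right

theorem Cube.ae_eq_closedBall (Q : Cube d) :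
    Q.toSet =ᵐ[volume]
      Metric.closedBall (fun i => Q.corner i + Q.side / 2) (Q.side / 2) := by
  have : Metric.closedBall (fun i => Q.corner i + Q.side / 2) (Q.side / 2) =
      Set.Icc Q.corner fun i => Q.corner i + Q.side := by
    rw [closedBall_pi _ (half_pos Q.side_pos).le, ← Set.pi_univ_Icc]
    refine Set.pi_congr rfl fun i _ => ?_
    rw [Real.closedBall_eq_Icc]
    congr 1 <;> ring
  rw [this]
  exact Measure.univ_pi_Ico_ae_eq_Icc

/-- **Lebesgue differentiation** along dyadic cubes. -/
theorem ae_le_iSup_pathSup {F : (Fin d → ℝ) → ℝ≥0∞} (hF : AEMeasurable F volume)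
    (hfin : ∀ Q : Cube d, ∫⁻ x in Q.toSet, F x ≠ ∞) (L : Cube d) :
    ∀ᵐ x, x ∈ L.toSet → F x ≤ ⨆ k, pathSup k (fun Q => Q.avg F) L x := by
  have hball : ∀ x : Fin d → ℝ, ∃ Q : Cube d, Metric.ball x 1 ⊆ Q.toSet := fun x => by
    refine ⟨⟨fun i => x i - 1, 2, by norm_num⟩, ?_⟩
    rw [ball_pi _ one_pos]
    refine fun y hy => Cube.mem_toSet.2 fun i => ?_
    have : y i ∈ Metric.ball (x i) 1 := hy i (Set.mem_univ i)
    rw [Real.ball_eq_Ioo] at this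
    exact ⟨this.1.le, by simp only; linarith [this.2]⟩
  have hint : ∀ Q : Cube d, IntegrableOn (fun x => (F x).toReal) Q.toSet := fun Q =>
    integrable_toReal_of_lintegral_ne_top hF.restrict (hfin Q)
  have hloc : LocallyIntegrable (fun x => (F x).toReal) volume := fun x => by
    obtain ⟨Q, hQ⟩ := hball x
    exact ⟨_, Metric.ball_mem_nhds x one_pos, (hint Q).mono_set hQ⟩
  have hlt : ∀ᵐ x, x ∈ L.toSet → F x < ∞ := by
    rw [← ae_restrict_iff' L.measurableSet]
    exact ae_lt_top' hF.restrict (hfin L)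
  -- Up to null sets the cubes of the descent are sup-norm balls that contain `x` in their closure
  -- and shrink to it, as the differentiation theorem requires.
  filter_upwards [IsUnifLocDoublingMeasure.ae_tendsto_average volume hloc 1, hlt]
    with x hx hxlt hxL
  set S := ⨆ k, pathSup k (fun Q => Q.avg F) L x with hS
  rcases eq_or_ne S ∞ with hSt | hSt
  · rw [hSt]; exact le_top
  have hside : ∀ k, (descend k L x).side / 2 = L.side / 2 * (1 / 2) ^ k := fun k => by
    rw [side_descend, div_pow, one_pow]; ring
  have hδ : Filter.Tendsto (fun k => (descend k L x).side / 2) Filter.atTop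
      (nhdsWithin 0 (Set.Ioi 0)) := by
    refine tendsto_nhdsWithin_iff.2 ⟨?_, Filter.Eventually.of_forall fun k =>
      half_pos (descend k L x).side_pos⟩
    simp only [hside]
    simpa using (tendsto_pow_atTop_nhds_zero_of_lt_one (r := (1 / 2 : ℝ)) (by norm_num)
      (by norm_num)).const_mul (L.side / 2)
  have hlim := hx (fun k i => (descend k L x).corner i + (descend k L x).side / 2)
    (fun k => (descend k L x).side / 2) hδ (Filter.Eventually.of_forall fun k => by
      rw [one_mul, mem_closedBall_iff_norm, pi_norm_le_iff_of_nonneg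
        (half_pos (descend k L x).side_pos).le]
      intro i
      have := Cube.mem_toSet.1 (mem_descend k hxL) i
      rw [Pi.sub_apply, Real.norm_eq_abs, abs_le]
      constructor <;> linarith)
  have hle : ∀ k, ⨍ y in Metric.closedBall
      (fun i => (descend k L x).corner i + (descend k L x).side / 2)
      ((descend k L x).side / 2), (F y).toReal ∂volume ≤ S.toReal := fun k => by
    have hae := (descend k L x).ae_eq_closedBall
    rw [setAverage_congr hae.symm, setAverage_eq, integral_toReal hF.restrict
      (ae_lt_top' hF.restrict (hfin _)), Measure.real, ← ENNReal.toReal_inv, smul_eq_mul,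
      ← ENNReal.toReal_mul, mul_comm, ← div_eq_mul_inv, ← Cube.avg_eq_div]
    exact ENNReal.toReal_mono hSt ((le_pathSup_descend k (fun Q => Q.avg F) L x).trans
      (le_iSup (fun k => pathSup k (fun Q => Q.avg F) L x) k))
  have := le_of_tendsto' hlim hle
  exact (ENNReal.toReal_le_toReal (hxlt hxL).ne hSt).1 this

/-- The sharp reverse Hölder inequality for weights satisfying a Fujii-Wilson condition. -/
theorem reverse_holder {F : (Fin d → ℝ) → ℝ≥0∞} (hF : AEMeasurable F volume)
    (hfin : ∀ Q : Cube d, ∫⁻ x in Q.toSet, F x ≠ ∞) {A : ℝ≥0} (hA1 : 1 ≤ A)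
    (hA : ∀ k (Q : Cube d), ∫⁻ x in Q.toSet, pathSup k (fun Q => Q.avg F) Q x ≤
      A * ∫⁻ x in Q.toSet, F x) {ε : ℝ} (hε : ε = 1 / (2 ^ (d + 1) * A)) (L : Cube d) :
    L.avg (fun x => F x ^ (1 + ε)) ≤ 2 * L.avg F ^ (1 + ε) := by
  have hA0 : (0 : ℝ) < A := by exact_mod_cast zero_lt_one.trans_le hA1
  have hA1' : (1 : ℝ) ≤ A := by exact_mod_cast hA1
  have hε0 : 0 < ε := by rw [hε]; positivity
  have hε1 : ε ≤ 1 := by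
    rw [hε, div_le_one (by positivity)]
    have : (1 : ℝ) ≤ 2 ^ (d + 1) := one_le_pow₀ (by norm_num)
    nlinarith
  -- `ε` is chosen to make this product exactly one half, the coefficient that can be absorbed.
  have hδ : (A : ℝ≥0∞) * (2 ^ d * ENNReal.ofReal ε) = 2⁻¹ := by
    rw [show (A : ℝ≥0∞) = ENNReal.ofReal A by simp,
      show (2 : ℝ≥0∞) ^ d = ENNReal.ofReal (2 ^ d) by simp [ENNReal.ofReal_pow],
      ← ENNReal.ofReal_mul (by positivity), ← ENNReal.ofReal_mul (by positivity),
      show (2 : ℝ≥0∞)⁻¹ = ENNReal.ofReal 2⁻¹ by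
        rw [ENNReal.ofReal_inv_of_pos (by norm_num)]; simp]
    congr 1
    rw [hε, pow_succ]
    field_simp
  set m := L.avg F with hm
  have hmt : m ≠ ∞ := Cube.avg_ne_top (hfin L)
  have hv := L.volume_ne_top
  have hNm : ∀ k x, m ⊔ pathSup k (fun Q => Q.avg F) L x = pathSup k (fun Q => Q.avg F) L x :=
    fun k x => sup_eq_right.2 (le_pathSup k (fun Q => Q.avg F) L x)
  have hmul : ∀ y : ℝ≥0∞, y * y ^ ε = y ^ (1 + ε) := fun y => by
    rw [ENNReal.rpow_add_of_nonneg _ _ zero_le_one hε0.le, ENNReal.rpow_one]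
  -- bound for the maximal function
  have hmax : ∀ k, ∫⁻ x in L.toSet, pathSup k (fun Q => Q.avg F) L x ^ (1 + ε) ≤
      2 * A * m ^ (1 + ε) * volume L.toSet := by
    intro k
    -- With the maximal function itself as `G`, its integral of order `1 + ε` occurs on both sides,
    -- on the right with coefficient one half.
    have h1 := lintegral_mul_sup_pathSup_rpow_le (A := A) (F := F) hε0 hε1
      (G := fun k J m x => m ⊔ pathSup k (fun Q => Q.avg F) J x)
      (fun k J m η x hx hm => sup_pathSup_succ F k hm hx)
      (fun k J => by
        refine le_trans (lintegral_mono fun x => ?_) (hA k J)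
        exact sup_le (le_pathSup k (fun Q => Q.avg F) J x) le_rfl) k L m le_rfl hmt
    simp only [hNm, hmul, hδ] at h1
    have hRf : ∫⁻ x in L.toSet, pathSup k (fun Q => Q.avg F) L x ^ (1 + ε) ≠ ∞ := by
      obtain ⟨K, hK, hK'⟩ := pathSup_lt_top k (b := fun Q => Q.avg F) (L := L) fun Q hQ =>
        (Cube.avg_ne_top (hfin Q)).lt_top
      refine ((setLIntegral_mono' L.measurableSet fun x hx =>
        ENNReal.rpow_le_rpow (hK' x hx) (by linarith : (0 : ℝ) ≤ 1 + ε)).trans_lt ?_).ne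
      rw [Cube.setLIntegral_const]
      finiteness
    set R := ∫⁻ x in L.toSet, pathSup k (fun Q => Q.avg F) L x ^ (1 + ε) with hR
    have h2 : 2⁻¹ * R + 2⁻¹ * R ≤ A * m ^ (1 + ε) * volume L.toSet + 2⁻¹ * R := by
      calc 2⁻¹ * R + 2⁻¹ * R = R := by rw [← add_mul, ENNReal.inv_two_add_inv_two, one_mul]
        _ ≤ _ := le_self_add.trans h1
        _ ≤ m ^ ε * (A * (m * volume L.toSet)) + 2⁻¹ * R := by
            gcongr
            rw [hm, L.avg_mul_volume]
            exact hA k L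
        _ = A * (m * m ^ ε) * volume L.toSet + 2⁻¹ * R := by ring
        _ = _ := by rw [hmul]
    have h3 : 2⁻¹ * R ≤ A * m ^ (1 + ε) * volume L.toSet :=
      (ENNReal.add_le_add_iff_right (by finiteness)).1 h2
    calc R = 2 * (2⁻¹ * R) := by
          rw [← mul_assoc, ENNReal.mul_inv_cancel (by simp) (by simp), one_mul]
      _ ≤ 2 * (A * m ^ (1 + ε) * volume L.toSet) := by gcongr
      _ = _ := by ring
  have hint : ∀ k, ∫⁻ x in L.toSet, F x * pathSup k (fun Q => Q.avg F) L x ^ ε ≤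
      2 * m ^ (1 + ε) * volume L.toSet := by
    intro k
    -- The same inequality with `F` as `G`, where `A = 1` suffices; the bound just found for the
    -- maximal function is inserted on the right.
    have h1 := lintegral_mul_sup_pathSup_rpow_le (A := 1) (F := F) hε0 hε1
      (G := fun k J m x => F x) (fun k J m η x hx hm => rfl) (fun k J => by simp) k L m le_rfl hmt
    simp only [hNm, ENNReal.coe_one, one_mul] at h1
    calc _ ≤ _ := le_self_add.trans h1
      _ ≤ m ^ ε * (m * volume L.toSet) +
          2 ^ d * ENNReal.ofReal ε * (2 * A * m ^ (1 + ε) * volume L.toSet) := by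
          gcongr
          · rw [hm, L.avg_mul_volume]
          · exact hmax k
      _ = m * m ^ ε * volume L.toSet + 2 * (A * (2 ^ d * ENNReal.ofReal ε)) *
          (m ^ (1 + ε) * volume L.toSet) := by ring
      _ = _ := by
          rw [hδ, hmul, ENNReal.mul_inv_cancel (by simp) (by simp)]; ring
  have hfinal : ∫⁻ x in L.toSet, F x ^ (1 + ε) ≤ 2 * m ^ (1 + ε) * volume L.toSet := by
    have hae : ∀ᵐ x ∂volume.restrict L.toSet, F x ^ (1 + ε) ≤
        ⨆ k, F x * pathSup k (fun Q => Q.avg F) L x ^ ε := by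
      rw [ae_restrict_iff' L.measurableSet]
      filter_upwards [ae_le_iSup_pathSup hF hfin L] with x hx hxL
      rw [← hmul, ← ENNReal.mul_iSup]
      gcongr
      refine (ENNReal.rpow_le_rpow (hx hxL) hε0.le).trans ?_
      rw [← ENNReal.orderIsoRpow_apply ε hε0, OrderIso.map_iSup]
      rfl
    refine (lintegral_mono_ae hae).trans ?_
    rw [lintegral_iSup']
    · exact iSup_le hint
    · exact fun k => (hF.mul ((aemeasurable_pathSup k _ L).pow_const ε)).restrict
    · refine Filter.Eventually.of_forall fun x => monotone_nat_of_le_succ fun k => ?_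
      gcongr
      exact pathSup_le_succ k _ L x
  rw [Cube.avg_eq_div]
  exact ENNReal.div_le_of_le_mul hfinal

/-! ### Consequences of the Fujii-Wilson condition -/

theorem aInftyChar_le_iff {w : (Fin d → ℝ) → ℝ≥0∞} {A : ℝ≥0} (h : aInftyChar w ≤ A) (Q : Cube d) :
    ∫⁻ x in Q.toSet, w x ≠ ∞ ∧
      ∫⁻ x in Q.toSet, maximalFn (Q.toSet.indicator w) x ≤ A * ∫⁻ x in Q.toSet, w x := by
  have hQ := (le_iSup (f := fun Q : Cube d => if ∫⁻ x in Q.toSet, w x = ∞ then ∞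
    else (∫⁻ x in Q.toSet, maximalFn (Q.toSet.indicator w) x) / ∫⁻ x in Q.toSet, w x) Q).trans h
  split_ifs at hQ with htop
  · simp at hQ
  · exact ⟨htop, (ENNReal.div_le_iff_le_mul (Or.inr ENNReal.coe_ne_top) (Or.inl htop)).1 hQ⟩

/-- The cubes of the descent stay inside `Q`, so localizing the weight to `Q` does not change their
averages. -/
theorem pathSup_avg_le_maximalFn (k : ℕ) (w : (Fin d → ℝ) → ℝ≥0∞) (Q : Cube d) {x : Fin d → ℝ}
    (hx : x ∈ Q.toSet) :
    pathSup k (fun P => P.avg w) Q x ≤ maximalFn (Q.toSet.indicator w) x := by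
  refine pathSup_le k Q hx fun P hP hxP => ?_
  have : P.avg w = P.avg (Q.toSet.indicator w) :=
    setLAverage_congr_fun P.measurableSet fun y hy => by
      rw [Set.indicator_of_mem (hP hy)]
  rw [this]
  exact le_iSup₂ (f := fun (P : Cube d) (_ : x ∈ P.toSet) => P.avg (Q.toSet.indicator w)) P hxP

theorem reverse_holder_of_aInftyChar {w : (Fin d → ℝ) → ℝ≥0∞} (hw : AEMeasurable w volume) {A : ℝ≥0}
    (hA1 : 1 ≤ A) (hA : aInftyChar w ≤ A) {ε : ℝ} (hε : ε = 1 / (2 ^ (d + 1) * A)) (L : Cube d) :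
    L.avg (fun x => w x ^ (1 + ε)) ≤ 2 * L.avg w ^ (1 + ε) := by
  refine reverse_holder hw (fun Q => (aInftyChar_le_iff hA Q).1) hA1 (fun k Q => ?_) hε L
  exact (setLIntegral_mono' Q.measurableSet fun x hx => pathSup_avg_le_maximalFn k w Q hx).trans
    (aInftyChar_le_iff hA Q).2

/-- Since `log A ≤ A`, the number `A ^ ε` stays below `e` when `ε ≤ 1 / A`. An exponent exceeding
`1` by a multiple of `1 / A` therefore still gives linear growth in `A`. -/
theorem rpow_exponent_le {c A q : ℝ} (hc : 1 ≤ c) (hA : 1 ≤ A) (hq : 1 < q) {ε s : ℝ}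
    (hεA : ε ≤ 1 / A) (hs : s ≤ 1 + (q - 1) * ε) :
    (c * A) ^ s ≤ c * (c * Real.exp 1) ^ (q - 1) * A := by
  have hA0 : 0 < A := by linarith
  have hc0 : 0 < c := by linarith
  have hcA : 1 ≤ c * A := by nlinarith
  have hε1 : ε ≤ 1 := hεA.trans ((div_le_one hA0).2 hA)
  have h1 : A ^ ε ≤ Real.exp 1 := by
    rw [Real.rpow_def_of_pos hA0]
    refine Real.exp_le_exp.2 ?_
    have hl := Real.log_le_sub_one_of_pos hA0
    have hl0 := Real.log_nonneg hA
    calc Real.log A * ε ≤ Real.log A * (1 / A) := by gcongr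
      _ ≤ A * (1 / A) := by gcongr; linarith
      _ = 1 := by field_simp
  have h2 : c ^ ε ≤ c := by
    simpa using Real.rpow_le_rpow_of_exponent_le hc hε1
  calc (c * A) ^ s ≤ (c * A) ^ (1 + (q - 1) * ε) := Real.rpow_le_rpow_of_exponent_le hcA hs
    _ = c * A * (c ^ ε * A ^ ε) ^ (q - 1) := by
        rw [Real.rpow_add (by positivity), Real.rpow_one, ← Real.mul_rpow hc0.le hA0.le,
          ← Real.rpow_mul (by positivity), mul_comm ε]
    _ ≤ c * A * (c * Real.exp 1) ^ (q - 1) := by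
        have : 0 ≤ q - 1 := by linarith
        gcongr
    _ = _ := by ring

/-- For each bound `A` on Fujii-Wilson characteristics there is an exponent `r < q` so close to `q`
that a Hölder inequality with exponents `q'` and `r` holds for all weights with characteristic at
most `A`, but such that the `L^q` norm of the maximal function of order `r` is of order
`A ^ (1 / q)`. -/
theorem exists_exponent (d : ℕ) {q : ℝ} (hq : 1 < q) : ∃ C : ℝ≥0, ∀ A : ℝ≥0, 1 ≤ A →
    ∃ r, 1 < r ∧ r < q ∧
      (∀ w : (Fin d → ℝ) → ℝ≥0∞, AEMeasurable w volume → aInftyChar w ≤ A →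
        ∀ g : (Fin d → ℝ) → ℝ≥0∞, AEMeasurable g volume → ∀ Q : Cube d,
          Q.avg (fun x => w x ^ (1 - 1 / q) * g x) ≤
            2 * Q.avg w ^ (1 - 1 / q) * Q.avg (fun x => g x ^ r) ^ (1 / r)) ∧
      (∀ g : (Fin d → ℝ) → ℝ≥0∞, AEMeasurable g volume → ∀ (k : ℕ) (L : Cube d),
        ∫⁻ x in L.toSet, pathSup k (fun Q => Q.avg fun x => g x ^ r) L x ^ (q / r) ≤
          C * A * ∫⁻ x in L.toSet, g x ^ q) := by
  have hq0 : 0 < q - 1 := by linarith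
  set c : ℝ := 2 ^ (d + 1) * ((q + 1) / (q - 1)) with hc
  have hc1 : 1 ≤ c := by
    have h1 : (1 : ℝ) ≤ 2 ^ (d + 1) := one_le_pow₀ (by norm_num)
    have h2 : 1 ≤ (q + 1) / (q - 1) := by rw [le_div_iff₀ hq0]; linarith
    nlinarith
  refine ⟨(c * (c * Real.exp 1) ^ (q - 1)).toNNReal, fun A hA1 => ?_⟩
  have hA1' : (1 : ℝ) ≤ A := by exact_mod_cast hA1
  have hA0 : (0 : ℝ) < A := by linarith
  set ε : ℝ := 1 / (2 ^ (d + 1) * A) with hε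
  have hε0 : 0 < ε := by positivity
  have h2d : (1 : ℝ) ≤ 2 ^ (d + 1) := one_le_pow₀ (by norm_num)
  have hεA : ε ≤ 1 / A := by
    rw [hε]
    refine one_div_le_one_div_of_le hA0 ?_
    nlinarith
  have hε1 : ε ≤ 1 := hεA.trans ((div_le_one hA0).2 hA1')
  have hqε : 0 < 1 + q * ε := by nlinarith
  -- The exponent conjugate to `r` is then `q' (1 + ε)`, so that in Hölder's inequality `w ^ (1 /
  -- q')` becomes `w ^ (1 + ε)`, the power controlled by the reverse Hölder inequality.
  set r : ℝ := q * (1 + ε) / (1 + q * ε) with hr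
  have hr1 : 1 < r := by rw [hr, lt_div_iff₀ hqε]; nlinarith
  have hrq : r < q := by
    rw [hr, div_lt_iff₀ hqε]
    have : 0 < (q - 1) * (q * ε) := by positivity
    nlinarith
  refine ⟨r, hr1, hrq, fun w hw hwA g hg Q => ?_, fun g hg k L => ?_⟩
  · have hconj : (q / (q - 1) * (1 + ε)).HolderConjugate r := by
      rw [Real.holderConjugate_iff]
      constructor
      · have : 1 < q / (q - 1) := by rw [lt_div_iff₀ hq0]; linarith
        nlinarith
      · rw [hr]
        field_simp
        ring
    have hH := ENNReal.lintegral_mul_le_Lp_mul_Lq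
      ((volume.restrict Q.toSet Set.univ)⁻¹ • volume.restrict Q.toSet) hconj
      (f := fun x => w x ^ (1 - 1 / q)) (g := g)
      ((hw.pow_const _).restrict.smul_measure _) (hg.restrict.smul_measure _)
    simp only [Pi.mul_apply, ← ENNReal.rpow_mul] at hH
    have he : (1 - 1 / q) * (q / (q - 1) * (1 + ε)) = 1 + ε := by field_simp
    rw [he] at hH
    have hRH := reverse_holder_of_aInftyChar hw hA1 hwA hε Q
    have hpos : 0 ≤ 1 / (q / (q - 1) * (1 + ε)) := by
      have : 0 < q / (q - 1) := by positivity
      positivity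
    refine hH.trans ?_
    gcongr ?_ * _
    refine (ENNReal.rpow_le_rpow hRH hpos).trans ?_
    have hexp : (1 + ε) * (1 / (q / (q - 1) * (1 + ε))) = 1 - 1 / q := by field_simp
    rw [ENNReal.mul_rpow_of_nonneg _ _ hpos, ← ENNReal.rpow_mul, hexp]
    gcongr
    · conv_rhs => rw [← ENNReal.rpow_one 2]
      refine ENNReal.rpow_le_rpow_of_exponent_le (by norm_num) ?_
      rw [div_le_one (by have : 0 < q / (q - 1) := by positivity
                         positivity)]
      exact hconj.lt.le
  · have hs : 1 < q / r := by rw [lt_div_iff₀ (by linarith)]; linarith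
    have hD := lintegral_pathSup_rpow_le (hg.pow_const r) hs k L
    refine hD.trans ?_
    simp only [← ENNReal.rpow_mul, mul_div_cancel₀ q (by linarith : r ≠ 0)]
    gcongr
    have hsr : q / r = (1 + q * ε) / (1 + ε) := by
      rw [hr]; field_simp
    have hs1 : q / r ≤ 1 + (q - 1) * ε := by
      rw [hsr, div_le_iff₀ (by positivity)]
      have : 0 ≤ (q - 1) * ε * ε := by positivity
      nlinarith
    -- Doob's constant is the conjugate exponent of `q / r`, of order `1 / ε` and so at most `c *
    -- A`.
    have hbase : q / r / (q / r - 1) ≤ c * A := by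
      have : q / r / (q / r - 1) = (1 + q * ε) / ((q - 1) * ε) := by
        rw [hsr]
        have h1 : (1 + q * ε) / (1 + ε) - 1 = (q - 1) * ε / (1 + ε) := by field_simp; ring
        rw [h1]; field_simp
      rw [this]
      calc (1 + q * ε) / ((q - 1) * ε) ≤ (q + 1) / ((q - 1) * ε) := by
            refine div_le_div_of_nonneg_right ?_ (by positivity)
            nlinarith
        _ = c * A := by rw [hc, hε]; field_simp
    have hb0 : 0 ≤ q / r / (q / r - 1) := div_nonneg (by linarith) (by linarith)
    rw [ENNReal.ofReal_rpow_of_nonneg hb0 (by linarith), show (A : ℝ≥0∞) = ENNReal.ofReal A by simp,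
      show ((c * (c * Real.exp 1) ^ (q - 1)).toNNReal : ℝ≥0∞) = ENNReal.ofReal _ from rfl,
      ← ENNReal.ofReal_mul (by positivity)]
    refine ENNReal.ofReal_le_ofReal ?_
    exact (Real.rpow_le_rpow hb0 hbase (by linarith)).trans
      (rpow_exponent_le hc1 hA1' hq hεA hs1)

end MaximalBounds

end MatrixSquare

end

noncomputable section

namespace MatrixSquare

/-! ### Powers of positive definite matrices -/

section Powers

variable {d n : ℕ} {A : Matrix (Fin n) (Fin n) ℂ}

theorem spectrum_pos (hA : A.PosDef) {t : ℝ} (ht : t ∈ spectrum ℝ A) : 0 < t := by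
  rw [hA.isHermitian.spectrum_real_eq_range_eigenvalues] at ht
  obtain ⟨i, rfl⟩ := ht
  exact hA.eigenvalues_pos i

theorem isSelfAdjoint_matrixPow (A : Matrix (Fin n) (Fin n) ℂ) (s : ℝ) :
    IsSelfAdjoint (matrixPow A s) :=
  cfc_predicate _ _

theorem matrixPow_mul_neg (hA : A.PosDef) (s : ℝ) : matrixPow A s * matrixPow A (-s) = 1 := by
  have hsa : IsSelfAdjoint A := hA.isHermitian
  rw [matrixPow, matrixPow, ← cfc_mul _ _ A (Matrix.finite_real_spectrum.continuousOn _)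
    (Matrix.finite_real_spectrum.continuousOn _), ← cfc_const_one ℝ A hsa]
  refine cfc_congr fun t ht => ?_
  rw [← Real.rpow_add (spectrum_pos hA ht), add_neg_cancel, Real.rpow_zero]

theorem matrixPow_matrixPow (hA : A.PosDef) (s t : ℝ) :
    matrixPow (matrixPow A s) t = matrixPow A (s * t) := by
  have hsa : IsSelfAdjoint A := hA.isHermitian
  rw [matrixPow, matrixPow, ← cfc_comp _ _ A hsa
    ((Matrix.finite_real_spectrum.image _).continuousOn _)
    (Matrix.finite_real_spectrum.continuousOn _)]
  refine cfc_congr fun x hx => ?_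
  simp only [Function.comp_apply]
  rw [← Real.rpow_mul (spectrum_pos hA hx).le]

theorem matrixPow_algebraMap (c s : ℝ) :
    matrixPow (algebraMap ℝ (Matrix (Fin n) (Fin n) ℂ) c) s = algebraMap ℝ _ (c ^ s) :=
  cfc_algebraMap c fun t => t ^ s

theorem adjoint_op_matrixPow (A : Matrix (Fin n) (Fin n) ℂ) (s : ℝ) :
    ContinuousLinearMap.adjoint (op (matrixPow A s)) = op (matrixPow A s) := by
  rw [← ContinuousLinearMap.star_eq_adjoint, op, ← map_star, (isSelfAdjoint_matrixPow A s).star_eq]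

theorem op_matrixPow_apply_neg (hA : A.PosDef) (s : ℝ) (v : EuclideanSpace ℂ (Fin n)) :
    op (matrixPow A s) (op (matrixPow A (-s)) v) = v := by
  have := congrArg op (matrixPow_mul_neg hA s)
  rw [op, map_mul, show op (1 : Matrix (Fin n) (Fin n) ℂ) = 1 from map_one _] at this
  exact congrArg (fun B : EuclideanSpace ℂ (Fin n) →L[ℂ] EuclideanSpace ℂ (Fin n) => B v) this

theorem op_matrixPow_injective (hA : A.PosDef) (s : ℝ) :
    Function.Injective (op (matrixPow A s)) := by
  intro v w h
  have h1 := op_matrixPow_apply_neg hA (-s) v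
  have h2 := op_matrixPow_apply_neg hA (-s) w
  rw [neg_neg] at h1 h2
  rw [← h1, ← h2, h]

/-- Polynomials converging to `t ^ s` on all compact subsets of `(0, ∞)`. -/
theorem exists_polynomials_tendsto_rpow (s : ℝ) : ∃ P : ℕ → Polynomial ℝ, ∀ t, 0 < t →
    Filter.Tendsto (fun j => (P j).eval t) Filter.atTop (nhds (t ^ s)) := by
  have h : ∀ j : ℕ, ∃ P : Polynomial ℝ, ∀ t ∈ Set.Icc (1 / ((j : ℝ) + 1)) (j + 1),
      |P.eval t - t ^ s| < 1 / ((j : ℝ) + 1) := fun j =>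
    exists_polynomial_near_of_continuousOn _ _ _ (fun t ht => by
      have : 0 < t := (by positivity : (0 : ℝ) < 1 / ((j : ℝ) + 1)).trans_le ht.1
      exact (Real.continuousAt_rpow_const t s (Or.inl this.ne')).continuousWithinAt) _
      (by positivity)
  choose P hP using h
  refine ⟨P, fun t ht => ?_⟩
  rw [tendsto_iff_dist_tendsto_zero]
  refine squeeze_zero' (Filter.Eventually.of_forall fun _ => dist_nonneg) ?_
    tendsto_one_div_add_atTop_nhds_zero_nat
  have h1 : ∀ᶠ j : ℕ in Filter.atTop, 1 / ((j : ℝ) + 1) < t :=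
    (tendsto_one_div_add_atTop_nhds_zero_nat (𝕜 := ℝ)).eventually (gt_mem_nhds ht)
  filter_upwards [h1, Filter.eventually_ge_atTop ⌈t⌉₊] with j hj hj'
  exact (hP j t ⟨hj.le, (Nat.le_ceil t).trans (by
    have : (⌈t⌉₊ : ℝ) ≤ j := by exact_mod_cast hj'
    linarith)⟩).le

variable {W : (Fin d → ℝ) → Matrix (Fin n) (Fin n) ℂ}

/-- `W ^ s` is an a.e. limit of polynomials in `W`: pointwise convergence of the polynomials on `(0,
∞)` is uniform on each spectrum, which is finite. -/
theorem IsMatrixWeight.aemeasurable_matrixPow (hW : IsMatrixWeight W) (s : ℝ) (i j : Fin n) :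
    AEMeasurable (fun x => matrixPow (W x) s i j) volume := by
  obtain ⟨P, hP⟩ := exists_polynomials_tendsto_rpow s
  have hm : AEMeasurable (fun x => (fun i j => W x i j : Fin n → Fin n → ℂ)) volume :=
    aemeasurable_pi_lambda _ fun i => aemeasurable_pi_lambda _ fun j => hW.aemeasurable i j
  refine aemeasurable_of_tendsto_metrizable_ae Filter.atTop
    (f := fun k x => (Polynomial.aeval (W x) (P k)) i j) (fun k => ?_) ?_
  · have hc : Continuous fun B : Matrix (Fin n) (Fin n) ℂ => (Polynomial.aeval B (P k)) i j :=
      (Polynomial.continuous_aeval (P k)).matrix_elem i j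
    have hc' : Continuous fun B : Fin n → Fin n → ℂ =>
        (Polynomial.aeval (Matrix.of B) (P k)) i j := hc.comp continuous_id
    exact hc'.measurable.comp_aemeasurable hm
  · filter_upwards [hW.posDef] with x hx
    have hsa : IsSelfAdjoint (W x) := hx.isHermitian
    have h1 : Filter.Tendsto (fun k => Polynomial.aeval (W x) (P k)) Filter.atTop
        (nhds (matrixPow (W x) s)) := by
      simp only [← cfc_polynomial (p := IsSelfAdjoint) _ _ hsa]
      refine tendsto_cfc_fun ?_ (Filter.Eventually.of_forall fun k =>
        Matrix.finite_real_spectrum.continuousOn _)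
      have hf : (spectrum ℝ (W x)).Finite := Matrix.finite_real_spectrum
      rw [Metric.tendstoUniformlyOn_iff]
      intro ε hε
      have : ∀ t ∈ spectrum ℝ (W x), ∀ᶠ k in Filter.atTop,
          dist (t ^ s) ((P k).eval t) < ε := fun t ht => by
        have := Metric.tendsto_nhds.1 (hP t (spectrum_pos hx ht)) ε hε
        simpa only [dist_comm] using this
      exact (Filter.eventually_all_finite hf).2 this
    exact ((continuous_id.matrix_elem i j).tendsto _).comp h1

theorem IsMatrixWeight.aestronglyMeasurable_op (hW : IsMatrixWeight W) (s : ℝ)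
    {f : (Fin d → ℝ) → EuclideanSpace ℂ (Fin n)} (hf : AEStronglyMeasurable f volume) :
    AEStronglyMeasurable (fun x => op (matrixPow (W x) s) (f x)) volume := by
  have h1 : AEMeasurable (fun x => (matrixPow (W x) s).mulVec (f x).ofLp) volume := by
    refine aemeasurable_pi_lambda _ fun i => ?_
    simp only [Matrix.mulVec, dotProduct]
    refine Finset.aemeasurable_fun_sum _ fun j _ => (hW.aemeasurable_matrixPow s i j).mul ?_
    have : Measurable fun v : EuclideanSpace ℂ (Fin n) => v j :=
      (EuclideanSpace.proj (𝕜 := ℂ) j).continuous.measurable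
    exact this.comp_aemeasurable hf.aemeasurable
  have h2 : Continuous fun v : Fin n → ℂ => (WithLp.toLp 2 v : EuclideanSpace ℂ (Fin n)) :=
    PiLp.continuous_toLp 2 _
  exact (h2.comp_aestronglyMeasurable h1.aestronglyMeasurable).congr
    (Filter.Eventually.of_forall fun x => (Matrix.toEuclideanCLM_toLp _ _).symm)

end Powers

/-! ### Reducing operators -/

section Reducing

variable {d n : ℕ}

/-- **Auerbach's lemma**: a norm on `ℂ^n` is comparable to the maximum norm of coordinates. -/
theorem exists_auerbach_basis {F : Type*} [NormedAddCommGroup F] [NormedSpace ℂ F]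
    (T : EuclideanSpace ℂ (Fin n) →ₗ[ℂ] F) (hT : Function.Injective T) :
    ∃ b : Module.Basis (Fin n) ℂ (EuclideanSpace ℂ (Fin n)),
      (∀ i, ‖T (b i)‖ ≤ 1) ∧ ∀ v i, ‖b.repr v i‖ ≤ ‖T v‖ := by
  classical
  set e := (EuclideanSpace.basisFun (Fin n) ℂ).toBasis with he
  have hTc : Continuous T := T.continuous_of_finiteDimensional
  obtain ⟨c, hc, hanti⟩ := T.injective_iff_antilipschitz.1 hT
  set K : Set (Fin n → EuclideanSpace ℂ (Fin n)) := {b | ∀ i, ‖T (b i)‖ ≤ 1} with hK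
  have hKclosed : IsClosed K := by
    rw [hK, Set.ofPred_forall]
    exact isClosed_iInter fun i =>
      isClosed_le (hTc.comp (continuous_apply i)).norm continuous_const
  have hKcomp : IsCompact K := by
    refine Metric.isCompact_of_isClosed_isBounded hKclosed ?_
    refine (Metric.isBounded_closedBall (x := 0) (r := c)).subset fun b hb => ?_
    rw [mem_closedBall_zero_iff, pi_norm_le_iff_of_nonneg c.coe_nonneg]
    intro i
    have h1 := hanti.le_mul_dist (b i) 0
    rw [dist_zero_right, map_zero, dist_zero_right] at h1
    exact h1.trans (mul_le_of_le_one_right c.coe_nonneg (hb i))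
  have hdet : Continuous fun b : Fin n → EuclideanSpace ℂ (Fin n) => ‖e.det b‖ := by
    simp only [Module.Basis.det_apply]
    refine (Continuous.matrix_det ?_).norm
    refine continuous_matrix fun i j => ?_
    simp only [Module.Basis.toMatrix_apply]
    exact ((e.coord i).continuous_of_finiteDimensional).comp (continuous_apply j)
  obtain ⟨b, hbK, hmax⟩ := hKcomp.exists_isMaxOn ⟨0, by simp [hK]⟩ hdet.continuousOn
  have hbmax : ∀ b' ∈ K, ‖e.det b'‖ ≤ ‖e.det b‖ := fun b' hb' => hmax hb'
  -- A small multiple of the standard basis is admissible and has nonzero determinant, so the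
  -- maximum is not zero.
  have hb0 : e.det b ≠ 0 := by
    intro h0
    set r : ℝ := (1 + ∑ i, ‖T (e i)‖)⁻¹ with hr
    have hpos : 0 < 1 + ∑ i, ‖T (e i)‖ := by positivity
    have hmem : (fun i => (r : ℂ) • e i) ∈ K := fun i => by
      rw [map_smul, norm_smul, Complex.norm_real, Real.norm_eq_abs, abs_of_pos (by positivity), hr,
        inv_mul_le_iff₀ hpos, mul_one]
      have := Finset.single_le_sum (f := fun i => ‖T (e i)‖) (fun _ _ => norm_nonneg _)
        (Finset.mem_univ i)
      linarith
    have h1 := hbmax _ hmem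
    rw [h0, norm_zero] at h1
    have h2 : e.det (fun i => (r : ℂ) • e i) = (r : ℂ) ^ n := by
      have := (e.det).map_smul_univ (fun _ => (r : ℂ)) e
      rw [this, e.det_self]; simp
    rw [h2, norm_pow, Complex.norm_real, Real.norm_eq_abs, abs_of_pos (by positivity)] at h1
    have : 0 < r ^ n := by positivity
    linarith
  have hbasis := (Module.Basis.is_basis_iff_det e).2 (isUnit_iff_ne_zero.2 hb0)
  set B := Module.Basis.mk hbasis.1 hbasis.2.ge with hB
  have hBb : ∀ i, B i = b i := fun i => Module.Basis.mk_apply _ _ i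
  refine ⟨B, fun i => by rw [hBb]; exact hbK i, ?_⟩
  -- Cramer's rule: a coordinate is a quotient of determinants, at most `1` in modulus because `b`
  -- maximizes the determinant.
  have hcoord : ∀ v, ‖T v‖ ≤ 1 → ∀ i, ‖B.repr v i‖ ≤ 1 := by
    intro v hv i
    have h1 := congrArg (fun f => f v) (e.det_smul_mk_coord_eq_det_update hbasis.1 hbasis.2.ge i)
    simp only [LinearMap.smul_apply, smul_eq_mul, Module.Basis.coord_apply] at h1
    have h2 : Function.update b i v ∈ K := fun j => by
      by_cases hj : j = i
      · subst hj; simpa using hv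
      · rw [Function.update_of_ne hj]; exact hbK j
    have h3 := hbmax _ h2
    have h4 : e.det (Function.update b i v) = e.det b * B.repr v i := h1.symm
    rw [h4, norm_mul] at h3
    exact le_of_mul_le_mul_left (by simpa using h3) (norm_pos_iff.2 hb0)
  intro v i
  rcases eq_or_ne v 0 with rfl | hv
  · simp
  have hTv : 0 < ‖T v‖ := norm_pos_iff.2 fun h => hv (hT (by rw [h, map_zero]))
  have h1 := hcoord (((‖T v‖⁻¹ : ℝ) : ℂ) • v) (by
    rw [map_smul, norm_smul, Complex.norm_real, norm_inv, norm_norm, inv_mul_cancel₀ hTv.ne']) i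
  rw [map_smul, Finsupp.smul_apply, norm_smul, Complex.norm_real, norm_inv, norm_norm,
    inv_mul_le_iff₀ hTv, mul_one] at h1
  exact h1

/-- `M` carries the standard basis to an Auerbach basis, so `M⁻¹ v` is the vector of the `n`
Auerbach coordinates of `v`. -/
theorem exists_auerbach_equiv {F : Type*} [NormedAddCommGroup F] [NormedSpace ℂ F]
    (T : EuclideanSpace ℂ (Fin n) →ₗ[ℂ] F) (hT : Function.Injective T) :
    ∃ M : EuclideanSpace ℂ (Fin n) ≃L[ℂ] EuclideanSpace ℂ (Fin n),
      (∀ i, ‖T (M (EuclideanSpace.single i 1))‖ ≤ 1) ∧ ∀ v, ‖M.symm v‖ ≤ n * ‖T v‖ := by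
  obtain ⟨b, hb1, hb2⟩ := exists_auerbach_basis T hT
  set e := (EuclideanSpace.basisFun (Fin n) ℂ).toBasis with he
  refine ⟨(e.equiv b (Equiv.refl _)).toContinuousLinearEquiv, fun i => ?_, fun v => ?_⟩
  · have : e i = EuclideanSpace.single i 1 := by simp [he]
    simp only [LinearEquiv.coe_toContinuousLinearEquiv']
    rw [← this, Module.Basis.equiv_apply]
    exact hb1 i
  · have h1 : (e.equiv b (Equiv.refl _)).toContinuousLinearEquiv.symm v =
        ∑ i, b.repr v i • e i := by
      rw [ContinuousLinearEquiv.symm_apply_eq]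
      simp only [LinearEquiv.coe_toContinuousLinearEquiv', map_sum, map_smul,
        Module.Basis.equiv_apply, Equiv.refl_apply]
      exact (b.sum_repr v).symm
    rw [h1]
    calc ‖∑ i, b.repr v i • e i‖ ≤ ∑ i : Fin n, ‖T v‖ := by
          refine norm_sum_le_of_le _ fun i _ => ?_
          rw [norm_smul]
          have : ‖e i‖ = 1 := by simp [he]
          rw [this, mul_one]
          exact hb2 v i
      _ = n * ‖T v‖ := by simp

/-- The reducing operator of `R` over a cube: up to dimensional constants, `|M⁻¹ v|` is the
`L^s` average of `|R v|`. -/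
theorem exists_reducing {R : (Fin d → ℝ) → EuclideanSpace ℂ (Fin n) →L[ℂ] EuclideanSpace ℂ (Fin n)}
    (hR : ∀ v, AEStronglyMeasurable (fun x => R x v) volume)
    (hinj : ∀ᵐ x, Function.Injective (R x)) {s : ℝ} (hs : 1 ≤ s) (Q : Cube d)
    (hfin : ∀ v, ∫⁻ x in Q.toSet, ‖R x v‖ₑ ^ s ≠ ∞) :
    ∃ M : EuclideanSpace ℂ (Fin n) ≃L[ℂ] EuclideanSpace ℂ (Fin n),
      (∀ i, Q.avg (fun x => ‖R x (M (EuclideanSpace.single i 1))‖ₑ ^ s) ≤ 1) ∧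
        ∀ v, ‖M.symm v‖ₑ ≤ n * Q.avg (fun x => ‖R x v‖ₑ ^ s) ^ (1 / s) := by
  have hs0 : 0 < s := by linarith
  set μ : Measure (Fin d → ℝ) :=
    (volume.restrict Q.toSet Set.univ)⁻¹ • volume.restrict Q.toSet with hμ
  have havg : ∀ F, Q.avg F = ∫⁻ x, F x ∂μ := fun F => rfl
  have hp0 : ENNReal.ofReal s ≠ 0 := by simpa using hs0
  have : Fact (1 ≤ ENNReal.ofReal s) := ⟨by simpa using hs⟩
  have hnorm : ∀ v, eLpNorm (fun x => R x v) (ENNReal.ofReal s) μ =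
      Q.avg (fun x => ‖R x v‖ₑ ^ s) ^ (1 / s) := fun v => by
    rw [eLpNorm_eq_lintegral_rpow_enorm_toReal hp0 ENNReal.ofReal_ne_top,
      ENNReal.toReal_ofReal hs0.le, havg]
  have hmem : ∀ v, MemLp (fun x => R x v) (ENNReal.ofReal s) μ := fun v => by
    refine ⟨(hR v).restrict.smul_measure _, ?_⟩
    rw [hnorm]
    exact (ENNReal.rpow_ne_top_of_nonneg (by positivity) (Cube.avg_ne_top (hfin v))).lt_top
  -- Constant vectors are embedded into `L^s` over the normalized cube, which makes the `L^s`
  -- average of `|R v|` a norm to which Auerbach's lemma applies.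
  let T : EuclideanSpace ℂ (Fin n) →ₗ[ℂ] Lp (EuclideanSpace ℂ (Fin n)) (ENNReal.ofReal s) μ :=
    { toFun := fun v => (hmem v).toLp _
      map_add' := fun v w => by
        rw [← MemLp.toLp_add]
        congr 1; ext1 x; simp
      map_smul' := fun c v => by
        rw [RingHom.id_apply, ← MemLp.toLp_const_smul]
        congr 1; ext1 x; simp }
  have hTn : ∀ v, ‖T v‖ₑ = Q.avg (fun x => ‖R x v‖ₑ ^ s) ^ (1 / s) := fun v => by
    rw [← hnorm]
    exact Lp.enorm_toLp (hf := hmem v)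
  have hTinj : Function.Injective T := by
    rw [injective_iff_map_eq_zero]
    intro v hv
    have h1 : (fun x => R x v) =ᵐ[μ] 0 := (hmem v).toLp_eq_toLp_iff MemLp.zero |>.1 (by
      rw [MemLp.toLp_zero]; exact hv)
    have hμv : μ ≪ volume := Measure.smul_absolutelyContinuous.trans Measure.restrict_le_self.absolutelyContinuous
    have hμ0 : μ ≠ 0 := by
      intro h
      have : μ Set.univ = 1 := by
        rw [hμ, Measure.smul_apply, Measure.restrict_apply_univ, smul_eq_mul,
          ENNReal.inv_mul_cancel Q.volume_ne_zero Q.volume_ne_top]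
      rw [h] at this
      simp at this
    have : (ae μ).NeBot := ae_neBot.2 hμ0
    obtain ⟨x, hx1, hx2⟩ := (h1.and (hμv.ae_le hinj)).exists
    exact hx2 (by simpa using hx1)
  obtain ⟨M, hM1, hM2⟩ := exists_auerbach_equiv T hTinj
  refine ⟨M, fun i => ?_, fun v => ?_⟩
  · have h1 : ‖T (M (EuclideanSpace.single i 1))‖ₑ ≤ 1 := by
      rw [← ofReal_norm, ENNReal.ofReal_le_one]; exact hM1 i
    rw [hTn] at h1
    have h2 := ENNReal.rpow_le_rpow h1 hs0.le
    rwa [← ENNReal.rpow_mul, one_div_mul_cancel hs0.ne', ENNReal.rpow_one, ENNReal.one_rpow] at h2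
  · rw [← hTn, ← ofReal_norm, ← ofReal_norm, show (n : ℝ≥0∞) = ENNReal.ofReal n by simp,
      ← ENNReal.ofReal_mul (by positivity)]
    exact ENNReal.ofReal_le_ofReal (hM2 v)

end Reducing

end MatrixSquare

end

noncomputable section

namespace MatrixSquare

/-! ### From trees to the whole grid -/

section Global

variable {d : ℕ} {D : Set (Cube d)}

theorem Cube.interior_nonempty (Q : Cube d) : (interior Q.toSet).Nonempty := by
  have h : (Set.univ.pi fun i => Set.Ioo (Q.corner i) (Q.corner i + Q.side)) ⊆ Q.toSet :=
    Set.pi_mono fun i _ => Set.Ioo_subset_Ico_self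
  have ho : IsOpen (Set.univ.pi fun i => Set.Ioo (Q.corner i) (Q.corner i + Q.side)) :=
    isOpen_set_pi Set.finite_univ fun i _ => isOpen_Ioo
  have hs := Q.side_pos
  exact ⟨fun i => Q.corner i + Q.side / 2, interior_maximal h ho fun i _ =>
    ⟨by linarith, by linarith⟩⟩

theorem IsDyadicGrid.countable_generation (hD : IsDyadicGrid D) (k : ℤ) :
    {Q ∈ D | Q.side = (2 : ℝ) ^ k}.Countable := by
  refine Set.PairwiseDisjoint.countable_of_nonempty_interior (s := Cube.toSet) ?_
    fun Q _ => Q.interior_nonempty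
  intro P hP Q hQ hne
  refine Set.disjoint_left.2 fun x hxP hxQ => hne ?_
  exact hD.eq_of_mem hP.1 hQ.1 (hP.2.trans hQ.2.symm) hxP hxQ

theorem IsDyadicGrid.countable (hD : IsDyadicGrid D) : D.Countable := by
  refine (Set.countable_iUnion fun k : ℤ => hD.countable_generation k).mono fun Q hQ => ?_
  obtain ⟨k, hk⟩ := hD.side_eq Q hQ
  exact Set.mem_iUnion.2 ⟨k, hQ, hk⟩

theorem IsDyadicGrid.lintegral_eq_tsum (hD : IsDyadicGrid D) (k : ℤ) (F : (Fin d → ℝ) → ℝ≥0∞) :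
    ∫⁻ x, F x = ∑' Q : {Q ∈ D | Q.side = (2 : ℝ) ^ k}, ∫⁻ x in (Q : Cube d).toSet, F x := by
  have := (hD.countable_generation k).to_subtype
  rw [← lintegral_iUnion (s := fun Q : {Q ∈ D | Q.side = (2 : ℝ) ^ k} => (Q : Cube d).toSet)
    (fun Q => (Q : Cube d).measurableSet)]
  · rw [← setLIntegral_univ]
    congr 2
    symm
    refine Set.eq_univ_of_forall fun x => ?_
    obtain ⟨Q, ⟨hQ, hs, hx⟩, -⟩ := hD.partition k x
    exact Set.mem_iUnion.2 ⟨⟨Q, hQ, hs⟩, hx⟩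
  · intro P Q hne
    refine Set.disjoint_left.2 fun x hxP hxQ => hne (Subtype.ext ?_)
    exact hD.eq_of_mem P.2.1 Q.2.1 (P.2.2.trans Q.2.2.symm) hxP hxQ

theorem IsDyadicGrid.side_le_half (hD : IsDyadicGrid D) {P Q : Cube d} (hP : P ∈ D) (hQ : Q ∈ D)
    (h : P.side < Q.side) : P.side ≤ Q.side / 2 := by
  obtain ⟨k, hk⟩ := hD.side_eq P hP
  obtain ⟨l, hl⟩ := hD.side_eq Q hQ
  rw [hk, hl] at h ⊢
  have hkl : k ≤ l - 1 := by
    have := (zpow_lt_zpow_iff_right₀ (by norm_num : (1 : ℝ) < 2)).1 h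
    omega
  calc (2 : ℝ) ^ k ≤ 2 ^ (l - 1) := zpow_le_zpow_right₀ (by norm_num) hkl
    _ = 2 ^ l / 2 := by rw [zpow_sub₀ (by norm_num)]; norm_num

variable [NeZero d]

open Classical in
-- Grid cubes containing `x` form a chain with one cube per generation, and the descent from `Q`
-- visits all those of the `k` admissible generations.
theorem IsDyadicGrid.sum_indicator_le_pathSum (hD : IsDyadicGrid D)
    (F : Cube d → (Fin d → ℝ) → ℝ≥0∞) (k : ℕ) {Q : Cube d} (hQ : Q ∈ D) {x : Fin d → ℝ}
    (hx : x ∈ Q.toSet) (s : Finset (Cube d)) (hs : ∀ J ∈ s, J ∈ D)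
    (hs1 : ∀ J ∈ s, x ∈ J.toSet → J.side ≤ Q.side)
    (hs2 : ∀ J ∈ s, x ∈ J.toSet → Q.side / 2 ^ k < J.side) :
    ∑ J ∈ s, J.toSet.indicator (F J) x ≤ pathSum k F Q x := by
  induction k generalizing Q s with
  | zero =>
    refine (Finset.sum_eq_zero fun J hJ => Set.indicator_of_notMem (fun hxJ => ?_) _).le
    have h1 := hs1 J hJ hxJ
    have h2 := hs2 J hJ hxJ
    rw [pow_zero, div_one] at h2
    linarith
  | succ k ih =>
    have h1 : ∑ J ∈ s, J.toSet.indicator (F J) x ≤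
        F Q x + ∑ J ∈ s.erase Q, J.toSet.indicator (F J) x := by
      by_cases hQs : Q ∈ s
      · rw [← Finset.add_sum_erase s _ hQs, Set.indicator_of_mem hx]
      · rw [Finset.erase_eq_of_notMem hQs]; exact le_add_self
    refine h1.trans ?_
    rw [pathSum]
    gcongr
    refine ih (hD.child_mem hQ _) (Cube.mem_sub hx) (s.erase Q)
      (fun J hJ => hs J (Finset.mem_of_mem_erase hJ)) (fun J hJ hxJ => ?_) (fun J hJ hxJ => ?_)
    · have hJs := Finset.mem_of_mem_erase hJ
      refine hD.side_le_half (hs J hJs) hQ (lt_of_le_of_ne (hs1 J hJs hxJ) fun he => ?_)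
      exact Finset.ne_of_mem_erase hJ (hD.eq_of_mem (hs J hJs) hQ he hxJ hx)
    · have h2 := hs2 J (Finset.mem_of_mem_erase hJ) hxJ
      rw [pow_succ] at h2
      refine lt_of_eq_of_lt ?_ h2
      simp only [Cube.child]
      field_simp

open Classical in
/-- Bounds for square functions over finite trees add up to bounds over the whole grid. -/
theorem IsDyadicGrid.lintegral_tsum_indicator_rpow_le (hD : IsDyadicGrid D)
    {F : Cube d → (Fin d → ℝ) → ℝ≥0∞} (hF : ∀ Q, AEMeasurable (F Q) volume) {t : ℝ} (ht : 0 < t)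
    {G : (Fin d → ℝ) → ℝ≥0∞} {C : ℝ≥0∞}
    (hC : ∀ k, ∀ L ∈ D, ∫⁻ x in L.toSet, pathSum k F L x ^ t ≤ C * ∫⁻ x in L.toSet, G x) :
    ∫⁻ x, (∑' J : D, (J : Cube d).toSet.indicator (F J) x) ^ t ≤ C * ∫⁻ x, G x := by
  have := hD.countable.to_subtype
  have hfin : ∀ s : Finset D,
      ∫⁻ x, (∑ J ∈ s, (J : Cube d).toSet.indicator (F J) x) ^ t ≤ C * ∫⁻ x, G x := by
    intro s
    choose κ hκ using fun J : D => hD.side_eq J J.2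
    -- Finitely many cubes have sides in `(2 ^ (-N), 2 ^ N]`. They are all met by descents of `2 *
    -- N` generations from the cubes of side `2 ^ N`, which partition the space.
    obtain ⟨N, hN⟩ : ∃ N : ℕ, ∀ J ∈ s, -(N : ℤ) < κ J ∧ κ J ≤ N := by
      refine ⟨∑ J ∈ s, ((κ J).natAbs + 1), fun J hJ => ?_⟩
      have := Finset.single_le_sum (f := fun J => (κ J).natAbs + 1) (fun _ _ => Nat.zero_le _) hJ
      omega
    rw [hD.lintegral_eq_tsum N, hD.lintegral_eq_tsum N G, ← ENNReal.tsum_mul_left]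
    refine ENNReal.tsum_le_tsum fun Q => ?_
    refine le_trans ?_ (hC (2 * N) Q Q.2.1)
    refine setLIntegral_mono' (Q : Cube d).measurableSet fun x hx => ?_
    refine ENNReal.rpow_le_rpow ?_ ht.le
    have h1 := hD.sum_indicator_le_pathSum F (2 * N) Q.2.1 hx (s.map (Function.Embedding.subtype _))
      (fun J hJ => by
        obtain ⟨J', _, rfl⟩ := Finset.mem_map.1 hJ
        exact J'.2)
      (fun J hJ _ => by
        obtain ⟨J', hJ', rfl⟩ := Finset.mem_map.1 hJ
        rw [Function.Embedding.subtype_apply, hκ J', Q.2.2]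
        exact zpow_le_zpow_right₀ (by norm_num) (hN J' hJ').2)
      (fun J hJ _ => by
        obtain ⟨J', hJ', rfl⟩ := Finset.mem_map.1 hJ
        rw [Function.Embedding.subtype_apply, hκ J', Q.2.2, ← zpow_natCast, ← zpow_sub₀ (by norm_num)]
        refine zpow_lt_zpow_right₀ (by norm_num) ?_
        have := (hN J' hJ').1
        push_cast
        omega)
    rwa [Finset.sum_map] at h1
  have hsup : ∀ x, (∑' J : D, (J : Cube d).toSet.indicator (F J) x) ^ t =
      ⨆ s : Finset D, (∑ J ∈ s, (J : Cube d).toSet.indicator (F J) x) ^ t := fun x => by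
    rw [ENNReal.tsum_eq_iSup_sum, ← ENNReal.orderIsoRpow_apply t ht, OrderIso.map_iSup]
    rfl
  simp only [hsup]
  rw [lintegral_iSup_directed]
  · exact iSup_le hfin
  · intro s
    exact (Finset.aemeasurable_fun_sum s fun J _ =>
      (hF J).indicator (J : Cube d).measurableSet).pow_const t
  · refine Monotone.directed_le fun s s' hss x => ?_
    exact ENNReal.rpow_le_rpow (Finset.sum_le_sum_of_subset hss) ht.le

end Global

end MatrixSquare

end

noncomputable section

namespace MatrixSquare

/-! ### Two-weight estimates for operator valued weights -/

section Averages

variable {d n : ℕ}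

theorem Cube.avg_const_mul (Q : Cube d) {c : ℝ≥0∞} (hc : c ≠ ∞) (F : (Fin d → ℝ) → ℝ≥0∞) :
    Q.avg (fun x => c * F x) = c * Q.avg F :=
  lintegral_const_mul' _ _ hc

theorem Cube.avg_mono_ae (Q : Cube d) {F G : (Fin d → ℝ) → ℝ≥0∞} (h : ∀ᵐ x, F x ≤ G x) :
    Q.avg F ≤ Q.avg G := by
  refine lintegral_mono_ae ?_
  exact (Measure.smul_absolutelyContinuous.trans
    Measure.restrict_le_self.absolutelyContinuous).ae_le h

theorem Cube.avg_mono (Q : Cube d) {F G : (Fin d → ℝ) → ℝ≥0∞} (h : ∀ x, F x ≤ G x) :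
    Q.avg F ≤ Q.avg G :=
  Q.avg_mono_ae (Filter.Eventually.of_forall h)

theorem Cube.avg_finset_sum {ι : Type*} (Q : Cube d) (s : Finset ι)
    {F : ι → (Fin d → ℝ) → ℝ≥0∞} (hF : ∀ i ∈ s, AEMeasurable (F i) volume) :
    Q.avg (fun x => ∑ i ∈ s, F i x) = ∑ i ∈ s, Q.avg (F i) :=
  lintegral_finsetSum' s fun i hi => ((hF i hi).restrict).smul_measure _

/-- Comparison with the largest term. Crude, but valid on both sides of `s = 1`. -/
theorem sum_rpow_le_mul_sum_rpow {a : Fin n → ℝ≥0∞} {s : ℝ} (hs : 0 < s) :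
    (∑ i, a i) ^ s ≤ (n : ℝ≥0∞) ^ s * ∑ i, a i ^ s := by
  rcases isEmpty_or_nonempty (Fin n) with h | h
  · simp [hs]
  obtain ⟨j, -, hj⟩ := Finset.exists_max_image Finset.univ a Finset.univ_nonempty
  calc (∑ i, a i) ^ s ≤ ((n : ℝ≥0∞) * a j) ^ s := by
        refine ENNReal.rpow_le_rpow ?_ hs.le
        refine (Finset.sum_le_sum hj).trans ?_
        simp
    _ = (n : ℝ≥0∞) ^ s * a j ^ s := ENNReal.mul_rpow_of_nonneg _ _ hs.le
    _ ≤ _ := by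
        gcongr
        exact Finset.single_le_sum (f := fun i => a i ^ s) (fun _ _ => zero_le) (Finset.mem_univ j)

/-- Operators are controlled by their columns, so operator averages reduce to the scalar averages on
which the hypotheses are stated. -/
theorem enorm_clm_apply_le_sum {F : Type*} [NormedAddCommGroup F] [NormedSpace ℂ F]
    (B : EuclideanSpace ℂ (Fin n) →L[ℂ] F) (v : EuclideanSpace ℂ (Fin n)) :
    ‖B v‖ₑ ≤ (∑ i, ‖B (EuclideanSpace.single i 1)‖ₑ) * ‖v‖ₑ := by
  have h1 : B v = ∑ i, v i • B (EuclideanSpace.single i 1) := by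
    conv_lhs => rw [← (EuclideanSpace.basisFun (Fin n) ℂ).sum_repr v]
    simp [map_sum]
  rw [h1, Finset.sum_mul]
  refine (enorm_sum_le _ _).trans (Finset.sum_le_sum fun i _ => ?_)
  rw [enorm_smul, mul_comm]
  gcongr
  rw [← ofReal_norm, ← ofReal_norm]
  exact ENNReal.ofReal_le_ofReal (PiLp.norm_apply_le v i)

theorem enorm_clm_le_sum (B : EuclideanSpace ℂ (Fin n) →L[ℂ] EuclideanSpace ℂ (Fin n)) :
    ‖B‖ₑ ≤ ∑ i, ‖B (EuclideanSpace.single i 1)‖ₑ := by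
  have h1 : ‖B‖ ≤ ∑ i, ‖B (EuclideanSpace.single i 1)‖ := by
    refine B.opNorm_le_bound (Finset.sum_nonneg fun _ _ => norm_nonneg _) fun v => ?_
    have := ENNReal.toReal_mono (ENNReal.mul_ne_top
      (ENNReal.sum_ne_top.2 fun _ _ => enorm_ne_top) enorm_ne_top) (enorm_clm_apply_le_sum B v)
    rw [ENNReal.toReal_mul, ENNReal.toReal_sum fun _ _ => enorm_ne_top] at this
    simpa using this
  rw [← ofReal_norm]
  simp only [← ofReal_norm]
  rw [← ENNReal.ofReal_sum_of_nonneg fun _ _ => norm_nonneg _]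
  exact ENNReal.ofReal_le_ofReal h1

theorem enorm_clm_apply_le {E F : Type*} [NormedAddCommGroup E] [NormedSpace ℂ E]
    [NormedAddCommGroup F] [NormedSpace ℂ F] (B : E →L[ℂ] F) (v : E) : ‖B v‖ₑ ≤ ‖B‖ₑ * ‖v‖ₑ := by
  rw [← ofReal_norm, ← ofReal_norm, ← ofReal_norm, ← ENNReal.ofReal_mul (norm_nonneg _)]
  exact ENNReal.ofReal_le_ofReal (B.le_opNorm v)

theorem enorm_adjoint (B : EuclideanSpace ℂ (Fin n) →L[ℂ] EuclideanSpace ℂ (Fin n)) :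
    ‖ContinuousLinearMap.adjoint B‖ₑ = ‖B‖ₑ := by
  rw [← ofReal_norm, ← ofReal_norm, LinearIsometryEquiv.norm_map]

theorem enorm_single_one (i : Fin n) : ‖(EuclideanSpace.single i 1 : EuclideanSpace ℂ (Fin n))‖ₑ = 1 := by
  rw [← ofReal_norm]; simp

end Averages

/-- The hypotheses on a pair of weights `U`, `V`, in terms of the operators `RU = U^{1/p}`,
`RV = V^{1/p}` and `RI = V^{-1/p}`: the two-weight `A_p` condition with constant `K`, and the weak
`A_∞` condition for the dual weight with constant `A`. -/
structure IsWeightPair {d n : ℕ} (p : ℝ)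
    (RU RV RI : (Fin d → ℝ) → EuclideanSpace ℂ (Fin n) →L[ℂ] EuclideanSpace ℂ (Fin n))
    (K : ℝ≥0∞) (A : ℝ≥0) : Prop where
  measU : ∀ v, AEStronglyMeasurable (fun x => RU x v) volume
  measI : ∀ v, AEStronglyMeasurable (fun x => RI x v) volume
  adjU : ∀ x, ContinuousLinearMap.adjoint (RU x) = RU x
  adjI : ∀ x, ContinuousLinearMap.adjoint (RI x) = RI x
  injU : ∀ᵐ x, Function.Injective (RU x)
  injI : ∀ᵐ x, Function.Injective (RI x)
  inv : ∀ᵐ x, ∀ v, RI x (RV x v) = v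
  K_ne_top : K ≠ ∞
  ap : ∀ Q : Cube d, Q.avg (fun x => Q.avg (fun y => ‖RI y * RU x‖ₑ ^ dual p) ^ (p / dual p)) ≤ K
  one_le : 1 ≤ A
  ainf : ∀ e ≠ 0, aInftyChar (fun y => ‖RI y e‖ₑ ^ dual p) ≤ A

/-- The constant in the comparison of the `A_p` characteristic with reducing operators. -/
def reducingConst (n : ℕ) (p : ℝ) : ℝ≥0∞ :=
  ((n : ℝ≥0∞) ^ dual p * n) ^ (1 / dual p) * (n * (n * ((n : ℝ≥0∞) ^ p * (n * n ^ p)) ^ (1 / p)))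

theorem reducingConst_ne_top (n : ℕ) {p : ℝ} (hp : 1 < p) : reducingConst n p ≠ ∞ := by
  have h1 : 0 ≤ dual p := (Real.HolderConjugate.conjExponent hp).symm.nonneg
  have h2 : 0 ≤ 1 / dual p := by positivity
  have h3 : 0 ≤ 1 / p := by positivity
  rw [reducingConst]
  have := ENNReal.natCast_ne_top n
  finiteness

/-! ### Reducing operators for a pair of weights -/

namespace IsWeightPair

variable {d n : ℕ} {p : ℝ} {K : ℝ≥0∞} {A : ℝ≥0}
  {RU RV RI : (Fin d → ℝ) → EuclideanSpace ℂ (Fin n) →L[ℂ] EuclideanSpace ℂ (Fin n)}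

theorem lintegral_dual_ne_top (h : IsWeightPair p RU RV RI K A) (hp : 1 < p) (Q : Cube d)
    (v : EuclideanSpace ℂ (Fin n)) : ∫⁻ x in Q.toSet, ‖RI x v‖ₑ ^ dual p ≠ ∞ := by
  have hp' : 0 < dual p := (Real.HolderConjugate.conjExponent hp).symm.pos
  rcases eq_or_ne v 0 with rfl | hv
  · simp [ENNReal.zero_rpow_of_pos hp']
  · exact (aInftyChar_le_iff (h.ainf v hv) Q).1

/-- `N` reduces `V^{-1/p}` in `L^{p'}`. Thus `|N⁻¹ U^{1/p}(x) v|` is bounded by the inner average in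
the `A_p` characteristic, and averaging over `x` brings in `K`. -/
theorem exists_reducing_dual (h : IsWeightPair p RU RV RI K A) (hp : 1 < p) (Q : Cube d) :
    ∃ N : EuclideanSpace ℂ (Fin n) ≃L[ℂ] EuclideanSpace ℂ (Fin n),
      (∀ i, Q.avg (fun x => ‖RI x (N (EuclideanSpace.single i 1))‖ₑ ^ dual p) ≤ 1) ∧
      ∀ v, Q.avg (fun x => ‖N.symm (RU x v)‖ₑ ^ p) ≤ (n * ‖v‖ₑ) ^ p * K := by
  have hp0 : 0 < p := by linarith
  have hp' := (Real.HolderConjugate.conjExponent hp).symm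
  obtain ⟨N, hN1, hN2⟩ := exists_reducing h.measI h.injI hp'.lt.le Q
    (h.lintegral_dual_ne_top hp Q)
  refine ⟨N, hN1, fun v => ?_⟩
  have hd : 0 ≤ 1 / dual p := by have := hp'.pos; positivity
  have key : ∀ x, ‖N.symm (RU x v)‖ₑ ^ p ≤
      (n * ‖v‖ₑ) ^ p * Q.avg (fun y => ‖RI y * RU x‖ₑ ^ dual p) ^ (p / dual p) := fun x => by
    have h1 : Q.avg (fun y => ‖RI y (RU x v)‖ₑ ^ dual p) ≤
        ‖v‖ₑ ^ dual p * Q.avg (fun y => ‖RI y * RU x‖ₑ ^ dual p) := by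
      rw [← Cube.avg_const_mul _ (ENNReal.rpow_ne_top_of_nonneg hp'.nonneg (by finiteness))]
      refine Q.avg_mono fun y => ?_
      rw [← ENNReal.mul_rpow_of_nonneg _ _ hp'.nonneg, mul_comm]
      exact ENNReal.rpow_le_rpow (enorm_clm_apply_le (RI y * RU x) v) hp'.nonneg
    calc ‖N.symm (RU x v)‖ₑ ^ p
        ≤ (n * (‖v‖ₑ ^ dual p * Q.avg (fun y => ‖RI y * RU x‖ₑ ^ dual p)) ^ (1 / dual p)) ^ p := by
          refine ENNReal.rpow_le_rpow ((hN2 _).trans ?_) hp0.le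
          gcongr
      _ = _ := by
          rw [ENNReal.mul_rpow_of_nonneg _ _ hd, ← ENNReal.rpow_mul,
            mul_one_div_cancel hp'.ne_zero, ENNReal.rpow_one, ← mul_assoc,
            ENNReal.mul_rpow_of_nonneg _ _ hp0.le, ← ENNReal.rpow_mul]
          congr 2
          ring
  refine (Q.avg_mono key).trans ?_
  rw [Cube.avg_const_mul _ (ENNReal.rpow_ne_top_of_nonneg hp0.le (by finiteness))]
  gcongr
  exact h.ap Q

/-- Local integrability of `|U^{1/p} v|^p` is not among the hypotheses; it follows from the
two-weight condition because `N` is invertible. -/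
theorem lintegral_ne_top (h : IsWeightPair p RU RV RI K A) (hp : 1 < p) (Q : Cube d)
    (v : EuclideanSpace ℂ (Fin n)) : ∫⁻ x in Q.toSet, ‖RU x v‖ₑ ^ p ≠ ∞ := by
  have hp0 : 0 < p := by linarith
  obtain ⟨N, -, hN⟩ := h.exists_reducing_dual hp Q
  have h1 : ∀ x, ‖RU x v‖ₑ ^ p ≤ ‖(N : EuclideanSpace ℂ (Fin n) →L[ℂ] EuclideanSpace ℂ (Fin n))‖ₑ ^ p *
      ‖N.symm (RU x v)‖ₑ ^ p := fun x => by
    rw [← ENNReal.mul_rpow_of_nonneg _ _ hp0.le]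
    refine ENNReal.rpow_le_rpow ?_ hp0.le
    have := enorm_clm_apply_le (N : EuclideanSpace ℂ (Fin n) →L[ℂ] EuclideanSpace ℂ (Fin n))
      (N.symm (RU x v))
    simpa using this
  have h2 := (Q.avg_mono h1).trans_eq (Cube.avg_const_mul _
    (ENNReal.rpow_ne_top_of_nonneg hp0.le (by finiteness)) _)
  rw [← Q.avg_mul_volume]
  have hK := h.K_ne_top
  have hv := Q.volume_ne_top
  have h3 : Q.avg (fun x => ‖RU x v‖ₑ ^ p) ≠ ∞ := by
    refine (h2.trans_lt ?_).ne
    refine ENNReal.mul_lt_top (by finiteness) ((hN v).trans_lt ?_)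
    have := ENNReal.natCast_ne_top n
    finiteness
  finiteness

/-- `M` reduces `U^{1/p}` in `L^p` and `N` reduces `V^{-1/p}` in `L^{p'}`; in terms of them the
`A_p` condition says that `N⁻¹ M^{-*}` has norm of order at most `K^{1/p}`. Passing to adjoints
allows the defining property of `M` to be tested on the vectors `N^{-*} e_j`. -/
theorem exists_reducing_pair (h : IsWeightPair p RU RV RI K A) (hp : 1 < p) (Q : Cube d) :
    ∃ M : EuclideanSpace ℂ (Fin n) ≃L[ℂ] EuclideanSpace ℂ (Fin n),
      (∀ i, Q.avg (fun x => ‖RU x (M (EuclideanSpace.single i 1))‖ₑ ^ p) ≤ 1) ∧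
      ∀ i, Q.avg (fun x => ‖RI x (ContinuousLinearMap.adjoint
        (M.symm : EuclideanSpace ℂ (Fin n) →L[ℂ] EuclideanSpace ℂ (Fin n))
          (EuclideanSpace.single i 1))‖ₑ ^ dual p) ^ (1 / dual p) ≤
        reducingConst n p * K ^ (1 / p) := by
  have hp0 : 0 < p := by linarith
  have hp' := (Real.HolderConjugate.conjExponent hp).symm
  have hd : 0 ≤ 1 / dual p := by have := hp'.pos; positivity
  obtain ⟨N, hN1, hN2⟩ := h.exists_reducing_dual hp Q
  obtain ⟨M, hM1, hM2⟩ := exists_reducing h.measU h.injU hp.le Q (h.lintegral_ne_top hp Q)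
  refine ⟨M, hM1, fun i => ?_⟩
  set T : EuclideanSpace ℂ (Fin n) →L[ℂ] EuclideanSpace ℂ (Fin n) :=
    (M.symm : EuclideanSpace ℂ (Fin n) →L[ℂ] EuclideanSpace ℂ (Fin n)) with hT
  set S : EuclideanSpace ℂ (Fin n) →L[ℂ] EuclideanSpace ℂ (Fin n) :=
    (N.symm : EuclideanSpace ℂ (Fin n) →L[ℂ] EuclideanSpace ℂ (Fin n)) with hS
  -- the composition of the two reducing operators
  have hST : ‖S * ContinuousLinearMap.adjoint T‖ₑ ≤
      n * (n * ((n : ℝ≥0∞) ^ p * (n * n ^ p)) ^ (1 / p)) * K ^ (1 / p) := by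
    have h1 : ∀ v : EuclideanSpace ℂ (Fin n), ‖v‖ₑ ≤ 1 →
        Q.avg (fun x => ‖RU x (ContinuousLinearMap.adjoint S v)‖ₑ ^ p) ≤
          (n : ℝ≥0∞) ^ p * (n * n ^ p) * K := by
      intro v hv
      have h2 : ∀ x, ‖RU x (ContinuousLinearMap.adjoint S v)‖ₑ ^ p ≤
          (n : ℝ≥0∞) ^ p * ∑ j, ‖S (RU x (EuclideanSpace.single j 1))‖ₑ ^ p := fun x => by
        refine le_trans ?_ (sum_rpow_le_mul_sum_rpow hp0)
        refine ENNReal.rpow_le_rpow ?_ hp0.le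
        calc ‖RU x (ContinuousLinearMap.adjoint S v)‖ₑ
            = ‖(ContinuousLinearMap.adjoint (S * RU x)) v‖ₑ := by
              have h3 : ContinuousLinearMap.adjoint (S * RU x) =
                  RU x * ContinuousLinearMap.adjoint S := by
                rw [← ContinuousLinearMap.star_eq_adjoint, star_mul,
                  ContinuousLinearMap.star_eq_adjoint, ContinuousLinearMap.star_eq_adjoint, h.adjU]
              rw [h3]
              rfl
          _ ≤ ‖ContinuousLinearMap.adjoint (S * RU x)‖ₑ * ‖v‖ₑ := enorm_clm_apply_le _ _
          _ ≤ ‖S * RU x‖ₑ := by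
              rw [enorm_adjoint]
              exact mul_le_of_le_one_right zero_le hv
          _ ≤ _ := enorm_clm_le_sum _
      refine (Q.avg_mono h2).trans ?_
      rw [Cube.avg_const_mul _ (ENNReal.rpow_ne_top_of_nonneg hp0.le (ENNReal.natCast_ne_top n)),
        Cube.avg_finset_sum, mul_assoc]
      · gcongr
        calc _ ≤ ∑ j : Fin n, (n : ℝ≥0∞) ^ p * K := by
              refine Finset.sum_le_sum fun j _ => (hN2 _).trans ?_
              rw [enorm_single_one, mul_one]
          _ = _ := by
              simp only [Finset.sum_const, Finset.card_univ, Fintype.card_fin, nsmul_eq_mul]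
              ring
      · intro j _
        exact ((S.continuous.comp_aestronglyMeasurable (h.measU _)).enorm).pow_const _
    calc ‖S * ContinuousLinearMap.adjoint T‖ₑ = ‖T * ContinuousLinearMap.adjoint S‖ₑ := by
          rw [← enorm_adjoint, ← ContinuousLinearMap.star_eq_adjoint, star_mul,
            ContinuousLinearMap.star_eq_adjoint, ContinuousLinearMap.star_eq_adjoint,
            ContinuousLinearMap.adjoint_adjoint]
      _ ≤ ∑ j, ‖T (ContinuousLinearMap.adjoint S (EuclideanSpace.single j 1))‖ₑ :=
          enorm_clm_le_sum _
      _ ≤ ∑ j : Fin n, n * ((n : ℝ≥0∞) ^ p * (n * n ^ p) * K) ^ (1 / p) := by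
          refine Finset.sum_le_sum fun j _ => (hM2 _).trans ?_
          gcongr
          exact h1 _ (enorm_single_one j).le
      _ = _ := by
          rw [ENNReal.mul_rpow_of_nonneg _ _ (by positivity)]
          simp only [Finset.sum_const, Finset.card_univ, Fintype.card_fin, nsmul_eq_mul]
          ring
  -- Insert `N N⁻¹` between `V^{-1/p}` and `M^{-*}`; the averages of the columns of `V^{-1/p} N` are
  -- at most `1`.
  have h3 : ∀ x, ‖RI x (ContinuousLinearMap.adjoint T (EuclideanSpace.single i 1))‖ₑ ^ dual p ≤
      ‖S * ContinuousLinearMap.adjoint T‖ₑ ^ dual p * ((n : ℝ≥0∞) ^ dual p *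
        ∑ j, ‖RI x (N (EuclideanSpace.single j 1))‖ₑ ^ dual p) := fun x => by
    refine le_trans ?_ (mul_le_mul_right (sum_rpow_le_mul_sum_rpow hp'.pos) _)
    rw [← ENNReal.mul_rpow_of_nonneg _ _ hp'.nonneg]
    refine ENNReal.rpow_le_rpow ?_ hp'.nonneg
    set v := ContinuousLinearMap.adjoint T (EuclideanSpace.single i 1) with hv
    have hv1 : RI x v = (RI x ∘L (N : EuclideanSpace ℂ (Fin n) →L[ℂ] EuclideanSpace ℂ (Fin n)))
        (S v) := by simp [hS]
    have hv2 : ‖S v‖ₑ ≤ ‖S * ContinuousLinearMap.adjoint T‖ₑ := by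
      have := enorm_clm_apply_le (S * ContinuousLinearMap.adjoint T) (EuclideanSpace.single i 1)
      rwa [enorm_single_one, mul_one] at this
    rw [hv1, mul_comm]
    refine (enorm_clm_apply_le_sum _ _).trans ?_
    exact mul_le_mul_right hv2 _
  have h4 : Q.avg (fun x => ‖RI x (ContinuousLinearMap.adjoint T
      (EuclideanSpace.single i 1))‖ₑ ^ dual p) ≤
      ‖S * ContinuousLinearMap.adjoint T‖ₑ ^ dual p * ((n : ℝ≥0∞) ^ dual p * n) := by
    refine (Q.avg_mono h3).trans ?_
    rw [Cube.avg_const_mul _ (ENNReal.rpow_ne_top_of_nonneg hp'.nonneg (by finiteness)),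
      Cube.avg_const_mul _ (ENNReal.rpow_ne_top_of_nonneg hp'.nonneg (ENNReal.natCast_ne_top n)),
      Cube.avg_finset_sum]
    · gcongr
      calc _ ≤ ∑ j : Fin n, (1 : ℝ≥0∞) := Finset.sum_le_sum fun j _ => hN1 j
        _ = _ := by simp
    · exact fun j _ => (h.measI _).enorm.pow_const _
  calc _ ≤ (‖S * ContinuousLinearMap.adjoint T‖ₑ ^ dual p *
        ((n : ℝ≥0∞) ^ dual p * n)) ^ (1 / dual p) := ENNReal.rpow_le_rpow h4 hd
    _ = ‖S * ContinuousLinearMap.adjoint T‖ₑ * ((n : ℝ≥0∞) ^ dual p * n) ^ (1 / dual p) := by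
        rw [ENNReal.mul_rpow_of_nonneg _ _ hd, ← ENNReal.rpow_mul, mul_one_div_cancel hp'.ne_zero,
          ENNReal.rpow_one]
    _ ≤ n * (n * ((n : ℝ≥0∞) ^ p * (n * n ^ p)) ^ (1 / p)) * K ^ (1 / p) *
        ((n : ℝ≥0∞) ^ dual p * n) ^ (1 / dual p) := by gcongr
    _ = _ := by rw [reducingConst]; ring

/-- Averages of `|M⁻¹ f|` in terms of averages of `|V^{1/p} f|`. -/
theorem avg_reducing_le (h : IsWeightPair p RU RV RI K A) (hp : 1 < p) {r : ℝ}
    (hr : ∀ w : (Fin d → ℝ) → ℝ≥0∞, AEMeasurable w volume → aInftyChar w ≤ A →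
        ∀ g : (Fin d → ℝ) → ℝ≥0∞, AEMeasurable g volume → ∀ Q : Cube d,
          Q.avg (fun x => w x ^ (1 - 1 / p) * g x) ≤
            2 * Q.avg w ^ (1 - 1 / p) * Q.avg (fun x => g x ^ r) ^ (1 / r))
    {f : (Fin d → ℝ) → EuclideanSpace ℂ (Fin n)}
    (hg : AEMeasurable (fun x => ‖RV x (f x)‖ₑ) volume)
    {Q : Cube d} {M : EuclideanSpace ℂ (Fin n) ≃L[ℂ] EuclideanSpace ℂ (Fin n)}
    (hM : ∀ i, Q.avg (fun x => ‖RI x (ContinuousLinearMap.adjoint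
        (M.symm : EuclideanSpace ℂ (Fin n) →L[ℂ] EuclideanSpace ℂ (Fin n))
          (EuclideanSpace.single i 1))‖ₑ ^ dual p) ^ (1 / dual p) ≤
        reducingConst n p * K ^ (1 / p)) :
    Q.avg (fun x => ‖M.symm (f x)‖ₑ) ≤
      n * (2 * (reducingConst n p * K ^ (1 / p))) *
        Q.avg (fun x => ‖RV x (f x)‖ₑ ^ r) ^ (1 / r) := by
  have hp0 : 0 < p := by linarith
  have hp' := (Real.HolderConjugate.conjExponent hp).symm
  have hdual : 1 / dual p = 1 - 1 / p := by
    have := hp'.symm.one_div_add_one_div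
    have h1 : (1 : ℝ) / 1 = 1 := one_div_one
    linarith
  set T : EuclideanSpace ℂ (Fin n) →L[ℂ] EuclideanSpace ℂ (Fin n) :=
    (M.symm : EuclideanSpace ℂ (Fin n) →L[ℂ] EuclideanSpace ℂ (Fin n)) with hT
  -- Taking the adjoint of `M⁻¹ V^{-1/p}(x)` makes `V^{-1/p}(x)` act on fixed vectors, which
  -- produces scalar weights raised to the power `1 / p'`.
  have h1 : ∀ᵐ x, ‖M.symm (f x)‖ₑ ≤ ∑ i,
      (‖RI x (ContinuousLinearMap.adjoint T (EuclideanSpace.single i 1))‖ₑ ^ dual p) ^ (1 - 1 / p) *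
        ‖RV x (f x)‖ₑ := by
    filter_upwards [h.inv] with x hx
    have h2 : M.symm (f x) = (T * RI x) (RV x (f x)) := by
      show M.symm (f x) = T (RI x (RV x (f x)))
      rw [hx]; rfl
    rw [h2, ← Finset.sum_mul]
    refine (enorm_clm_apply_le _ _).trans ?_
    gcongr
    rw [← enorm_adjoint, ← ContinuousLinearMap.star_eq_adjoint, star_mul,
      ContinuousLinearMap.star_eq_adjoint, ContinuousLinearMap.star_eq_adjoint, h.adjI]
    refine (enorm_clm_le_sum _).trans (le_of_eq (Finset.sum_congr rfl fun i _ => ?_))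
    rw [← hdual, ← ENNReal.rpow_mul, mul_one_div_cancel hp'.ne_zero, ENNReal.rpow_one]
    rfl
  refine (Q.avg_mono_ae h1).trans ?_
  have hm : ∀ v, AEMeasurable (fun x => ‖RI x v‖ₑ ^ dual p) volume := fun v =>
    (h.measI v).enorm.pow_const _
  rw [Cube.avg_finset_sum (F := fun i x =>
    (‖RI x (ContinuousLinearMap.adjoint T (EuclideanSpace.single i 1))‖ₑ ^ dual p) ^ (1 - 1 / p) *
      ‖RV x (f x)‖ₑ) _ _ fun i _ => ((hm _).pow_const _).mul hg]
  calc _ ≤ ∑ i : Fin n, 2 * (reducingConst n p * K ^ (1 / p)) *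
        Q.avg (fun x => ‖RV x (f x)‖ₑ ^ r) ^ (1 / r) := by
        refine Finset.sum_le_sum fun i _ => ?_
        -- The weak `A_∞` hypothesis concerns nonzero vectors only; `M^{-*} e_i` pairs to `1` with
        -- `M e_i`.
        have hne : ContinuousLinearMap.adjoint T (EuclideanSpace.single i 1) ≠ 0 := by
          intro h0
          have h5 : inner ℂ (ContinuousLinearMap.adjoint T (EuclideanSpace.single i 1))
              (M (EuclideanSpace.single i 1)) = (1 : ℂ) := by
            rw [ContinuousLinearMap.adjoint_inner_left]
            have : T (M (EuclideanSpace.single i 1)) = EuclideanSpace.single i 1 := by simp [hT]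
            rw [this]
            simp
          rw [h0, inner_zero_left] at h5
          exact zero_ne_one h5
        refine (hr _ (hm _) (h.ainf _ hne) _ hg Q).trans ?_
        gcongr
        rw [← hdual]
        exact hM i
    _ = _ := by
        simp only [Finset.sum_const, Finset.card_univ, Fintype.card_fin, nsmul_eq_mul]
        ring

/-- Hölder's inequality for `f = V^{-1/p} (V^{1/p} f)`: the columns of the first factor are locally
in `L^{p'}`, the second factor is in `L^p` over `Q`. It makes the Haar coefficients meaningful. -/
theorem integrableOn (h : IsWeightPair p RU RV RI K A) (hp : 1 < p)
    {f : (Fin d → ℝ) → EuclideanSpace ℂ (Fin n)} (hf : AEStronglyMeasurable f volume)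
    (hg : AEMeasurable (fun x => ‖RV x (f x)‖ₑ) volume)
    {Q : Cube d} (hfin : ∫⁻ x in Q.toSet, ‖RV x (f x)‖ₑ ^ p ≠ ∞) : IntegrableOn f Q.toSet := by
  have hp0 : 0 < p := by linarith
  have hp' := (Real.HolderConjugate.conjExponent hp).symm
  refine ⟨hf.restrict, ?_⟩
  have h1 : ∀ᵐ x ∂volume.restrict Q.toSet, ‖f x‖ₑ ≤
      ∑ i, ‖RI x (EuclideanSpace.single i 1)‖ₑ * ‖RV x (f x)‖ₑ := by
    filter_upwards [ae_restrict_of_ae h.inv] with x hx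
    conv_lhs => rw [← hx (f x)]
    rw [← Finset.sum_mul]
    exact enorm_clm_apply_le_sum _ _
  refine (lintegral_mono_ae h1).trans_lt ?_
  rw [lintegral_finsetSum' (f := fun i x => ‖RI x (EuclideanSpace.single i 1)‖ₑ * ‖RV x (f x)‖ₑ) _
    fun i _ => ((h.measI _).enorm.mul hg).restrict, ENNReal.sum_lt_top]
  intro i _
  refine (ENNReal.lintegral_mul_le_Lp_mul_Lq _ hp' (h.measI _).enorm.restrict hg.restrict).trans_lt ?_
  have h2 := h.lintegral_dual_ne_top hp Q (EuclideanSpace.single i 1)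
  have h3 : 0 ≤ 1 / dual p := by have := hp'.pos; positivity
  have h4 : 0 ≤ 1 / p := by positivity
  finiteness

end IsWeightPair

end MatrixSquare

end

noncomputable section

namespace MatrixSquare

/-! ### Weighted estimates for the square function over finite trees -/

section

variable {d n : ℕ}

theorem pathSup_mul_le (k : ℕ) (a b : Cube d → ℝ≥0∞) (L : Cube d) (x : Fin d → ℝ) :
    pathSup k (fun Q => a Q * b Q) L x ≤ pathSup k a L x * pathSup k b L x := by
  induction k generalizing L with
  | zero => exact le_rfl
  | succ k ih =>
    simp only [pathSup]
    exact sup_le (mul_le_mul' le_sup_left le_sup_left)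
      ((ih _).trans (mul_le_mul' le_sup_right le_sup_right))

theorem pathSum_const_le (k : ℕ) {G : Cube d → ℝ≥0∞} (hG : ∀ Q, G Q ≠ ∞) (L : Cube d) :
    ∃ B : ℝ≥0∞, B ≠ ∞ ∧ ∀ x ∈ L.toSet, pathSum k (fun Q _ => G Q) L x ≤ B := by
  induction k generalizing L with
  | zero => exact ⟨0, by simp, fun x _ => le_rfl⟩
  | succ k ih =>
    choose B hB hB' using fun ε : Fin d → Bool => ih (L.child ε)
    refine ⟨G L + ∑ ε, B ε, ENNReal.add_ne_top.2 ⟨hG L, ENNReal.sum_ne_top.2 fun ε _ => hB ε⟩, ?_⟩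
    intro x hx
    refine add_le_add_right ?_ _
    exact (hB' _ x (Cube.mem_sub hx)).trans
      (Finset.single_le_sum (f := B) (fun _ _ => zero_le) (Finset.mem_univ _))

theorem pathSum_le_mul (k : ℕ) {F : Cube d → (Fin d → ℝ) → ℝ≥0∞} {G : Cube d → ℝ≥0∞}
    {x : Fin d → ℝ} {c : ℝ≥0∞} (h : ∀ Q, F Q x ≤ c * G Q) (L : Cube d) :
    pathSum k F L x ≤ c * pathSum k (fun Q _ => G Q) L x := by
  induction k generalizing L with
  | zero => exact zero_le
  | succ k ih =>
    simp only [pathSum, mul_add]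
    exact add_le_add (h L) (ih _)

theorem haarSq_ne_top (h : Cube d → Fin (2 ^ d - 1) → (Fin d → ℝ) → ℂ)
    (f : (Fin d → ℝ) → EuclideanSpace ℂ (Fin n)) (Q : Cube d) : haarSq h f Q ≠ ∞ :=
  ENNReal.div_ne_top (ENNReal.sum_ne_top.2 fun _ _ => by finiteness) Q.volume_ne_zero

theorem weightedHaarSq_le_mul_haarSq (h : Cube d → Fin (2 ^ d - 1) → (Fin d → ℝ) → ℂ)
    (U : (Fin d → ℝ) → EuclideanSpace ℂ (Fin n) →L[ℂ] EuclideanSpace ℂ (Fin n))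
    (f : (Fin d → ℝ) → EuclideanSpace ℂ (Fin n)) (Q : Cube d) (x : Fin d → ℝ) :
    weightedHaarSq h U f Q x ≤
      (∑ i, ‖U x (EuclideanSpace.single i 1)‖ₑ) ^ 2 * haarSq h f Q := by
  rw [weightedHaarSq, haarSq, ← mul_div_assoc, Finset.mul_sum]
  gcongr with κ
  rw [← mul_pow]
  gcongr
  exact enorm_clm_apply_le_sum _ _

end

namespace IsWeightPair

variable {d n : ℕ} {p : ℝ} {K : ℝ≥0∞} {A : ℝ≥0}
  {RU RV RI : (Fin d → ℝ) → EuclideanSpace ℂ (Fin n) →L[ℂ] EuclideanSpace ℂ (Fin n)}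

theorem aemeasurable_sum (hU : ∀ v, AEStronglyMeasurable (fun x => RU x v) volume)
    (v : Fin n → EuclideanSpace ℂ (Fin n)) : AEMeasurable (fun x => ∑ i, ‖RU x (v i)‖ₑ) volume :=
  Finset.aemeasurable_fun_sum _ fun i _ => (hU (v i)).enorm

theorem aemeasurable_weightedHaarSq (hU : ∀ v, AEStronglyMeasurable (fun x => RU x v) volume)
    (h : Cube d → Fin (2 ^ d - 1) → (Fin d → ℝ) → ℂ)
    (f : (Fin d → ℝ) → EuclideanSpace ℂ (Fin n)) (Q : Cube d) :
    AEMeasurable (weightedHaarSq h RU f Q) volume :=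
  (Finset.aemeasurable_fun_sum _ fun _ _ => (hU _).enorm.pow_const _).div_const _

theorem enorm_apply_le_reducing (B : EuclideanSpace ℂ (Fin n) →L[ℂ] EuclideanSpace ℂ (Fin n))
    (M : EuclideanSpace ℂ (Fin n) ≃L[ℂ] EuclideanSpace ℂ (Fin n)) (v : EuclideanSpace ℂ (Fin n)) :
    ‖B v‖ₑ ≤ (∑ i, ‖B (M (EuclideanSpace.single i 1))‖ₑ) * ‖M.symm v‖ₑ := by
  have := enorm_clm_apply_le_sum
    (B ∘L (M : EuclideanSpace ℂ (Fin n) →L[ℂ] EuclideanSpace ℂ (Fin n))) (M.symm v)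
  simpa using this

theorem avg_sum_rpow_le (hU : ∀ v, AEStronglyMeasurable (fun x => RU x v) volume) {s : ℝ}
    (hs : 0 < s) {Q : Cube d} {v : Fin n → EuclideanSpace ℂ (Fin n)}
    (hv : ∀ i, Q.avg (fun x => ‖RU x (v i)‖ₑ ^ s) ≤ 1) :
    Q.avg (fun x => (∑ i, ‖RU x (v i)‖ₑ) ^ s) ≤ (n : ℝ≥0∞) ^ s * n := by
  refine (Q.avg_mono fun x => sum_rpow_le_mul_sum_rpow hs).trans ?_
  rw [Cube.avg_const_mul _ (ENNReal.rpow_ne_top_of_nonneg hs.le (ENNReal.natCast_ne_top n)),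
    Cube.avg_finset_sum _ _ fun i _ => (hU _).enorm.pow_const _]
  gcongr
  calc _ ≤ ∑ j : Fin n, (1 : ℝ≥0∞) := Finset.sum_le_sum fun j _ => hv j
    _ = _ := by simp

/-- The sparse bound with `t = p / 2 ≤ 1` and `φ = 1`. The factor from `U` is a bounded average, so
no `A_∞` condition on `U` enters; the factor from `f` is a maximal function of order `r`. -/
theorem lintegral_pathSum_le_of_le_two (d n : ℕ) [NeZero d] {p : ℝ} (hp : 1 < p) (hp2 : p ≤ 2) :
    ∃ C : ℝ≥0, ∀ (K : ℝ≥0∞) (A : ℝ≥0)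
      (RU RV RI : (Fin d → ℝ) → EuclideanSpace ℂ (Fin n) →L[ℂ] EuclideanSpace ℂ (Fin n)),
      IsWeightPair p RU RV RI K A → ∀ (D : Set (Cube d)), IsDyadicGrid D →
      ∀ h : Cube d → Fin (2 ^ d - 1) → (Fin d → ℝ) → ℂ, IsHaarSystem D h →
      ∀ f : (Fin d → ℝ) → EuclideanSpace ℂ (Fin n), AEStronglyMeasurable f volume →
      AEMeasurable (fun x => ‖RV x (f x)‖ₑ) volume → ∀ k, ∀ L ∈ D,
      ∫⁻ x in L.toSet, ‖RV x (f x)‖ₑ ^ p ≠ ∞ →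
      ∫⁻ x in L.toSet, pathSum k (weightedHaarSq h RU f) L x ^ (p / 2) ≤
        C * (K * A) * ∫⁻ x in L.toSet, ‖RV x (f x)‖ₑ ^ p := by
  have hp0 : 0 < p := by linarith
  obtain ⟨C₀, hC₀⟩ := exists_exponent d hp
  set c : ℝ≥0∞ := (n * (2 * reducingConst n p)) ^ p * ((n : ℝ≥0∞) ^ p * n) with hc
  have hn := ENNReal.natCast_ne_top n
  have hred := reducingConst_ne_top n hp
  have hctop : c ≠ ∞ := by finiteness
  have hctop' : 2 * (2 ^ (d + 4)) ^ (p / 2) * (c * C₀) ≠ ∞ := by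
    have : 0 ≤ p / 2 := by positivity
    finiteness
  refine ⟨(2 * (2 ^ (d + 4)) ^ (p / 2) * (c * C₀)).toNNReal, ?_⟩
  intro K A RU RV RI hw D hD h hh f hf hg k L hL hfin
  obtain ⟨r, hr1, hrp, hRH, hDoob⟩ := hC₀ A hw.one_le
  have hr0 : 0 < r := by linarith
  choose M hM1 hM2 using hw.exists_reducing_pair hp
  have hsum := hh.lintegral_pathSum_le hD (U := RU) (f := f)
    (T := fun Q => ((M Q).symm : EuclideanSpace ℂ (Fin n) →L[ℂ] EuclideanSpace ℂ (Fin n)))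
    (u := fun Q x => ∑ i, ‖RU x (M Q (EuclideanSpace.single i 1))‖ₑ)
    (fun Q => aemeasurable_sum hw.measU _)
    (fun Q x v => enorm_apply_le_reducing (RU x) (M Q) v)
    (φ := fun _ => 1) aemeasurable_const (t := p / 2) (by linarith) (by linarith) k hL
    (hw.integrableOn hp hf hg hfin)
  simp only [mul_one, show 2 * (p / 2) = p by ring] at hsum
  rw [ENNReal.coe_toNNReal hctop']
  refine hsum.trans ?_
  have hb : ∀ Q : Cube d, (Q.avg fun x => ‖(M Q).symm (f x)‖ₑ) ^ p *
      Q.avg (fun x => (∑ i, ‖RU x (M Q (EuclideanSpace.single i 1))‖ₑ) ^ p) ≤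
      c * K * Q.avg (fun x => ‖RV x (f x)‖ₑ ^ r) ^ (p / r) := fun Q => by
    calc _ ≤ (n * (2 * (reducingConst n p * K ^ (1 / p))) *
          Q.avg (fun x => ‖RV x (f x)‖ₑ ^ r) ^ (1 / r)) ^ p * ((n : ℝ≥0∞) ^ p * n) :=
          mul_le_mul' (ENNReal.rpow_le_rpow (hw.avg_reducing_le hp hRH hg (hM2 Q)) hp0.le)
            (avg_sum_rpow_le hw.measU hp0 (hM1 Q))
      _ = _ := by
          rw [show n * (2 * (reducingConst n p * K ^ (1 / p))) =
            n * (2 * reducingConst n p) * K ^ (1 / p) by ring,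
            ENNReal.mul_rpow_of_nonneg _ _ hp0.le, ENNReal.mul_rpow_of_nonneg _ _ hp0.le,
            ← ENNReal.rpow_mul, ← ENNReal.rpow_mul, one_div_mul_cancel hp0.ne', ENNReal.rpow_one,
            hc, one_div_mul_eq_div]
          ring
  have hcK : c * K ≠ ∞ := ENNReal.mul_ne_top hctop hw.K_ne_top
  have hmono : Monotone fun y : ℝ≥0∞ => c * K * y ^ (p / r) := fun y z hyz => by
    dsimp only
    gcongr
  calc _ ≤ 2 * (2 ^ (d + 4)) ^ (p / 2) * ∫⁻ x in L.toSet,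
        c * K * pathSup k (fun Q => Q.avg fun x => ‖RV x (f x)‖ₑ ^ r) L x ^ (p / r) := by
        refine mul_le_mul_right (setLIntegral_mono' L.measurableSet fun x hx => ?_) _
        rw [← pathSup_comp k hmono]
        exact pathSup_mono k L hx fun Q _ _ => hb Q
    _ ≤ 2 * (2 ^ (d + 4)) ^ (p / 2) *
        (c * K * (C₀ * A * ∫⁻ x in L.toSet, ‖RV x (f x)‖ₑ ^ p)) := by
        rw [lintegral_const_mul' _ _ hcK]
        gcongr
        exact hDoob _ hg k L
    _ = _ := by ring

/-- A truncated square function is at most a constant times the size of `U^{1/p}(x)`, whose `p`-th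
power is locally integrable. Needed for the absorption when `p > 2`. -/
theorem lintegral_pathSum_rpow_ne_top (hw : IsWeightPair p RU RV RI K A) (hp : 1 < p)
    (h : Cube d → Fin (2 ^ d - 1) → (Fin d → ℝ) → ℂ)
    (f : (Fin d → ℝ) → EuclideanSpace ℂ (Fin n)) (k : ℕ) (L : Cube d) :
    ∫⁻ x in L.toSet, pathSum k (weightedHaarSq h RU f) L x ^ (p / 2) ≠ ∞ := by
  have hp0 : 0 < p := by linarith
  have hp2 : 0 ≤ p / 2 := by positivity
  obtain ⟨B, hB, hB'⟩ := pathSum_const_le k (haarSq_ne_top h f) L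
  have h1 : ∀ x ∈ L.toSet, pathSum k (weightedHaarSq h RU f) L x ^ (p / 2) ≤
      B ^ (p / 2) * (n : ℝ≥0∞) ^ p * ∑ i, ‖RU x (EuclideanSpace.single i 1)‖ₑ ^ p := fun x hx => by
    calc _ ≤ ((∑ i, ‖RU x (EuclideanSpace.single i 1)‖ₑ) ^ 2 * B) ^ (p / 2) := by
          refine ENNReal.rpow_le_rpow ?_ hp2
          refine (pathSum_le_mul k (weightedHaarSq_le_mul_haarSq h RU f · x) L).trans ?_
          gcongr
          exact hB' x hx
      _ = B ^ (p / 2) * (∑ i, ‖RU x (EuclideanSpace.single i 1)‖ₑ) ^ p := by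
          rw [ENNReal.mul_rpow_of_nonneg _ _ hp2, ← ENNReal.rpow_natCast, ← ENNReal.rpow_mul,
            mul_comm]
          congr 2
          push_cast
          ring
      _ ≤ _ := by
          rw [mul_assoc]
          gcongr
          exact sum_rpow_le_mul_sum_rpow hp0
  refine ((setLIntegral_mono' L.measurableSet h1).trans_lt ?_).ne
  have hn := ENNReal.natCast_ne_top n
  have hc : B ^ (p / 2) * (n : ℝ≥0∞) ^ p ≠ ∞ := by finiteness
  rw [lintegral_const_mul' _ _ hc, lintegral_finsetSum'
    (f := fun i x => ‖RU x (EuclideanSpace.single i 1)‖ₑ ^ p) _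
    fun i _ => ((hw.measU _).enorm.pow_const _).restrict]
  exact ENNReal.mul_lt_top hc.lt_top (ENNReal.sum_lt_top.2 fun i _ =>
    (hw.lintegral_ne_top hp L _).lt_top)

/-- Subadditivity of `y ^ (p / 2)` fails, so the sparse bound is used with `t = 1` and the square
function itself supplies the dual function. The reverse Hölder inequality must then also be applied
to `U`, hence the constant `B`. -/
theorem lintegral_pathSum_le_of_two_lt (d n : ℕ) [NeZero d] {p : ℝ} (hp : 2 < p) :
    ∃ C : ℝ≥0, ∀ (K : ℝ≥0∞) (A B : ℝ≥0)
      (RU RV RI : (Fin d → ℝ) → EuclideanSpace ℂ (Fin n) →L[ℂ] EuclideanSpace ℂ (Fin n)),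
      IsWeightPair p RU RV RI K A → 1 ≤ B → (∀ e ≠ 0, aInftyChar (fun y => ‖RU y e‖ₑ ^ p) ≤ B) →
      ∀ (D : Set (Cube d)), IsDyadicGrid D →
      ∀ h : Cube d → Fin (2 ^ d - 1) → (Fin d → ℝ) → ℂ, IsHaarSystem D h →
      ∀ f : (Fin d → ℝ) → EuclideanSpace ℂ (Fin n), AEStronglyMeasurable f volume →
      AEMeasurable (fun x => ‖RV x (f x)‖ₑ) volume → ∀ k, ∀ L ∈ D,
      ∫⁻ x in L.toSet, ‖RV x (f x)‖ₑ ^ p ≠ ∞ →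
      ∫⁻ x in L.toSet, pathSum k (weightedHaarSq h RU f) L x ^ (p / 2) ≤
        C * (K * A) * (B : ℝ≥0∞) ^ (p / 2 - 1) * ∫⁻ x in L.toSet, ‖RV x (f x)‖ₑ ^ p := by
  have hp1 : 1 < p := by linarith
  have hp0 : 0 < p := by linarith
  set q : ℝ := p / (p - 2) with hq
  have hp2 : 0 < p - 2 := by linarith
  have hq1 : 1 < q := by rw [hq, one_lt_div hp2]; linarith
  have hq0 : 0 < q := by linarith
  have hconj : (p / 2).HolderConjugate q := by
    rw [Real.holderConjugate_iff]
    refine ⟨by linarith, ?_⟩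
    rw [hq]
    field_simp
    ring
  have hq' : 1 - 1 / q = 2 / p := by
    rw [hq]
    field_simp
    ring
  obtain ⟨C₀, hC₀⟩ := exists_exponent d hp1
  obtain ⟨C₁, hC₁⟩ := exists_exponent d hq1
  set c : ℝ≥0∞ := (n * (2 * reducingConst n p)) ^ 2 * ((n : ℝ≥0∞) ^ 2 * (n * 2)) with hc
  set c' : ℝ≥0∞ := 2 * 2 ^ (d + 4) * c * (C₀ : ℝ≥0∞) ^ (2 / p) * (C₁ : ℝ≥0∞) ^ (1 / q) with hc'
  have hn := ENNReal.natCast_ne_top n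
  have hred := reducingConst_ne_top n hp1
  have hctop : c ≠ ∞ := by finiteness
  have h2p : 0 ≤ 2 / p := by positivity
  have h1q : 0 ≤ 1 / q := by positivity
  have hp2' : 0 ≤ p / 2 := by positivity
  have hctop' : c' ≠ ∞ := by finiteness
  refine ⟨(c' ^ (p / 2)).toNNReal, ?_⟩
  intro K A B RU RV RI hw hB1 hB D hD h hh f hf hg k L hL hfin
  obtain ⟨r, hr1, hrp, hRH, hDoob⟩ := hC₀ A hw.one_le
  obtain ⟨s, hs1, hsq, hRH', hDoob'⟩ := hC₁ B hB1
  have hr0 : 0 < r := by linarith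
  have hs0 : 0 < s := by linarith
  choose M hM1 hM2 using hw.exists_reducing_pair hp1
  set S := pathSum k (weightedHaarSq h RU f) L with hS
  have hSm : AEMeasurable S volume :=
    aemeasurable_pathSum k (fun Q => aemeasurable_weightedHaarSq hw.measU h f Q) L
  -- The extremal dual function: `∫ S φ = ∫ S ^ (p / 2)` and `φ ^ q = S ^ (p / 2)`, with `q`
  -- conjugate to `p / 2`.
  set φ : (Fin d → ℝ) → ℝ≥0∞ := fun x => S x ^ (p / 2 - 1) with hφ
  have hφm : AEMeasurable φ volume := hSm.pow_const _
  have hsum := hh.lintegral_pathSum_le hD (U := RU) (f := f)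
    (T := fun Q => ((M Q).symm : EuclideanSpace ℂ (Fin n) →L[ℂ] EuclideanSpace ℂ (Fin n)))
    (u := fun Q x => ∑ i, ‖RU x (M Q (EuclideanSpace.single i 1))‖ₑ)
    (fun Q => aemeasurable_sum hw.measU _)
    (fun Q x v => enorm_apply_le_reducing (RU x) (M Q) v)
    hφm (t := 1) one_pos le_rfl k hL (hw.integrableOn hp1 hf hg hfin)
  simp only [ENNReal.rpow_one, mul_one] at hsum
  have hX : ∀ x, S x * φ x = S x ^ (p / 2) := fun x => by
    have := ENNReal.rpow_add_of_nonneg (x := S x) 1 (p / 2 - 1) zero_le_one (by linarith)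
    rw [ENNReal.rpow_one, add_sub_cancel] at this
    exact this.symm
  set X : ℝ≥0∞ := ∫⁻ x in L.toSet, S x ^ (p / 2) with hXdef
  have hXtop : X ≠ ∞ := hw.lintegral_pathSum_rpow_ne_top hp1 h f k L
  have hsum' : X ≤ 2 * 2 ^ (d + 4) * ∫⁻ x in L.toSet, pathSup k (fun Q =>
      (Q.avg fun x => ‖(M Q).symm (f x)‖ₑ) ^ (2 : ℝ) *
        Q.avg fun x => (∑ i, ‖RU x (M Q (EuclideanSpace.single i 1))‖ₑ) ^ (2 : ℝ) * φ x) L x := by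
    refine le_trans (le_of_eq ?_) hsum
    rw [hXdef]
    simp only [← hX]
    rfl
  set a : Cube d → ℝ≥0∞ := fun Q => Q.avg fun x => ‖RV x (f x)‖ₑ ^ r with ha
  set b : Cube d → ℝ≥0∞ := fun Q => Q.avg fun x => φ x ^ s with hb
  -- The square of a column is `w ^ (1 - 1 / q)` for the scalar weight `w = |U^{1/p} M e_i|^p`,
  -- whose average is at most `1` by the choice of `M`.
  have hu : ∀ Q : Cube d, Q.avg (fun x =>
      (∑ i, ‖RU x (M Q (EuclideanSpace.single i 1))‖ₑ) ^ (2 : ℝ) * φ x) ≤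
      (n : ℝ≥0∞) ^ 2 * (n * 2) * b Q ^ (1 / s) := fun Q => by
    have hne : ∀ i, M Q (EuclideanSpace.single i (1 : ℂ)) ≠ 0 := fun i => by
      simp
    have hz : ∀ i, AEMeasurable (fun x => ‖RU x (M Q (EuclideanSpace.single i 1))‖ₑ ^ p) volume :=
      fun i => (hw.measU _).enorm.pow_const _
    calc _ ≤ Q.avg (fun x => (n : ℝ≥0∞) ^ 2 * ∑ i,
          (‖RU x (M Q (EuclideanSpace.single i 1))‖ₑ ^ p) ^ (1 - 1 / q) * φ x) := by
          refine Q.avg_mono fun x => ?_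
          rw [← Finset.sum_mul, ← mul_assoc]
          gcongr
          refine (sum_rpow_le_mul_sum_rpow two_pos).trans (le_of_eq ?_)
          rw [hq']
          congr 1
          · norm_cast
          · refine Finset.sum_congr rfl fun i _ => ?_
            rw [← ENNReal.rpow_mul]
            congr 1
            field_simp
      _ = (n : ℝ≥0∞) ^ 2 * ∑ i, Q.avg (fun x =>
          (‖RU x (M Q (EuclideanSpace.single i 1))‖ₑ ^ p) ^ (1 - 1 / q) * φ x) := by
          rw [Cube.avg_const_mul _ (by finiteness), Cube.avg_finset_sum (F := fun i x =>
            (‖RU x (M Q (EuclideanSpace.single i 1))‖ₑ ^ p) ^ (1 - 1 / q) * φ x)]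
          exact fun i _ => ((hz i).pow_const _).mul hφm
      _ ≤ (n : ℝ≥0∞) ^ 2 * ∑ i : Fin n, 2 * b Q ^ (1 / s) := by
          gcongr with i
          refine (hRH' _ (hz i) (hB _ (hne i)) φ hφm Q).trans ?_
          gcongr
          refine mul_le_of_le_one_right zero_le ?_
          exact ENNReal.rpow_le_one (hM1 Q i) (by rw [hq']; positivity)
      _ = _ := by
          simp only [Finset.sum_const, Finset.card_univ, Fintype.card_fin, nsmul_eq_mul]
          ring
  have hbQ : ∀ Q : Cube d, (Q.avg fun x => ‖(M Q).symm (f x)‖ₑ) ^ (2 : ℝ) *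
      Q.avg (fun x => (∑ i, ‖RU x (M Q (EuclideanSpace.single i 1))‖ₑ) ^ (2 : ℝ) * φ x) ≤
      c * K ^ (2 / p) * (a Q ^ (2 / r) * b Q ^ (1 / s)) := fun Q => by
    calc _ ≤ (n * (2 * (reducingConst n p * K ^ (1 / p))) * a Q ^ (1 / r)) ^ (2 : ℝ) *
          ((n : ℝ≥0∞) ^ 2 * (n * 2) * b Q ^ (1 / s)) :=
          mul_le_mul' (ENNReal.rpow_le_rpow (hw.avg_reducing_le hp1 hRH hg (hM2 Q)) zero_le_two)
            (hu Q)
      _ = _ := by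
          rw [show n * (2 * (reducingConst n p * K ^ (1 / p))) =
            n * (2 * reducingConst n p) * K ^ (1 / p) by ring,
            ENNReal.mul_rpow_of_nonneg _ _ zero_le_two, ENNReal.mul_rpow_of_nonneg _ _ zero_le_two,
            ← ENNReal.rpow_mul, ← ENNReal.rpow_mul, one_div_mul_eq_div, one_div_mul_eq_div,
            ENNReal.rpow_two, hc]
          ring
  have hcK : c * K ^ (2 / p) ≠ ∞ :=
    ENNReal.mul_ne_top hctop (ENNReal.rpow_ne_top_of_nonneg h2p hw.K_ne_top)
  have hm1 : Monotone fun y : ℝ≥0∞ => y ^ (2 / r) := ENNReal.monotone_rpow_of_nonneg (by positivity)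
  have hm2 : Monotone fun y : ℝ≥0∞ => y ^ (1 / s) := ENNReal.monotone_rpow_of_nonneg (by positivity)
  set G : ℝ≥0∞ := ∫⁻ x in L.toSet, ‖RV x (f x)‖ₑ ^ p with hG
  -- Hölder with exponents `p / 2` and `q` separates the two maximal functions; Doob's inequality
  -- then costs `A` for the one and `B` for the other.
  have hholder : ∫⁻ x in L.toSet, pathSup k a L x ^ (2 / r) * pathSup k b L x ^ (1 / s) ≤
      (C₀ * A * G) ^ (2 / p) * (C₁ * B * X) ^ (1 / q) := by
    refine (ENNReal.lintegral_mul_le_Lp_mul_Lq _ hconj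
      ((aemeasurable_pathSup k a L).pow_const _).restrict
      ((aemeasurable_pathSup k b L).pow_const _).restrict).trans ?_
    simp only [← ENNReal.rpow_mul]
    rw [show 2 / r * (p / 2) = p / r by ring, show 1 / s * q = q / s by ring,
      show 1 / (p / 2) = 2 / p by field_simp]
    gcongr
    · exact hDoob _ hg k L
    · refine (hDoob' φ hφm k L).trans (le_of_eq ?_)
      rw [hXdef, hφ]
      simp only [← ENNReal.rpow_mul]
      rw [show (p / 2 - 1) * q = p / 2 by rw [hq]; field_simp]
  have hmain : X ≤ c' * (K * A * G) ^ (2 / p) * (B : ℝ≥0∞) ^ (1 / q) * X ^ (1 / q) := by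
    calc X ≤ 2 * 2 ^ (d + 4) * ∫⁻ x in L.toSet,
          c * K ^ (2 / p) * (pathSup k a L x ^ (2 / r) * pathSup k b L x ^ (1 / s)) := by
          refine hsum'.trans ?_
          refine mul_le_mul_right (setLIntegral_mono' L.measurableSet fun x hx => ?_) _
          refine (pathSup_mono k L hx fun Q _ _ => hbQ Q).trans ?_
          have hm3 : Monotone fun y : ℝ≥0∞ => c * K ^ (2 / p) * y := fun y z hyz =>
            mul_le_mul_right hyz _
          rw [pathSup_comp k hm3, ← pathSup_comp k hm1, ← pathSup_comp k hm2]
          gcongr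
          exact pathSup_mul_le k _ _ L x
      _ ≤ 2 * 2 ^ (d + 4) * (c * K ^ (2 / p) *
          ((C₀ * A * G) ^ (2 / p) * (C₁ * B * X) ^ (1 / q))) := by
          rw [lintegral_const_mul' _ _ hcK]
          gcongr
      _ = _ := by
          rw [hc']
          simp only [ENNReal.mul_rpow_of_nonneg _ _ h2p, ENNReal.mul_rpow_of_nonneg _ _ h1q]
          ring
  -- Absorption: `X ^ (1 / q)` is finite and, unless `X = 0`, nonzero, so it may be divided out.
  have hfinal : X ^ (2 / p) ≤ c' * (K * A * G) ^ (2 / p) * (B : ℝ≥0∞) ^ (1 / q) := by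
    rcases eq_or_ne X 0 with h0 | h0
    · rw [h0, ENNReal.zero_rpow_of_pos (by positivity)]
      exact zero_le
    have h1 : X = X ^ (2 / p) * X ^ (1 / q) := by
      rw [← ENNReal.rpow_add _ _ h0 hXtop, ← hq']
      simp
    have h2 : X ^ (1 / q) ≠ 0 := by
      simp [h0, hXtop]
    have h3 : X ^ (1 / q) ≠ ∞ := ENNReal.rpow_ne_top_of_nonneg h1q hXtop
    rw [h1] at hmain
    exact (ENNReal.mul_le_mul_iff_left h2 h3).1 (by rwa [← h1] at hmain ⊢)
  have := ENNReal.rpow_le_rpow hfinal hp2'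
  rw [← ENNReal.rpow_mul, show 2 / p * (p / 2) = 1 by field_simp, ENNReal.rpow_one] at this
  refine this.trans (le_of_eq ?_)
  rw [ENNReal.coe_toNNReal (ENNReal.rpow_ne_top_of_nonneg hp2' hctop'),
    ENNReal.mul_rpow_of_nonneg _ _ hp2', ENNReal.mul_rpow_of_nonneg _ _ hp2',
    ← ENNReal.rpow_mul, ← ENNReal.rpow_mul, show 2 / p * (p / 2) = 1 by field_simp,
    ENNReal.rpow_one, show 1 / q * (p / 2) = p / 2 - 1 by rw [hq]; field_simp]
  ring

end IsWeightPair

end MatrixSquare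

end

noncomputable section

namespace MatrixSquare

/-! ### The norm of the square function -/

section

variable {d n : ℕ} {p : ℝ}

theorem aInftyChar_congr_ae {v w : (Fin d → ℝ) → ℝ≥0∞} (h : v =ᵐ[volume] w) :
    aInftyChar v = aInftyChar w := by
  have h1 : ∀ Q : Cube d, ∫⁻ x in Q.toSet, v x = ∫⁻ x in Q.toSet, w x := fun Q =>
    lintegral_congr_ae (ae_restrict_of_ae h)
  have h2 : ∀ Q : Cube d, maximalFn (Q.toSet.indicator v) = maximalFn (Q.toSet.indicator w) := by
    intro Q
    have h3 : Q.toSet.indicator v =ᵐ[volume] Q.toSet.indicator w := by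
      filter_upwards [h] with x hx
      simp only [Set.indicator, hx]
    funext x
    simp only [maximalFn]
    congr 1
    funext P
    congr 1
    funext _
    exact setLAverage_congr_fun_ae P.measurableSet (h3.mono fun y hy _ => hy)
  simp only [aInftyChar, h1, h2]

theorem Cube.lintegral_ne_zero (Q : Cube d) {F : (Fin d → ℝ) → ℝ≥0∞}
    (hF : AEMeasurable F volume) (h : ∀ᵐ x, F x ≠ 0) : ∫⁻ x in Q.toSet, F x ≠ 0 := by
  intro h0
  rw [lintegral_eq_zero_iff' hF.restrict] at h0
  have h1 : ∀ᵐ x ∂volume.restrict Q.toSet, False := by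
    filter_upwards [h0, ae_restrict_of_ae h] with x hx hx'
    exact hx' hx
  rw [Filter.eventually_false_iff_eq_bot, ae_eq_bot, Measure.restrict_eq_zero] at h1
  exact Q.volume_ne_zero h1

/-- On `Q` the maximal function of the localized weight is at least the average over `Q`. The
exponent `r` is constructed only for bounds `A ≥ 1`. -/
theorem one_le_aInftyChar {w : (Fin d → ℝ) → ℝ≥0∞} (hw : AEMeasurable w volume)
    (h : ∀ᵐ x, w x ≠ 0) : 1 ≤ aInftyChar w := by
  let Q : Cube d := ⟨0, 1, one_pos⟩
  refine le_trans ?_ (le_iSup (f := fun Q : Cube d => if ∫⁻ x in Q.toSet, w x = ∞ then ∞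
    else (∫⁻ x in Q.toSet, maximalFn (Q.toSet.indicator w) x) / ∫⁻ x in Q.toSet, w x) Q)
  split_ifs with htop
  · exact le_top
  rw [ENNReal.le_div_iff_mul_le (Or.inl (Q.lintegral_ne_zero hw h)) (Or.inl htop), one_mul,
    ← Q.avg_mul_volume w, ← setLIntegral_const]
  refine setLIntegral_mono' Q.measurableSet fun x hx => ?_
  exact (le_pathSup 0 (fun P => P.avg w) Q x).trans (pathSup_avg_le_maximalFn 0 w Q hx)

theorem IsMatrixWeight.aestronglyMeasurable_op_const {W : (Fin d → ℝ) → Matrix (Fin n) (Fin n) ℂ}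
    (hW : IsMatrixWeight W) (s : ℝ) (v : EuclideanSpace ℂ (Fin n)) :
    AEStronglyMeasurable (fun x => op (matrixPow (W x) s) v) volume :=
  hW.aestronglyMeasurable_op s aestronglyMeasurable_const

theorem enorm_rpow_ne_zero {B : EuclideanSpace ℂ (Fin n) →L[ℂ] EuclideanSpace ℂ (Fin n)}
    (hB : Function.Injective B) {v : EuclideanSpace ℂ (Fin n)} (hv : v ≠ 0) (s : ℝ) :
    ‖B v‖ₑ ^ s ≠ 0 := by
  have : B v ≠ 0 := fun h => hv (hB (h.trans (map_zero B).symm))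
  simp [this]

/-- The dual characteristic of `V` in terms of the operators `V^{-1/p}`. -/
theorem IsMatrixWeight.apWkChar_dual {V : (Fin d → ℝ) → Matrix (Fin n) (Fin n) ℂ}
    (hV : IsMatrixWeight V) (hp : 1 < p) :
    apWkChar (dual p) (fun x => matrixPow (V x) (-dual p / p)) =
      ⨆ (e : EuclideanSpace ℂ (Fin n)) (_ : e ≠ 0),
        aInftyChar fun x => ‖op (matrixPow (V x) (-1 / p)) e‖ₑ ^ dual p := by
  have hp' := (Real.HolderConjugate.conjExponent hp).symm
  simp only [apWkChar]
  congr 1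
  funext e
  congr 1
  funext _
  refine aInftyChar_congr_ae ?_
  filter_upwards [hV.posDef] with x hx
  rw [matrixPow_matrixPow hx]
  have : -dual p / p * (1 / dual p) = -1 / p := by
    have := hp'.ne_zero
    field_simp
  rw [this]

theorem IsMatrixWeight.one_le_apWkChar {W : (Fin d → ℝ) → Matrix (Fin n) (Fin n) ℂ}
    (hW : IsMatrixWeight W) (hn : 0 < n) (q : ℝ) : 1 ≤ apWkChar q W := by
  have he : (EuclideanSpace.single (⟨0, hn⟩ : Fin n) 1 : EuclideanSpace ℂ (Fin n)) ≠ 0 := by simp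
  refine le_trans ?_ (le_iSup₂ (f := fun (e : EuclideanSpace ℂ (Fin n)) (_ : e ≠ 0) =>
    aInftyChar fun x => ‖op (matrixPow (W x) (1 / q)) e‖ₑ ^ q) _ he)
  refine one_le_aInftyChar ((hW.aestronglyMeasurable_op_const _ _).enorm.pow_const _) ?_
  filter_upwards [hW.posDef] with x hx
  exact enorm_rpow_ne_zero (op_matrixPow_injective hx _) he _

theorem IsMatrixWeight.one_le_apWkChar_dual {V : (Fin d → ℝ) → Matrix (Fin n) (Fin n) ℂ}
    (hV : IsMatrixWeight V) (hn : 0 < n) (hp : 1 < p) :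
    1 ≤ apWkChar (dual p) (fun x => matrixPow (V x) (-dual p / p)) := by
  have hp' := (Real.HolderConjugate.conjExponent hp).symm
  rw [hV.apWkChar_dual hp]
  have he : (EuclideanSpace.single (⟨0, hn⟩ : Fin n) 1 : EuclideanSpace ℂ (Fin n)) ≠ 0 := by simp
  refine le_trans ?_ (le_iSup₂ (f := fun (e : EuclideanSpace ℂ (Fin n)) (_ : e ≠ 0) =>
    aInftyChar fun x => ‖op (matrixPow (V x) (-1 / p)) e‖ₑ ^ dual p) _ he)
  refine one_le_aInftyChar ((hV.aestronglyMeasurable_op_const _ _).enorm.pow_const _) ?_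
  filter_upwards [hV.posDef] with x hx
  exact enorm_rpow_ne_zero (op_matrixPow_injective hx _) he _

variable {U V : (Fin d → ℝ) → Matrix (Fin n) (Fin n) ℂ}

theorem op_mul (A B : Matrix (Fin n) (Fin n) ℂ) : op (A * B) = op A * op B :=
  map_mul _ A B

theorem avg_le_apChar (p : ℝ) (U V : (Fin d → ℝ) → Matrix (Fin n) (Fin n) ℂ) (Q : Cube d) :
    Q.avg (fun x => Q.avg (fun y =>
      ‖op (matrixPow (V y) (-1 / p) * matrixPow (U x) (1 / p))‖ₑ ^ dual p) ^ (p / dual p)) ≤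
      apChar p U V :=
  le_iSup (fun I : Cube d => ⨍⁻ x in I.toSet, (⨍⁻ y in I.toSet,
    ‖op (matrixPow (V y) (-1 / p) * matrixPow (U x) (1 / p))‖ₑ ^ dual p ∂volume) ^ (p / dual p)
      ∂volume) Q

theorem isWeightPair (hU : IsMatrixWeight U) (hV : IsMatrixWeight V) (hp : 1 < p) {A : ℝ≥0}
    (hK : apChar p U V ≠ ∞) (hA1 : 1 ≤ A)
    (hA : apWkChar (dual p) (fun x => matrixPow (V x) (-dual p / p)) ≤ A) :
    IsWeightPair p (fun x => op (matrixPow (U x) (1 / p))) (fun x => op (matrixPow (V x) (1 / p)))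
      (fun x => op (matrixPow (V x) (-1 / p))) (apChar p U V) A := by
  have hinv : ∀ᵐ x, ∀ v, op (matrixPow (V x) (-1 / p)) (op (matrixPow (V x) (1 / p)) v) = v := by
    filter_upwards [hV.posDef] with x hx v
    have := op_matrixPow_apply_neg hx (-1 / p) v
    rwa [show -(-1 / p) = 1 / p by ring] at this
  have hap : ∀ Q : Cube d, Q.avg (fun x => Q.avg (fun y =>
      ‖op (matrixPow (V y) (-1 / p)) * op (matrixPow (U x) (1 / p))‖ₑ ^ dual p) ^ (p / dual p)) ≤
      apChar p U V := fun Q => by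
    simp only [← op_mul]
    exact avg_le_apChar p U V Q
  have hainf : ∀ e : EuclideanSpace ℂ (Fin n), e ≠ 0 →
      aInftyChar (fun x => ‖op (matrixPow (V x) (-1 / p)) e‖ₑ ^ dual p) ≤ A := fun e he => by
    rw [hV.apWkChar_dual hp] at hA
    exact (le_iSup₂ (f := fun (e : EuclideanSpace ℂ (Fin n)) (_ : e ≠ 0) =>
      aInftyChar fun x => ‖op (matrixPow (V x) (-1 / p)) e‖ₑ ^ dual p) e he).trans hA
  have hinjU : ∀ᵐ x, Function.Injective (op (matrixPow (U x) (1 / p))) :=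
    hU.posDef.mono fun _ hx => op_matrixPow_injective hx _
  have hinjI : ∀ᵐ x, Function.Injective (op (matrixPow (V x) (-1 / p))) :=
    hV.posDef.mono fun _ hx => op_matrixPow_injective hx _
  exact ⟨hU.aestronglyMeasurable_op_const _, hV.aestronglyMeasurable_op_const _,
    fun x => adjoint_op_matrixPow _ _, fun x => adjoint_op_matrixPow _ _, hinjU, hinjI, hinv, hK,
    hap, hA1, hainf⟩

/-- If the characteristic vanished, the dual reducing operator would force `U^{1/p} e = 0` a.e. on a
cube. Needed when `[U]_{A_p^{wk}} = ∞`, where a zero factor would turn the right-hand side into `0`.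
-/
theorem apChar_ne_zero (hU : IsMatrixWeight U) (hV : IsMatrixWeight V) (hn : 0 < n) (hp : 1 < p)
    (hA : apWkChar (dual p) (fun x => matrixPow (V x) (-dual p / p)) ≠ ∞) :
    apChar p U V ≠ 0 := by
  intro h0
  have hp0 : 0 < p := by linarith
  have hw := isWeightPair hU hV hp (h0 ▸ ENNReal.zero_ne_top)
    (A := (apWkChar (dual p) (fun x => matrixPow (V x) (-dual p / p))).toNNReal)
    (by
      rw [← ENNReal.coe_le_coe, ENNReal.coe_toNNReal hA]
      exact hV.one_le_apWkChar_dual hn hp) (by rw [ENNReal.coe_toNNReal hA])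
  let Q : Cube d := ⟨0, 1, one_pos⟩
  obtain ⟨N, -, hN⟩ := hw.exists_reducing_dual hp Q
  have he : (EuclideanSpace.single (⟨0, hn⟩ : Fin n) 1 : EuclideanSpace ℂ (Fin n)) ≠ 0 := by simp
  have h1 := hN (EuclideanSpace.single (⟨0, hn⟩ : Fin n) 1)
  rw [h0, mul_zero, nonpos_iff_eq_zero] at h1
  refine Q.lintegral_ne_zero (F := fun x => ‖N.symm (op (matrixPow (U x) (1 / p))
    (EuclideanSpace.single (⟨0, hn⟩ : Fin n) 1))‖ₑ ^ p) ?_ ?_ ?_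
  · exact ((N.symm.continuous.comp_aestronglyMeasurable (hw.measU _)).enorm).pow_const _
  · filter_upwards [hw.injU] with x hx
    exact enorm_rpow_ne_zero (B := (N.symm : EuclideanSpace ℂ (Fin n) →L[ℂ] _) ∘L
      op (matrixPow (U x) (1 / p))) (N.symm.injective.comp hx) he p
  · rw [← Q.avg_mul_volume, h1, zero_mul]

theorem squareFn_rpow (D : Set (Cube d)) (h : Cube d → Fin (2 ^ d - 1) → (Fin d → ℝ) → ℂ)
    (p : ℝ) (U : (Fin d → ℝ) → Matrix (Fin n) (Fin n) ℂ)
    (f : (Fin d → ℝ) → EuclideanSpace ℂ (Fin n)) (x : Fin d → ℝ) :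
    squareFn D h p U f x ^ p = (∑' J : D, (J : Cube d).toSet.indicator
      (weightedHaarSq h (fun x => op (matrixPow (U x) (1 / p))) f J) x) ^ (p / 2) := by
  rw [squareFn, ← ENNReal.rpow_mul, one_div_mul_eq_div]
  congr 1
  refine tsum_congr fun J => ?_
  by_cases hx : x ∈ (J : Cube d).toSet
  · simp only [Set.indicator_of_mem hx, weightedHaarSq, ENNReal.div_eq_inv_mul, Finset.mul_sum]
  · simp only [Set.indicator_of_notMem hx, Finset.sum_const_zero]

/-- Estimates uniform in the depth and in the top cube add up over a partition of the space, and
only finiteness on the top cube is ever required of `f`. -/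
theorem squareFnNorm_le_of_tree_bound [NeZero d] {D : Set (Cube d)} (hD : IsDyadicGrid D)
    {h : Cube d → Fin (2 ^ d - 1) → (Fin d → ℝ) → ℂ} (hU : IsMatrixWeight U) (hp : 1 < p)
    {C : ℝ≥0∞} (hC : C ≠ ∞)
    (hb : ∀ f : (Fin d → ℝ) → EuclideanSpace ℂ (Fin n), AEStronglyMeasurable f volume →
      ∀ k, ∀ L ∈ D, ∫⁻ x in L.toSet, ‖op (matrixPow (V x) (1 / p)) (f x)‖ₑ ^ p ≠ ∞ →
      ∫⁻ x in L.toSet, pathSum k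
        (weightedHaarSq h (fun x => op (matrixPow (U x) (1 / p))) f) L x ^ (p / 2) ≤
        C * ∫⁻ x in L.toSet, ‖op (matrixPow (V x) (1 / p)) (f x)‖ₑ ^ p) :
    squareFnNorm D h p U V ≤ C ^ (1 / p) := by
  have hp0 : 0 < p := by linarith
  lift C to ℝ≥0 using hC
  refine sInf_le fun f hf hfin => ?_
  have hfin' : ∫⁻ x, ‖op (matrixPow (V x) (1 / p)) (f x)‖ₑ ^ p ≠ ∞ := by
    rw [weightedNorm, ENNReal.rpow_lt_top_iff_of_pos (by positivity)] at hfin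
    exact hfin.ne
  rw [weightedNorm, ← ENNReal.mul_rpow_of_nonneg _ _ (by positivity)]
  refine ENNReal.rpow_le_rpow ?_ (by positivity)
  simp only [squareFn_rpow]
  exact hD.lintegral_tsum_indicator_rpow_le
    (IsWeightPair.aemeasurable_weightedHaarSq (hU.aestronglyMeasurable_op_const _) h f)
    (by positivity) fun k L hL => hb f hf k L hL
      ((setLIntegral_le_lintegral _ _).trans_lt hfin'.lt_top).ne

theorem squareFnNorm_le_of_le_two (d n : ℕ) [NeZero d] (hn : 0 < n) (hp : 1 < p) (hp2 : p ≤ 2) :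
    ∃ C : ℝ≥0, ∀ D : Set (Cube d), IsDyadicGrid D →
      ∀ h : Cube d → Fin (2 ^ d - 1) → (Fin d → ℝ) → ℂ, IsHaarSystem D h →
      ∀ U V : (Fin d → ℝ) → Matrix (Fin n) (Fin n) ℂ,
        IsMatrixWeight U → IsMatrixWeight V → apChar p U V < ∞ →
        apWkChar (dual p) (fun x => matrixPow (V x) (-dual p / p)) < ∞ →
        squareFnNorm D h p U V ≤ C * apChar p U V ^ (1 / p) *
          apWkChar (dual p) (fun x => matrixPow (V x) (-dual p / p)) ^ (1 / p) := by
  have hp0 : 0 ≤ 1 / p := by positivity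
  obtain ⟨C, hC⟩ := IsWeightPair.lintegral_pathSum_le_of_le_two d n hp hp2
  refine ⟨C ^ (1 / p), fun D hD h hh U V hU hV hK hA => ?_⟩
  have h1 := hV.one_le_apWkChar_dual hn hp
  set A := apWkChar (dual p) (fun x => matrixPow (V x) (-dual p / p)) with hAdef
  have hA' : A ≠ ∞ := hA.ne
  have hK' := hK.ne
  clear_value A
  lift A to ℝ≥0 using hA'
  have hw := isWeightPair hU hV hp hK' (by exact_mod_cast h1) hAdef.ge
  refine (squareFnNorm_le_of_tree_bound hD hU hp (C := C * (apChar p U V * A)) (by finiteness)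
    fun f hf k L hL hfin => hC _ _ _ _ _ hw D hD h hh f hf
      (hV.aestronglyMeasurable_op _ hf).enorm k L hL hfin).trans_eq ?_
  rw [ENNReal.mul_rpow_of_nonneg _ _ hp0, ENNReal.mul_rpow_of_nonneg _ _ hp0,
    ← ENNReal.coe_rpow_of_nonneg C hp0, mul_assoc]

theorem squareFnNorm_le_of_two_lt (d n : ℕ) [NeZero d] (hn : 0 < n) (hp2 : 2 < p) :
    ∃ C : ℝ≥0, ∀ D : Set (Cube d), IsDyadicGrid D →
      ∀ h : Cube d → Fin (2 ^ d - 1) → (Fin d → ℝ) → ℂ, IsHaarSystem D h →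
      ∀ U V : (Fin d → ℝ) → Matrix (Fin n) (Fin n) ℂ,
        IsMatrixWeight U → IsMatrixWeight V → apChar p U V < ∞ →
        apWkChar (dual p) (fun x => matrixPow (V x) (-dual p / p)) < ∞ →
        squareFnNorm D h p U V ≤ C * apChar p U V ^ (1 / p) *
          apWkChar (dual p) (fun x => matrixPow (V x) (-dual p / p)) ^ (1 / p) *
            apWkChar p U ^ (1 / 2 - 1 / p) := by
  have hp : 1 < p := by linarith
  have hp0 : 0 < 1 / p := by positivity
  have hexp : 0 < 1 / 2 - 1 / p := by
    rw [sub_pos]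
    exact one_div_lt_one_div_of_lt two_pos hp2
  obtain ⟨C, hC⟩ := IsWeightPair.lintegral_pathSum_le_of_two_lt d n hp2
  -- `C + 1` rather than `C`: the constant must be positive for the right-hand side to be `∞` when
  -- the characteristic of `U` is.
  refine ⟨(C + 1) ^ (1 / p), fun D hD h hh U V hU hV hK hA => ?_⟩
  have h1 := hV.one_le_apWkChar_dual hn hp
  have h2 := hU.one_le_apWkChar hn p
  have hK0 := apChar_ne_zero hU hV hn hp hA.ne
  set A := apWkChar (dual p) (fun x => matrixPow (V x) (-dual p / p)) with hAdef
  have hA' : A ≠ ∞ := hA.ne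
  have hK' := hK.ne
  clear_value A
  lift A to ℝ≥0 using hA'
  rcases eq_or_ne (apWkChar p U) ∞ with hB | hB
  · rw [hB, ENNReal.top_rpow_of_pos hexp, ENNReal.mul_top]
    · exact le_top
    · have h3 : (A : ℝ≥0∞) ≠ 0 := fun h0 => by rw [h0] at h1; simp at h1
      have h4 : (A : ℝ≥0∞) ^ (1 / p) ≠ 0 := by
        rw [Ne, ENNReal.rpow_eq_zero_iff_of_pos hp0]; exact h3
      have h5 : apChar p U V ^ (1 / p) ≠ 0 := by
        rw [Ne, ENNReal.rpow_eq_zero_iff_of_pos hp0]; exact hK0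
      have h6 : (((C + 1) ^ (1 / p) : ℝ≥0) : ℝ≥0∞) ≠ 0 := by
        rw [ENNReal.coe_ne_zero]
        positivity
      exact mul_ne_zero (mul_ne_zero h6 h5) h4
  have hw := isWeightPair hU hV hp hK' (by exact_mod_cast h1) hAdef.ge
  have hBe : ∀ e : EuclideanSpace ℂ (Fin n), e ≠ 0 →
      aInftyChar (fun y => ‖op (matrixPow (U y) (1 / p)) e‖ₑ ^ p) ≤ (apWkChar p U).toNNReal := by
    rw [ENNReal.coe_toNNReal hB]
    exact fun e he => le_iSup₂ (f := fun (e : EuclideanSpace ℂ (Fin n)) (_ : e ≠ 0) =>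
      aInftyChar fun x => ‖op (matrixPow (U x) (1 / p)) e‖ₑ ^ p) e he
  set B := apWkChar p U with hBdef
  clear_value B
  lift B to ℝ≥0 using hB
  rw [ENNReal.toNNReal_coe] at hBe
  have hexp' : 0 ≤ p / 2 - 1 := by linarith
  refine (squareFnNorm_le_of_tree_bound hD hU hp
    (C := C * (apChar p U V * A) * (B : ℝ≥0∞) ^ (p / 2 - 1)) (by finiteness)
    fun f hf k L hL hfin => hC _ _ _ _ _ _ hw (by exact_mod_cast h2) hBe D hD h hh f hf
      (hV.aestronglyMeasurable_op _ hf).enorm k L hL hfin).trans ?_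
  rw [ENNReal.mul_rpow_of_nonneg _ _ hp0.le, ENNReal.mul_rpow_of_nonneg _ _ hp0.le,
    ENNReal.mul_rpow_of_nonneg _ _ hp0.le, ENNReal.coe_rpow_of_nonneg _ hp0.le, ← ENNReal.rpow_mul,
    show (p / 2 - 1) * (1 / p) = 1 / 2 - 1 / p by field_simp, ← mul_assoc]
  gcongr
  exact le_self_add

end

end MatrixSquare

end

noncomputable section

namespace MatrixSquare

/-! ### Scalar weights -/

section

variable {d n : ℕ} {p : ℝ}

/-- The matrix weight `σ^{1-p}` times the identity. -/
def scalarWeight (n : ℕ) (p : ℝ) (σ : (Fin d → ℝ) → ℝ≥0) (x : Fin d → ℝ) :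
    Matrix (Fin n) (Fin n) ℂ :=
  algebraMap ℝ _ ((σ x ^ (1 - p) : ℝ≥0) : ℝ)

variable {σ : (Fin d → ℝ) → ℝ≥0}

theorem isMatrixWeight_scalarWeight (hσ : Measurable σ) (hpos : ∀ x, 0 < σ x) :
    IsMatrixWeight (scalarWeight n p σ) where
  aemeasurable i j := by
    simp only [scalarWeight, Matrix.algebraMap_matrix_apply]
    split_ifs
    · exact (Complex.measurable_ofReal.comp
        (measurable_coe_nnreal_real.comp (hσ.pow_const _))).aemeasurable
    · exact aemeasurable_const
  posDef := Filter.Eventually.of_forall fun x => by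
    rw [scalarWeight, Algebra.algebraMap_eq_smul_one]
    exact Matrix.PosDef.one.smul (NNReal.coe_pos.2 (NNReal.rpow_pos (hpos x)))

theorem op_scalarWeight_apply (s : ℝ) (x : Fin d → ℝ) (v : EuclideanSpace ℂ (Fin n)) :
    op (matrixPow (scalarWeight n p σ x) s) v = ((σ x ^ ((1 - p) * s) : ℝ≥0) : ℝ) • v := by
  rw [scalarWeight, matrixPow_algebraMap, NNReal.rpow_mul, NNReal.coe_rpow]
  have h (c : ℝ) : op (algebraMap ℝ (Matrix (Fin n) (Fin n) ℂ) c) = (c : ℂ) • 1 := by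
    have : algebraMap ℝ (Matrix (Fin n) (Fin n) ℂ) c = (c : ℂ) • 1 := by
      rw [Algebra.algebraMap_eq_smul_one]
      ext i j
      simp
    rw [this, op, map_smul, map_one]
  rw [h]
  rfl

theorem enorm_op_scalarWeight (hpos : ∀ x, 0 < σ x) (s : ℝ) (x : Fin d → ℝ)
    (v : EuclideanSpace ℂ (Fin n)) :
    ‖op (matrixPow (scalarWeight n p σ x) s) v‖ₑ = (σ x : ℝ≥0∞) ^ ((1 - p) * s) * ‖v‖ₑ := by
  rw [op_scalarWeight_apply, enorm_smul, NNReal.enorm_eq,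
    ENNReal.coe_rpow_of_ne_zero (hpos x).ne']

theorem weightedHaarSq_scalarWeight (hpos : ∀ x, 0 < σ x) (hp : 1 < p)
    (h : Cube d → Fin (2 ^ d - 1) → (Fin d → ℝ) → ℂ)
    (f : (Fin d → ℝ) → EuclideanSpace ℂ (Fin n)) (J : Cube d) (x : Fin d → ℝ) :
    weightedHaarSq h (fun x => op (matrixPow (scalarWeight n p σ x) (1 / p))) f J x ^ (p / 2) =
      (σ x : ℝ≥0∞) ^ (1 - p) * haarSq h f J ^ (p / 2) := by
  have hp0 : 0 < p := by linarith
  simp only [weightedHaarSq, enorm_op_scalarWeight hpos, mul_pow]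
  rw [← Finset.mul_sum, mul_div_assoc, ENNReal.mul_rpow_of_nonneg _ _ (by positivity), haarSq,
    ← ENNReal.rpow_natCast, ← ENNReal.rpow_mul, ← ENNReal.rpow_mul]
  congr 2
  push_cast
  field_simp

/-- Discarding all terms of the square function except that of `J`. For a multiple of the identity
the weight factors out. -/
theorem le_squareFn_scalarWeight (hpos : ∀ x, 0 < σ x) (hp : 1 < p) {D : Set (Cube d)}
    (h : Cube d → Fin (2 ^ d - 1) → (Fin d → ℝ) → ℂ)
    (f : (Fin d → ℝ) → EuclideanSpace ℂ (Fin n)) {J : Cube d} (hJ : J ∈ D) {x : Fin d → ℝ}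
    (hx : x ∈ J.toSet) :
    (σ x : ℝ≥0∞) ^ (1 - p) * haarSq h f J ^ (p / 2) ≤
      squareFn D h p (scalarWeight n p σ) f x ^ p := by
  rw [squareFn_rpow, ← weightedHaarSq_scalarWeight hpos hp]
  refine ENNReal.rpow_le_rpow ?_ (by linarith)
  refine le_trans (le_of_eq ?_) (ENNReal.le_tsum (⟨J, hJ⟩ : D))
  rw [Set.indicator_of_mem hx]

/-- An `A_1` condition bounds the maximal function by `K * w` pointwise, and integration over `Q`
finishes. -/
theorem aInftyChar_le_of_avg_le {w : (Fin d → ℝ) → ℝ≥0∞} {K : ℝ≥0∞} (hK : K ≠ ∞)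
    (hw : ∀ x, w x ≠ ∞) (h : ∀ P : Cube d, ∀ x ∈ P.toSet, P.avg w ≤ K * w x) :
    aInftyChar w ≤ K := by
  refine iSup_le fun Q => ?_
  have hfin : ∫⁻ x in Q.toSet, w x ≠ ∞ := by
    have h1 := h Q _ Q.corner_mem
    rw [← Q.avg_mul_volume]
    exact ENNReal.mul_ne_top (h1.trans_lt (ENNReal.mul_lt_top hK.lt_top (hw _).lt_top)).ne
      Q.volume_ne_top
  rw [if_neg hfin]
  refine ENNReal.div_le_of_le_mul ?_
  rw [← lintegral_const_mul' _ _ hK]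
  refine setLIntegral_mono' Q.measurableSet fun x _ => ?_
  exact iSup₂_le fun P hP =>
    (P.avg_mono fun y => Set.indicator_le_self _ _ y).trans (h P x hP)

theorem enorm_op_dual_scalarWeight (hpos : ∀ x, 0 < σ x) (hp : 1 < p) (x : Fin d → ℝ)
    (v : EuclideanSpace ℂ (Fin n)) :
    ‖op (matrixPow (scalarWeight n p σ x) (-1 / p)) v‖ₑ ^ dual p = ‖v‖ₑ ^ dual p * σ x := by
  have hp0 : 0 < p := by linarith
  have hp' := (Real.HolderConjugate.conjExponent hp).symm
  have hp1 : p - 1 ≠ 0 := by linarith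
  rw [enorm_op_scalarWeight hpos, ENNReal.mul_rpow_of_nonneg _ _ hp'.nonneg, ← ENNReal.rpow_mul,
    mul_comm]
  have : (1 - p) * (-1 / p) * dual p = 1 := by
    rw [dual, Real.conjExponent]
    field_simp
    ring
  rw [this, ENNReal.rpow_one]

theorem apWkChar_scalarWeight_le (hσ : Measurable σ) (hpos : ∀ x, 0 < σ x) (hp : 1 < p) {K : ℝ≥0∞}
    (hK : K ≠ ∞) (h : ∀ P : Cube d, ∀ x ∈ P.toSet, P.avg (fun y => (σ y : ℝ≥0∞)) ≤ K * σ x) :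
    apWkChar (dual p) (fun x => matrixPow (scalarWeight n p σ x) (-dual p / p)) ≤ K := by
  have hp' := (Real.HolderConjugate.conjExponent hp).symm
  rw [(isMatrixWeight_scalarWeight hσ hpos).apWkChar_dual hp]
  refine iSup₂_le fun e _ => ?_
  simp only [enorm_op_dual_scalarWeight hpos hp]
  have hc : ‖e‖ₑ ^ dual p ≠ ∞ := ENNReal.rpow_ne_top_of_nonneg hp'.nonneg enorm_ne_top
  refine aInftyChar_le_of_avg_le hK (fun x => ENNReal.mul_ne_top hc ENNReal.coe_ne_top)
    fun P x hx => ?_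
  rw [P.avg_const_mul hc, mul_left_comm]
  gcongr
  exact h P x hx

theorem le_apWkChar_scalarWeight (hσ : Measurable σ) (hpos : ∀ x, 0 < σ x) (hp : 1 < p)
    (hn : 0 < n) : aInftyChar (fun y => (σ y : ℝ≥0∞)) ≤
      apWkChar (dual p) (fun x => matrixPow (scalarWeight n p σ x) (-dual p / p)) := by
  rw [(isMatrixWeight_scalarWeight hσ hpos).apWkChar_dual hp]
  have he : (EuclideanSpace.single (⟨0, hn⟩ : Fin n) 1 : EuclideanSpace ℂ (Fin n)) ≠ 0 := by simp
  refine le_trans ?_ (le_iSup₂ (f := fun (e : EuclideanSpace ℂ (Fin n)) (_ : e ≠ 0) =>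
    aInftyChar fun x => ‖op (matrixPow (scalarWeight n p σ x) (-1 / p)) e‖ₑ ^ dual p) _ he)
  simp only [enorm_op_dual_scalarWeight hpos hp, enorm_single_one, ENNReal.one_rpow, one_mul,
    le_refl]

theorem op_mul_apply (A B : Matrix (Fin n) (Fin n) ℂ) (v : EuclideanSpace ℂ (Fin n)) :
    op (A * B) v = op A (op B v) := by
  rw [op_mul]
  rfl

theorem nnnorm_op_mul_scalarWeight_le (σ : (Fin d → ℝ) → ℝ≥0) (x y : Fin d → ℝ) :
    ‖op (matrixPow (scalarWeight n p σ y) (-1 / p) * matrixPow (scalarWeight n p σ x) (1 / p))‖₊ ≤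
      σ y ^ ((1 - p) * (-1 / p)) * σ x ^ ((1 - p) * (1 / p)) := by
  refine ContinuousLinearMap.opNNNorm_le_bound _ _ fun v => le_of_eq ?_
  rw [op_mul_apply, op_scalarWeight_apply, op_scalarWeight_apply, nnnorm_smul, nnnorm_smul,
    ← mul_assoc, Real.nnnorm_of_nonneg (NNReal.coe_nonneg _),
    Real.nnnorm_of_nonneg (NNReal.coe_nonneg _)]
  rfl

/-- For `W = σ^{1-p} Id` the inner `L^{p'}` average is at most the average of `σ` divided by `σ x`,
hence at most the `A_1` constant `K`; the exponent is `p / p' = p - 1`. -/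
theorem apChar_scalarWeight_le (hpos : ∀ x, 0 < σ x) (hp : 1 < p) {K : ℝ≥0∞}
    (h : ∀ P : Cube d, ∀ x ∈ P.toSet, P.avg (fun y => (σ y : ℝ≥0∞)) ≤ K * σ x) :
    apChar p (scalarWeight n p σ) (scalarWeight n p σ) ≤ K ^ (p - 1) := by
  have hp0 : 0 < p := by linarith
  have hp' := (Real.HolderConjugate.conjExponent hp).symm
  have hp1 : 0 < p - 1 := by linarith
  have hdiv : p / dual p = p - 1 := by
    rw [dual, Real.conjExponent]
    field_simp
  have h0 : ∀ x, (σ x : ℝ≥0∞) ≠ 0 := fun x => ENNReal.coe_ne_zero.2 (hpos x).ne'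
  have hnorm : ∀ x y, ‖op (matrixPow (scalarWeight n p σ y) (-1 / p) *
      matrixPow (scalarWeight n p σ x) (1 / p))‖ₑ ^ dual p ≤ (σ x : ℝ≥0∞)⁻¹ * σ y := by
    intro x y
    have h1 := nnnorm_op_mul_scalarWeight_le (n := n) (p := p) σ x y
    have h2 := ENNReal.rpow_le_rpow (ENNReal.coe_le_coe.2 h1) hp'.nonneg
    refine h2.trans (le_of_eq ?_)
    rw [ENNReal.coe_mul, ENNReal.mul_rpow_of_nonneg _ _ hp'.nonneg,
      ENNReal.coe_rpow_of_ne_zero (hpos x).ne', ENNReal.coe_rpow_of_ne_zero (hpos y).ne',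
      ← ENNReal.rpow_mul, ← ENNReal.rpow_mul]
    have h3 : (1 - p) * (-1 / p) * dual p = 1 := by
      rw [dual, Real.conjExponent]
      field_simp
      ring
    have h4 : (1 - p) * (1 / p) * dual p = -1 := by
      rw [dual, Real.conjExponent]
      field_simp
      ring
    rw [h3, h4, ENNReal.rpow_one, ENNReal.rpow_neg_one, mul_comm]
  refine iSup_le fun I => ?_
  have hx : ∀ x ∈ I.toSet, I.avg (fun y => ‖op (matrixPow (scalarWeight n p σ y) (-1 / p) *
      matrixPow (scalarWeight n p σ x) (1 / p))‖ₑ ^ dual p) ^ (p / dual p) ≤ K ^ (p - 1) := by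
    intro x hxI
    rw [hdiv]
    refine ENNReal.rpow_le_rpow ?_ hp1.le
    refine (I.avg_mono (hnorm x)).trans ?_
    rw [I.avg_const_mul (ENNReal.inv_ne_top.2 (h0 x))]
    calc _ ≤ (σ x : ℝ≥0∞)⁻¹ * (K * σ x) := by gcongr; exact h I x hxI
      _ = K := by
        rw [mul_left_comm, ENNReal.inv_mul_cancel (h0 x) ENNReal.coe_ne_top, mul_one]
  rw [setLAverage_eq]
  refine ENNReal.div_le_of_le_mul ?_
  rw [← setLIntegral_const]
  exact setLIntegral_mono' I.measurableSet hx

/-- By Parseval the Haar energy of `J` is the variance of the averages over its children, so it is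
at least the deviation of a single child. The bound is independent of the Haar system chosen. -/
theorem IsHaarSystem.le_haarSq {D : Set (Cube d)}
    {h : Cube d → Fin (2 ^ d - 1) → (Fin d → ℝ) → ℂ} [NeZero d] (hh : IsHaarSystem D h)
    (hD : IsDyadicGrid D) {J : Cube d} (hJ : J ∈ D) {g : (Fin d → ℝ) → ℝ}
    (hg : IntegrableOn g J.toSet) {v : EuclideanSpace ℂ (Fin n)} (hv : ‖v‖ = 1)
    {ε : Fin d → Bool} {α β : ℝ} (hα : ∫ x in (J.child ε).toSet, g x = α * (J.side / 2) ^ d)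
    (hβ : ∫ x in J.toSet, g x = β * J.side ^ d) :
    ENNReal.ofReal ((α - β) ^ 2 / 2 ^ d) ≤ haarSq h (fun x => g x • v) J := by
  have hs := J.side_pos
  have hP := hh.parseval hD hJ (v := fun x => g x • v) (hg.smul_const v)
  simp only [integral_smul_const, norm_smul, hv, mul_one, Real.norm_eq_abs, sq_abs] at hP
  set V : ℝ := (J.side / 2) ^ d with hV
  have hV0 : 0 < V := by positivity
  have hJV : J.side ^ d = 2 ^ d * V := by
    rw [hV, ← mul_pow]
    congr 1
    ring
  set T : ℝ := ∑ κ, ‖haarCoeff h (fun x => g x • v) J κ‖ ^ 2 with hT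
  have hsum := J.integral_children hg
  set s : ℝ := ∫ x in J.toSet, g x with hsdef
  set a : (Fin d → Bool) → ℝ := fun ε => ∫ x in (J.child ε).toSet, g x with ha
  have h2 : (2 : ℝ) ^ d ≠ 0 := by positivity
  have hvar : ∑ ε, (a ε - s / 2 ^ d) ^ 2 = ∑ ε, a ε ^ 2 - s ^ 2 / 2 ^ d := by
    simp only [sub_sq, Finset.sum_add_distrib, Finset.sum_sub_distrib, ← Finset.sum_mul,
      ← Finset.mul_sum, ← hsum]
    simp only [Finset.sum_const, Finset.card_univ, Fintype.card_pi, Fintype.card_bool,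
      Finset.prod_const, Fintype.card_fin, nsmul_eq_mul]
    push_cast
    field_simp
    ring
  have hle : (a ε - s / 2 ^ d) ^ 2 ≤ T * V := by
    have h3 := Finset.single_le_sum (f := fun ε => (a ε - s / 2 ^ d) ^ 2)
      (fun _ _ => sq_nonneg _) (Finset.mem_univ ε)
    rw [hvar] at h3
    linarith
  have haε : a ε = α * V := hα
  have hdiff : a ε - s / 2 ^ d = (α - β) * V := by
    rw [haε, hβ, hJV]
    field_simp
  rw [hdiff, mul_pow, sq V, ← mul_assoc] at hle
  have hle' := le_of_mul_le_mul_right hle hV0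
  have hvol : volume J.toSet = ENNReal.ofReal (2 ^ d * V) := by
    rw [Cube.volume_toSet, ← ENNReal.ofReal_pow hs.le, hJV]
  rw [haarSq, hvol]
  simp only [enorm_sq_eq_ofReal]
  rw [← ENNReal.ofReal_sum_of_nonneg fun _ _ => by positivity,
    ← ENNReal.ofReal_div_of_pos (by positivity)]
  refine ENNReal.ofReal_le_ofReal ?_
  rw [div_le_div_iff₀ (by positivity) (by positivity)]
  calc (α - β) ^ 2 * (2 ^ d * V) = (α - β) ^ 2 * V * 2 ^ d := by ring
    _ ≤ T * 2 ^ d := by gcongr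

end

end MatrixSquare

end

noncomputable section

namespace MatrixSquare

/-! ### The extremal weight -/

section

variable {d : ℕ} (x₀ : Fin d → ℝ)

/-- The cubes of side `2 ^ (-i)` with corner `x₀`. -/
def cornerCube (i : ℕ) : Cube d := ⟨x₀, (1 / 2) ^ i, by positivity⟩

/-- The cubes of side `2 ^ (1 - i)` with centre `x₀`. -/
def centredCube (i : ℕ) : Cube d := ⟨fun k => x₀ k - (1 / 2) ^ i, 2 * (1 / 2) ^ i, by positivity⟩

/-- A truncation of the critical power weight `|x - x₀|^{-d}`. -/
def truncatedPowerWeight (m : ℕ) (x : Fin d → ℝ) : ℝ≥0 :=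
  1 + ∑ i ∈ Finset.range (2 * m), (centredCube x₀ i).toSet.indicator (fun _ => (2 ^ d) ^ i) x

variable {x₀} {m : ℕ}

theorem mem_cornerCube {i : ℕ} {x : Fin d → ℝ} :
    x ∈ (cornerCube x₀ i).toSet ↔ ∀ k, x₀ k ≤ x k ∧ x k < x₀ k + (1 / 2) ^ i :=
  Cube.mem_toSet

theorem mem_centredCube {i : ℕ} {x : Fin d → ℝ} :
    x ∈ (centredCube x₀ i).toSet ↔ ∀ k, x₀ k - (1 / 2) ^ i ≤ x k ∧ x k < x₀ k + (1 / 2) ^ i := by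
  rw [Cube.mem_toSet]
  refine forall_congr' fun k => and_congr Iff.rfl ?_
  rw [show (centredCube x₀ i).corner k + (centredCube x₀ i).side = x₀ k + (1 / 2) ^ i by
    simp only [centredCube]; ring]

theorem half_pow_le {i j : ℕ} (h : i ≤ j) : (1 / 2 : ℝ) ^ j ≤ (1 / 2) ^ i :=
  pow_le_pow_of_le_one (by norm_num) (by norm_num) h

theorem centredCube_anti {i j : ℕ} (h : i ≤ j) :
    (centredCube x₀ j).toSet ⊆ (centredCube x₀ i).toSet := fun x hx => by
  rw [mem_centredCube] at hx ⊢
  have := half_pow_le h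
  exact fun k => ⟨by linarith [(hx k).1], by linarith [(hx k).2]⟩

theorem cornerCube_anti {i j : ℕ} (h : i ≤ j) :
    (cornerCube x₀ j).toSet ⊆ (cornerCube x₀ i).toSet := fun x hx => by
  rw [mem_cornerCube] at hx ⊢
  have := half_pow_le h
  exact fun k => ⟨by linarith [(hx k).1], by linarith [(hx k).2]⟩

/-- The layers must be centred at `x₀` for the `A_1` condition over all cubes, but the cubes of the
grid have `x₀` as a corner. The nested intersections make averages over them exactly computable. -/
theorem centredCube_inter_cornerCube (i k : ℕ) :
    (centredCube x₀ k).toSet ∩ (cornerCube x₀ i).toSet = (cornerCube x₀ (max i k)).toSet := by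
  refine Set.Subset.antisymm (fun x hx => ?_) (Set.subset_inter (fun x hx => ?_)
    (cornerCube_anti (le_max_left i k)))
  · obtain ⟨h1, h2⟩ := hx
    rcases le_total i k with h | h
    · rw [max_eq_right h, mem_cornerCube]
      exact fun l => ⟨(mem_cornerCube.1 h2 l).1, (mem_centredCube.1 h1 l).2⟩
    · rwa [max_eq_left h]
  · have h1 := mem_cornerCube.1 (cornerCube_anti (le_max_right i k) hx)
    rw [mem_centredCube]
    have : (0 : ℝ) < (1 / 2) ^ k := by positivity
    exact fun l => ⟨by linarith [(h1 l).1], (h1 l).2⟩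

theorem volume_cornerCube (i : ℕ) : volume (cornerCube x₀ i).toSet = ((2 ^ d) ^ i)⁻¹ := by
  rw [Cube.volume_toSet, ← ENNReal.ofReal_pow (cornerCube x₀ i).side_pos.le]
  have : (cornerCube x₀ i).side ^ d = (((2 : ℝ) ^ d) ^ i)⁻¹ := by
    simp only [cornerCube]
    rw [one_div, inv_pow, inv_pow, ← pow_mul, ← pow_mul, mul_comm]
  rw [this, ENNReal.ofReal_inv_of_pos (by positivity), ENNReal.ofReal_pow (by positivity),
    ENNReal.ofReal_pow (by positivity)]
  simp

theorem volume_centredCube (i : ℕ) :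
    volume (centredCube x₀ i).toSet = ENNReal.ofReal (2 ^ d / (2 ^ d) ^ i) := by
  rw [Cube.volume_toSet, ← ENNReal.ofReal_pow (centredCube x₀ i).side_pos.le]
  congr 1
  simp only [centredCube]
  rw [mul_pow, one_div, inv_pow, inv_pow, ← pow_mul, ← pow_mul, mul_comm i, div_eq_mul_inv]

theorem measurable_truncatedPowerWeight : Measurable (truncatedPowerWeight x₀ m) :=
  measurable_const.add (Finset.measurable_fun_sum _ fun i _ =>
    measurable_const.indicator (centredCube x₀ i).measurableSet)

theorem one_le_truncatedPowerWeight (x : Fin d → ℝ) : 1 ≤ truncatedPowerWeight x₀ m x :=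
  le_self_add

theorem truncatedPowerWeight_pos (x : Fin d → ℝ) : 0 < truncatedPowerWeight x₀ m x :=
  one_pos.trans_le (one_le_truncatedPowerWeight x)

theorem pow_le_truncatedPowerWeight {i : ℕ} (hi : i < 2 * m) {x : Fin d → ℝ}
    (hx : x ∈ (centredCube x₀ i).toSet) : (2 ^ d) ^ i ≤ truncatedPowerWeight x₀ m x := by
  have h1 := Finset.single_le_sum (f := fun i => (centredCube x₀ i).toSet.indicator
    (fun _ => ((2 : ℝ≥0) ^ d) ^ i) x) (fun _ _ => zero_le) (Finset.mem_range.2 hi)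
  simp only [Set.indicator_of_mem hx] at h1
  exact h1.trans le_add_self

/-- A cube no larger than half the layer that meets it stays in the next larger layer, so the weight
on it drops by at most one factor `2 ^ d`. -/
theorem pow_le_of_inter {i : ℕ} (hi : i < 2 * m) {I : Cube d} (hI : I.side ≤ (1 / 2) ^ i)
    {x y : Fin d → ℝ} (hx : x ∈ I.toSet) (hy : y ∈ I.toSet) (hyi : y ∈ (centredCube x₀ i).toSet) :
    (2 ^ d) ^ i ≤ 2 ^ d * truncatedPowerWeight x₀ m x := by
  cases i with
  | zero =>
    rw [pow_zero]
    exact one_le_mul (one_le_pow₀ one_le_two) (one_le_truncatedPowerWeight x)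
  | succ i =>
    rw [pow_succ']
    gcongr
    refine pow_le_truncatedPowerWeight (by omega) ?_
    rw [Cube.mem_toSet] at hx hy
    rw [mem_centredCube] at hyi ⊢
    intro k
    have h1 : (1 / 2 : ℝ) ^ i = 2 * (1 / 2) ^ (i + 1) := by rw [pow_succ]; ring
    have h2 := hx k
    have h3 := hy k
    have h4 := hyi k
    constructor <;> linarith

/-- Each layer has total mass `2 ^ d` and satisfies the `A_1` bound against the full weight. A small
cube is handled by its height; a cube larger than `2 ^ (-i)` compares this mass with the weight at
the scale `j ≤ i` of its own side, or with the constant `1` if its side is at least `1`. -/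
theorem pow_mul_volume_inter_le {i : ℕ} (hi : i < 2 * m) {I : Cube d} {x : Fin d → ℝ}
    (hx : x ∈ I.toSet) :
    (2 ^ d) ^ i * volume ((centredCube x₀ i).toSet ∩ I.toSet) ≤
      8 ^ d * truncatedPowerWeight x₀ m x * volume I.toSet := by
  have hs := I.side_pos
  set σ := truncatedPowerWeight x₀ m x with hσ
  have hσ1 : (1 : ℝ) ≤ σ := by exact_mod_cast one_le_truncatedPowerWeight x
  rcases ((centredCube x₀ i).toSet ∩ I.toSet).eq_empty_or_nonempty with h | ⟨y, hyi, hyI⟩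
  · simp [h]
  have h28 : (2 : ℝ≥0∞) ^ d ≤ 8 ^ d := by gcongr; norm_num
  rcases le_or_gt I.side ((1 / 2) ^ i) with hle | hlt
  · have h1 : ((2 : ℝ≥0∞) ^ d) ^ i ≤ 2 ^ d * σ := by
      exact_mod_cast pow_le_of_inter (m := m) hi hle hx hyI hyi
    exact mul_le_mul' (h1.trans (by gcongr)) (measure_mono Set.inter_subset_right)
  have hreal : (2 : ℝ) ^ d ≤ 8 ^ d * σ * I.side ^ d := by
    have h28' : (2 : ℝ) ^ d ≤ 8 ^ d := by gcongr; norm_num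
    rcases le_or_gt 1 I.side with h1 | h1
    · calc (2 : ℝ) ^ d ≤ 8 ^ d := h28'
        _ ≤ 8 ^ d * σ := le_mul_of_one_le_right (by positivity) hσ1
        _ ≤ _ := le_mul_of_one_le_right (by positivity) (one_le_pow₀ h1)
    · obtain ⟨j, hj1, hj2⟩ := exists_nat_pow_near_of_lt_one hs h1.le
        (by norm_num : (0 : ℝ) < 1 / 2) (by norm_num)
      have hji : j ≤ i := by
        by_contra! hij
        exact absurd (hlt.trans_le hj2) (half_pow_le hij.le).not_gt
      have h2 : ((2 : ℝ) ^ d) ^ j ≤ 2 ^ d * σ := by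
        exact_mod_cast pow_le_of_inter (m := m) (hji.trans_lt hi) hj2 hx hyI
          (centredCube_anti hji hyi)
      have h3 : ((2 : ℝ) ^ d) ^ j * (2 ^ d * I.side ^ d) ≥ 1 := by
        have h4 : ((1 / 2 : ℝ) ^ (j + 1)) ^ d ≤ I.side ^ d := by gcongr
        calc (1 : ℝ) = ((2 : ℝ) ^ d) ^ j * (2 ^ d * ((1 / 2 : ℝ) ^ (j + 1)) ^ d) := by
              rw [← mul_assoc, ← pow_succ, ← pow_mul, ← pow_mul, mul_comm (j + 1) d, ← mul_pow]
              norm_num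
          _ ≤ _ := by gcongr
      have h8 : (8 : ℝ) ^ d = 2 ^ d * 2 ^ d * 2 ^ d := by rw [← mul_pow, ← mul_pow]; norm_num
      calc (2 : ℝ) ^ d = 2 ^ d * 1 := by ring
        _ ≤ 2 ^ d * (((2 : ℝ) ^ d) ^ j * (2 ^ d * I.side ^ d)) := by gcongr
        _ ≤ 2 ^ d * ((2 ^ d * σ) * (2 ^ d * I.side ^ d)) := by gcongr
        _ = _ := by rw [h8]; ring
  calc (2 ^ d) ^ i * volume ((centredCube x₀ i).toSet ∩ I.toSet)
      ≤ (2 ^ d) ^ i * volume (centredCube x₀ i).toSet := by gcongr; exact Set.inter_subset_left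
    _ = ENNReal.ofReal (2 ^ d) := by
        rw [volume_centredCube, show ((2 : ℝ≥0∞) ^ d) ^ i = ENNReal.ofReal ((2 ^ d) ^ i) by
          rw [ENNReal.ofReal_pow (by positivity), ENNReal.ofReal_pow (by positivity)]; simp,
          ← ENNReal.ofReal_mul (by positivity)]
        congr 1
        field_simp
    _ ≤ ENNReal.ofReal (8 ^ d * σ * I.side ^ d) := ENNReal.ofReal_le_ofReal hreal
    _ = _ := by
        rw [ENNReal.ofReal_mul (by positivity), ENNReal.ofReal_mul (by positivity),
          ENNReal.ofReal_pow (by positivity), ENNReal.ofReal_pow hs.le, ENNReal.ofReal_coe_nnreal,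
          Cube.volume_toSet]
        simp

theorem coe_truncatedPowerWeight (x : Fin d → ℝ) : (truncatedPowerWeight x₀ m x : ℝ≥0∞) =
    1 + ∑ i ∈ Finset.range (2 * m), (centredCube x₀ i).toSet.indicator (fun _ => (2 ^ d) ^ i) x := by
  rw [truncatedPowerWeight, ENNReal.coe_add, ENNReal.coe_one, ENNReal.ofNNReal_finsetSum]
  congr 1
  refine Finset.sum_congr rfl fun i _ => ?_
  rw [ENNReal.coe_indicator]
  simp

theorem setLIntegral_truncatedPowerWeight {s : Set (Fin d → ℝ)} :
    ∫⁻ x in s, (truncatedPowerWeight x₀ m x : ℝ≥0∞) =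
      volume s + ∑ i ∈ Finset.range (2 * m),
        (2 ^ d) ^ i * volume ((centredCube x₀ i).toSet ∩ s) := by
  simp only [coe_truncatedPowerWeight]
  rw [lintegral_add_left measurable_const, setLIntegral_const, one_mul, lintegral_finsetSum _
    fun i _ => measurable_const.indicator (centredCube x₀ i).measurableSet]
  congr 1
  refine Finset.sum_congr rfl fun i _ => ?_
  rw [lintegral_indicator_const (centredCube x₀ i).measurableSet,
    Measure.restrict_apply (centredCube x₀ i).measurableSet]

/-- Each of the `2 * m` layers costs `8 ^ d`, and the constant term is absorbed since `m ≥ 1`. -/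
theorem avg_truncatedPowerWeight_le (hm : 1 ≤ m) (I : Cube d) {x : Fin d → ℝ} (hx : x ∈ I.toSet) :
    I.avg (fun y => (truncatedPowerWeight x₀ m y : ℝ≥0∞)) ≤
      (3 * m * 8 ^ d) * truncatedPowerWeight x₀ m x := by
  rw [Cube.avg, setLAverage_eq]
  refine ENNReal.div_le_of_le_mul ?_
  rw [setLIntegral_truncatedPowerWeight]
  have hσ1 : (1 : ℝ≥0∞) ≤ truncatedPowerWeight x₀ m x := by
    exact_mod_cast one_le_truncatedPowerWeight x
  have hm' : (1 : ℝ≥0∞) ≤ m := by exact_mod_cast hm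
  have h8 : (1 : ℝ≥0∞) ≤ 8 ^ d := one_le_pow₀ (by norm_num)
  calc _ ≤ volume I.toSet + ∑ i ∈ Finset.range (2 * m),
        8 ^ d * truncatedPowerWeight x₀ m x * volume I.toSet := by
        refine add_le_add_right (Finset.sum_le_sum fun i hi => ?_) _
        exact pow_mul_volume_inter_le (Finset.mem_range.1 hi) hx
    _ ≤ m * (8 ^ d * truncatedPowerWeight x₀ m x * volume I.toSet) +
        2 * m * (8 ^ d * truncatedPowerWeight x₀ m x * volume I.toSet) := by
        rw [Finset.sum_const, Finset.card_range, nsmul_eq_mul]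
        push_cast
        gcongr
        calc volume I.toSet = 1 * (1 * 1 * volume I.toSet) := by simp
          _ ≤ _ := by gcongr
    _ = _ := by ring

/-- The averages of the extremal weight over the cubes `cornerCube x₀ i`. -/
def cornerAvg (d m i : ℕ) : ℕ := 1 + ∑ k ∈ Finset.range (2 * m), (2 ^ d) ^ min i k

theorem setLIntegral_cornerCube (i : ℕ) :
    ∫⁻ x in (cornerCube x₀ i).toSet, (truncatedPowerWeight x₀ m x : ℝ≥0∞) =
      cornerAvg d m i * volume (cornerCube x₀ i).toSet := by
  rw [setLIntegral_truncatedPowerWeight, cornerAvg]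
  push_cast
  rw [add_mul, one_mul, Finset.sum_mul]
  congr 1
  refine Finset.sum_congr rfl fun k _ => ?_
  rw [centredCube_inter_cornerCube, volume_cornerCube, volume_cornerCube]
  have h0 : ∀ j, ((2 : ℝ≥0∞) ^ d) ^ j ≠ 0 := fun j => by simp
  have ht : ∀ j, ((2 : ℝ≥0∞) ^ d) ^ j ≠ ∞ := fun j => by finiteness
  rcases le_total i k with h | h
  · rw [max_eq_right h, min_eq_left h, ENNReal.mul_inv_cancel (h0 k) (ht k),
      ENNReal.mul_inv_cancel (h0 i) (ht i)]
  · rw [max_eq_left h, min_eq_right h]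

theorem cornerAvg_zero (d m : ℕ) : cornerAvg d m 0 = 1 + 2 * m := by
  simp [cornerAvg]

/-- The layers `m ≤ k < 2 * m` lie deeper than scale `i < m`, and each contributes `(2 ^ d) ^ i`.
This is why there are `2 * m` layers while only the first `m` scales are used. -/
theorem mul_pow_le_cornerAvg (d : ℕ) {m i : ℕ} (hi : i < m) :
    m * (2 ^ d) ^ i ≤ cornerAvg d m i := by
  have h1 : ∑ k ∈ Finset.Ico m (2 * m), (2 ^ d) ^ min i k ≤
      ∑ k ∈ Finset.range (2 * m), (2 ^ d) ^ min i k :=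
    Finset.sum_le_sum_of_subset fun k hk => by
      rw [Finset.mem_Ico] at hk
      exact Finset.mem_range.2 hk.2
  have h2 : ∑ k ∈ Finset.Ico m (2 * m), (2 ^ d) ^ min i k = m * (2 ^ d) ^ i := by
    rw [Finset.sum_congr rfl fun k hk => by
      rw [min_eq_left (hi.le.trans (Finset.mem_Ico.1 hk).1)]]
    rw [Finset.sum_const, Nat.card_Ico, smul_eq_mul]
    congr 1
    omega
  rw [cornerAvg]
  omega

theorem two_le_two_pow [NeZero d] : 2 ≤ 2 ^ d :=
  Nat.le_self_pow (NeZero.ne d) 2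

/-- The deep layers gain a factor `2 ^ d ≥ 2` from one scale to the next. This difference of
averages becomes the Haar energy of the test function. -/
theorem cornerAvg_add_le [NeZero d] {m i : ℕ} (hi : i < m) :
    cornerAvg d m i + m * (2 ^ d) ^ i ≤ cornerAvg d m (i + 1) := by
  have h1 : ∑ k ∈ Finset.range (2 * m), (2 ^ d) ^ min i k +
      ∑ k ∈ Finset.range (2 * m), (if m ≤ k then (2 ^ d) ^ i else 0) ≤
      ∑ k ∈ Finset.range (2 * m), (2 ^ d) ^ min (i + 1) k := by
    rw [← Finset.sum_add_distrib]
    refine Finset.sum_le_sum fun k _ => ?_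
    split_ifs with h
    · rw [min_eq_left (by omega), min_eq_left (by omega), pow_succ]
      have := two_le_two_pow (d := d)
      nlinarith [Nat.zero_le ((2 ^ d) ^ i)]
    · exact Nat.pow_le_pow_right (by positivity) (by omega)
  have h2 : ∑ k ∈ Finset.range (2 * m), (if m ≤ k then (2 ^ d) ^ i else 0) = m * (2 ^ d) ^ i := by
    rw [← Finset.sum_filter, Finset.sum_const, smul_eq_mul]
    congr 1
    have : (Finset.range (2 * m)).filter (m ≤ ·) = Finset.Ico m (2 * m) := by
      ext k; simp; omega
    rw [this, Nat.card_Ico]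
    omega
  rw [h2] at h1
  rw [cornerAvg, cornerAvg]
  omega

/-- On the ring at scale `i` only the layers up to `i` are present, and their heights form a
geometric sum. -/
theorem truncatedPowerWeight_le [NeZero d] {i : ℕ} {x : Fin d → ℝ}
    (hx : x ∈ (cornerCube x₀ i).toSet \ (cornerCube x₀ (i + 1)).toSet) :
    truncatedPowerWeight x₀ m x ≤ 3 * (2 ^ d) ^ i := by
  have h2 : (2 : ℝ≥0) ≤ 2 ^ d := by exact_mod_cast two_le_two_pow (d := d)
  have hgeom : ∀ i : ℕ, ∑ k ∈ Finset.range (i + 1), ((2 : ℝ≥0) ^ d) ^ k ≤ 2 * (2 ^ d) ^ i := by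
    intro i
    induction i with
    | zero => simp
    | succ i ih =>
      rw [Finset.sum_range_succ]
      calc _ ≤ 2 * (2 ^ d) ^ i + ((2 : ℝ≥0) ^ d) ^ (i + 1) := by gcongr
        _ ≤ ((2 : ℝ≥0) ^ d) ^ (i + 1) + ((2 : ℝ≥0) ^ d) ^ (i + 1) := by
          gcongr
          rw [pow_succ']
          gcongr
        _ = _ := by ring
  have hsum : ∑ k ∈ Finset.range (2 * m), (centredCube x₀ k).toSet.indicator
      (fun _ => ((2 : ℝ≥0) ^ d) ^ k) x ≤ ∑ k ∈ Finset.range (i + 1), ((2 : ℝ≥0) ^ d) ^ k := by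
    refine (Finset.sum_le_sum_of_ne_zero (t := Finset.range (i + 1)) fun k _ hk => ?_).trans
      (Finset.sum_le_sum fun k _ => Set.indicator_le_self _ _ x)
    rw [Finset.mem_range]
    by_contra! hik
    have hxk := Set.mem_of_indicator_ne_zero hk
    have h3 : x ∈ (cornerCube x₀ (max i k)).toSet :=
      (centredCube_inter_cornerCube i k).subset ⟨hxk, hx.1⟩
    exact hx.2 (cornerCube_anti (by omega) h3)
  have h1 : (1 : ℝ≥0) ≤ (2 ^ d) ^ i := one_le_pow₀ (one_le_two.trans h2)
  calc truncatedPowerWeight x₀ m x ≤ (2 ^ d) ^ i + 2 * (2 ^ d) ^ i :=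
        add_le_add h1 (hsum.trans (hgeom i))
    _ = _ := by ring

/-- Each ring fills at least half of its corner cube, so a function of size `c * (2 ^ d) ^ i` on the
`i`-th ring gains `c / 2` from each of the `m` disjoint rings. -/
theorem le_setLIntegral_cornerCube [NeZero d] {F : (Fin d → ℝ) → ℝ≥0∞} {c : ℝ≥0∞}
    (hF : ∀ i < m, ∀ x ∈ (cornerCube x₀ i).toSet \ (cornerCube x₀ (i + 1)).toSet,
      c * (2 ^ d) ^ i ≤ F x) :
    m * (c / 2) ≤ ∫⁻ x in (cornerCube x₀ 0).toSet, F x := by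
  set R : ℕ → Set (Fin d → ℝ) := fun i =>
    (cornerCube x₀ i).toSet \ (cornerCube x₀ (i + 1)).toSet with hR
  have hRm : ∀ i, MeasurableSet (R i) := fun i =>
    (cornerCube x₀ i).measurableSet.diff (cornerCube x₀ (i + 1)).measurableSet
  have hdisj : (Finset.range m : Set ℕ).PairwiseDisjoint R := by
    have key : ∀ i j, i < j → Disjoint (R i) (R j) := fun i j hij =>
      Set.disjoint_left.2 fun x hxi hxj => hxi.2 (cornerCube_anti hij hxj.1)
    intro i _ j _ hij
    rcases lt_or_gt_of_ne hij with h | h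
    · exact key i j h
    · exact (key j i h).symm
  have hvol : ∀ i, 1 / 2 ≤ (2 ^ d) ^ i * volume (R i) := by
    intro i
    have h0 : ∀ j, ((2 : ℝ≥0∞) ^ d) ^ j ≠ 0 := fun j => by simp
    have ht : ∀ j, ((2 : ℝ≥0∞) ^ d) ^ j ≠ ∞ := fun j => by finiteness
    have h1 : volume (cornerCube x₀ i).toSet ≤
        volume (R i) + volume (cornerCube x₀ (i + 1)).toSet := by
      refine (measure_mono ?_).trans (measure_union_le _ _)
      intro x hx
      by_cases hx' : x ∈ (cornerCube x₀ (i + 1)).toSet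
      · exact Or.inr hx'
      · exact Or.inl ⟨hx, hx'⟩
    have h2 := mul_le_mul_right h1 (((2 : ℝ≥0∞) ^ d) ^ i)
    rw [mul_add, volume_cornerCube, volume_cornerCube, ENNReal.mul_inv_cancel (h0 i) (ht i),
      pow_succ, ENNReal.mul_inv (Or.inl (h0 i)) (Or.inl (ht i)), ← mul_assoc,
      ENNReal.mul_inv_cancel (h0 i) (ht i), one_mul] at h2
    have h3 : ((2 : ℝ≥0∞) ^ d)⁻¹ ≤ 1 / 2 := by
      rw [one_div]
      exact ENNReal.inv_le_inv.2 (by exact_mod_cast two_le_two_pow (d := d))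
    have h4 : (1 / 2 : ℝ≥0∞) + 1 / 2 ≤ (2 ^ d) ^ i * volume (R i) + 1 / 2 := by
      rw [ENNReal.add_halves]
      exact h2.trans (by gcongr)
    exact (ENNReal.add_le_add_iff_right (by finiteness)).1 h4
  calc m * (c / 2) = ∑ i ∈ Finset.range m, c * (1 / 2) := by
        rw [Finset.sum_const, Finset.card_range, nsmul_eq_mul, mul_one_div]
    _ ≤ ∑ i ∈ Finset.range m, ∫⁻ x in R i, F x := by
        refine Finset.sum_le_sum fun i hi => ?_
        calc c * (1 / 2) ≤ c * ((2 ^ d) ^ i * volume (R i)) := by gcongr; exact hvol i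
          _ = ∫⁻ x in R i, c * (2 ^ d) ^ i := by rw [setLIntegral_const, mul_assoc]
          _ ≤ _ := setLIntegral_mono' (hRm i) (hF i (Finset.mem_range.1 hi))
    _ = ∫⁻ x in ⋃ i ∈ Finset.range m, R i, F x :=
        (lintegral_biUnion_finset hdisj (fun i _ => hRm i) F).symm
    _ ≤ _ := by
        refine lintegral_mono_set (Set.iUnion₂_subset fun i _ => ?_)
        exact Set.sdiff_subset.trans (cornerCube_anti (Nat.zero_le i))

/-- On the `i`-th ring the maximal function is at least `m * (2 ^ d) ^ i`, so it integrates to at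
least `m² / 2`, against a mass `1 + 2 * m ≤ 3 * m`. -/
theorem le_aInftyChar_truncatedPowerWeight [NeZero d] (hm : 1 ≤ m) :
    (m : ℝ≥0∞) / 6 ≤ aInftyChar fun x => (truncatedPowerWeight x₀ m x : ℝ≥0∞) := by
  set w : (Fin d → ℝ) → ℝ≥0∞ := fun x => (truncatedPowerWeight x₀ m x : ℝ≥0∞) with hw
  have hvol : volume (cornerCube x₀ 0).toSet = 1 := by simp [volume_cornerCube]
  have hint : ∫⁻ x in (cornerCube x₀ 0).toSet, w x = 1 + 2 * m := by
    rw [hw, setLIntegral_cornerCube, hvol, cornerAvg_zero]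
    push_cast
    ring
  refine le_trans ?_ (le_iSup (f := fun Q : Cube d => if ∫⁻ x in Q.toSet, w x = ∞ then ∞
    else (∫⁻ x in Q.toSet, maximalFn (Q.toSet.indicator w) x) / ∫⁻ x in Q.toSet, w x)
    (cornerCube x₀ 0))
  have hfin : (1 : ℝ≥0∞) + 2 * m ≠ ∞ := by
    have := ENNReal.natCast_ne_top m
    finiteness
  simp only [hint, if_neg hfin]
  rw [ENNReal.le_div_iff_mul_le (Or.inl (by simp)) (Or.inl hfin)]
  have h1 : (m : ℝ≥0∞) * (m / 2) ≤
      ∫⁻ x in (cornerCube x₀ 0).toSet, maximalFn ((cornerCube x₀ 0).toSet.indicator w) x := by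
    refine le_setLIntegral_cornerCube fun i hi x hx => ?_
    have h2 : (cornerCube x₀ i).avg ((cornerCube x₀ 0).toSet.indicator w) = cornerAvg d m i := by
      have h3 : ∫⁻ y in (cornerCube x₀ i).toSet, (cornerCube x₀ 0).toSet.indicator w y =
          cornerAvg d m i * volume (cornerCube x₀ i).toSet := by
        rw [← setLIntegral_cornerCube]
        refine setLIntegral_congr_fun (cornerCube x₀ i).measurableSet fun y hy => ?_
        rw [Set.indicator_of_mem (cornerCube_anti (Nat.zero_le i) hy)]
      rw [Cube.avg, setLAverage_eq, h3, ENNReal.mul_div_cancel_right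
        (cornerCube x₀ i).volume_ne_zero (cornerCube x₀ i).volume_ne_top]
    refine le_trans ?_ (le_iSup₂ (f := fun (Q : Cube d) (_ : x ∈ Q.toSet) =>
      Q.avg ((cornerCube x₀ 0).toSet.indicator w)) (cornerCube x₀ i) hx.1)
    rw [h2]
    exact_mod_cast mul_pow_le_cornerAvg d hi
  refine le_trans ?_ h1
  have hm' : (1 : ℝ≥0∞) ≤ m := by exact_mod_cast hm
  calc (m : ℝ≥0∞) / 6 * (1 + 2 * m) ≤ m / 6 * (m + 2 * m) := by gcongr
    _ = m * (m * (3 / 6)) := by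
        rw [ENNReal.div_eq_inv_mul, ENNReal.div_eq_inv_mul]; ring
    _ = _ := by
        rw [show (3 : ℝ≥0∞) / 6 = 2⁻¹ by
          rw [show (6 : ℝ≥0∞) = 3 * 2 by norm_num, ENNReal.div_eq_inv_mul,
            ENNReal.mul_inv (by simp) (by simp), mul_right_comm,
            ENNReal.inv_mul_cancel (by simp) (by simp), one_mul], ← div_eq_mul_inv]

end

end MatrixSquare

end

noncomputable section

namespace MatrixSquare

/-! ### Sharpness -/

section

variable {d n : ℕ} {p : ℝ} {x₀ : Fin d → ℝ} {m : ℕ}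

theorem child_cornerCube (i : ℕ) :
    (cornerCube x₀ i).child (fun _ => false) = cornerCube x₀ (i + 1) :=
  Cube.ext' (by simp [cornerCube, Cube.child])
    (by simp only [cornerCube, Cube.child]; rw [pow_succ]; ring)

/-- The singularity is put at the corner of a unit cube of the given grid; the lowest children then
descend to it. -/
theorem IsDyadicGrid.exists_cornerCube_mem [NeZero d] {D : Set (Cube d)} (hD : IsDyadicGrid D) :
    ∃ x₀ : Fin d → ℝ, ∀ i, cornerCube x₀ i ∈ D := by
  obtain ⟨Q, ⟨hQ, hside, -⟩, -⟩ := hD.partition 0 0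
  refine ⟨Q.corner, fun i => ?_⟩
  induction i with
  | zero =>
    have : cornerCube Q.corner 0 = Q := Cube.ext' rfl (by simp [cornerCube, hside])
    rwa [this]
  | succ i ih =>
    rw [← child_cornerCube]
    exact hD.child_mem ih _

theorem integrableOn_truncatedPowerWeight (i : ℕ) :
    IntegrableOn (fun x => (truncatedPowerWeight x₀ m x : ℝ)) (cornerCube x₀ i).toSet := by
  refine ⟨(measurable_coe_nnreal_real.comp measurable_truncatedPowerWeight).aestronglyMeasurable, ?_⟩
  rw [HasFiniteIntegral]
  simp only [NNReal.enorm_eq]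
  rw [setLIntegral_cornerCube]
  exact ENNReal.mul_lt_top (ENNReal.natCast_ne_top _).lt_top
    (cornerCube x₀ i).volume_ne_top.lt_top

theorem integral_truncatedPowerWeight (i : ℕ) :
    ∫ x in (cornerCube x₀ i).toSet, (truncatedPowerWeight x₀ m x : ℝ) =
      cornerAvg d m i * (cornerCube x₀ i).side ^ d := by
  rw [integral_eq_lintegral_of_nonneg_ae (Filter.Eventually.of_forall fun x => NNReal.coe_nonneg _)
    (integrableOn_truncatedPowerWeight i).aestronglyMeasurable]
  simp only [ENNReal.ofReal_coe_nnreal]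
  rw [setLIntegral_cornerCube, ENNReal.toReal_mul, ENNReal.toReal_natCast, Cube.volume_toSet,
    ENNReal.toReal_pow, ENNReal.toReal_ofReal (cornerCube x₀ i).side_pos.le]

/-- The function which shows that the estimate for the extremal weight is sharp. -/
def testFn (x₀ : Fin d → ℝ) (m : ℕ) (v : EuclideanSpace ℂ (Fin n)) (x : Fin d → ℝ) :
    EuclideanSpace ℂ (Fin n) :=
  (cornerCube x₀ 0).toSet.indicator (fun x => (truncatedPowerWeight x₀ m x : ℝ)) x • v

theorem aestronglyMeasurable_testFn (v : EuclideanSpace ℂ (Fin n)) :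
    AEStronglyMeasurable (testFn x₀ m v) volume :=
  ((measurable_coe_nnreal_real.comp measurable_truncatedPowerWeight).indicator
    (cornerCube x₀ 0).measurableSet).aestronglyMeasurable.smul_const v

/-- The test function is `σ` itself on the unit cube, and `σ^{1-p} σ^p = σ`: its norm is the mass of
`σ`. -/
theorem lintegral_testFn (hp : 1 < p) {v : EuclideanSpace ℂ (Fin n)} (hv : ‖v‖ = 1) :
    ∫⁻ x, ‖op (matrixPow (scalarWeight n p (truncatedPowerWeight x₀ m) x) (1 / p))
      (testFn x₀ m v x)‖ₑ ^ p = 1 + 2 * m := by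
  have hp0 : 0 < p := by linarith
  have hv' : ‖v‖ₑ = 1 := by rw [← ofReal_norm, hv, ENNReal.ofReal_one]
  have h1 : ∀ x, ‖op (matrixPow (scalarWeight n p (truncatedPowerWeight x₀ m) x) (1 / p))
      (testFn x₀ m v x)‖ₑ ^ p = (cornerCube x₀ 0).toSet.indicator
        (fun x => (truncatedPowerWeight x₀ m x : ℝ≥0∞)) x := by
    intro x
    rw [enorm_op_scalarWeight truncatedPowerWeight_pos, testFn, enorm_smul, hv', mul_one]
    by_cases hx : x ∈ (cornerCube x₀ 0).toSet
    · simp only [Set.indicator_of_mem hx, NNReal.enorm_eq]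
      have h0 : (truncatedPowerWeight x₀ m x : ℝ≥0∞) ≠ 0 :=
        ENNReal.coe_ne_zero.2 (truncatedPowerWeight_pos x).ne'
      rw [ENNReal.mul_rpow_of_nonneg _ _ hp0.le, ← ENNReal.rpow_mul,
        ← ENNReal.rpow_add _ _ h0 ENNReal.coe_ne_top]
      conv_rhs => rw [← ENNReal.rpow_one (truncatedPowerWeight x₀ m x : ℝ≥0∞)]
      congr 1
      field_simp
      ring
    · simp only [Set.indicator_of_notMem hx, enorm_zero, mul_zero]
      exact ENNReal.zero_rpow_of_pos hp0
  simp only [h1]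
  rw [lintegral_indicator (cornerCube x₀ 0).measurableSet, setLIntegral_cornerCube,
    volume_cornerCube, cornerAvg_zero]
  simp

/-- The average over the next corner cube, a child, exceeds the average over the cube itself by at
least `m * (2 ^ d) ^ i`. -/
theorem le_haarSq_testFn [NeZero d] {D : Set (Cube d)} (hD : IsDyadicGrid D)
    {h : Cube d → Fin (2 ^ d - 1) → (Fin d → ℝ) → ℂ} (hh : IsHaarSystem D h)
    (hx₀ : ∀ i, cornerCube x₀ i ∈ D) {v : EuclideanSpace ℂ (Fin n)} (hv : ‖v‖ = 1) {i : ℕ}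
    (hi : i < m) :
    ((m : ℝ≥0∞) * (2 ^ d) ^ i) ^ 2 / 2 ^ d ≤ haarSq h (testFn x₀ m v) (cornerCube x₀ i) := by
  have hcongr : ∀ j, Set.EqOn ((cornerCube x₀ 0).toSet.indicator
      fun x => (truncatedPowerWeight x₀ m x : ℝ)) (fun x => (truncatedPowerWeight x₀ m x : ℝ))
      (cornerCube x₀ j).toSet := fun j x hx =>
    Set.indicator_of_mem (cornerCube_anti (Nat.zero_le j) hx) _
  have hint : ∀ j, ∫ x in (cornerCube x₀ j).toSet, (cornerCube x₀ 0).toSet.indicator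
      (fun x => (truncatedPowerWeight x₀ m x : ℝ)) x =
      cornerAvg d m j * (cornerCube x₀ j).side ^ d := fun j => by
    rw [← integral_truncatedPowerWeight]
    exact setIntegral_congr_fun (cornerCube x₀ j).measurableSet (hcongr j)
  have hα := hint (i + 1)
  rw [← child_cornerCube] at hα
  have := hh.le_haarSq hD (hx₀ i) ((integrableOn_truncatedPowerWeight (m := m) i).congr_fun
    (hcongr i).symm (cornerCube x₀ i).measurableSet) hv hα (hint i)
  refine le_trans ?_ this
  have h1 : (cornerAvg d m i : ℝ) + m * (2 ^ d) ^ i ≤ cornerAvg d m (i + 1) := by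
    exact_mod_cast cornerAvg_add_le (d := d) hi
  have h2 : ((m : ℝ≥0∞) * (2 ^ d) ^ i) ^ 2 / 2 ^ d =
      ENNReal.ofReal (((m : ℝ) * (2 ^ d) ^ i) ^ 2 / 2 ^ d) := by
    rw [ENNReal.ofReal_div_of_pos (by positivity), ENNReal.ofReal_pow (by positivity),
      ENNReal.ofReal_mul (by positivity), ENNReal.ofReal_pow (by positivity),
      ENNReal.ofReal_pow (by positivity)]
    simp
  rw [h2]
  refine ENNReal.ofReal_le_ofReal ?_
  gcongr
  linarith

/-- On the `i`-th ring `σ^{1-p}` is at least of order `2^{di(1-p)}` and the Haar term to the power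
`p / 2` at least of order `m^p 2^{dip}`. The product `m^p 2^{di}` gives the same contribution on
each of `m` rings, and dividing `m^{p+1}` by the mass of order `m` leaves `m^p`. -/
theorem le_squareFnNorm [NeZero d] (hn : 0 < n) (hp : 1 < p) (hm : 1 ≤ m) {D : Set (Cube d)}
    (hD : IsDyadicGrid D) {h : Cube d → Fin (2 ^ d - 1) → (Fin d → ℝ) → ℂ}
    (hh : IsHaarSystem D h) (hx₀ : ∀ i, cornerCube x₀ i ∈ D) :
    (m : ℝ≥0∞) * (3 ^ (1 - p) / (2 ^ d) ^ (p / 2) / 6) ^ (1 / p) ≤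
      squareFnNorm D h p (scalarWeight n p (truncatedPowerWeight x₀ m))
        (scalarWeight n p (truncatedPowerWeight x₀ m)) := by
  have hp0 : 0 < p := by linarith
  have hp2 : 0 ≤ p / 2 := by positivity
  have h1p : 0 ≤ 1 / p := by positivity
  have hmtop := ENNReal.natCast_ne_top m
  have hm0 : (m : ℝ≥0∞) ≠ 0 := by
    rw [Nat.cast_ne_zero]
    omega
  have hm1 : (1 : ℝ≥0∞) ≤ m := by exact_mod_cast hm
  set v : EuclideanSpace ℂ (Fin n) := EuclideanSpace.single ⟨0, hn⟩ 1 with hvdef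
  have hv : ‖v‖ = 1 := by simp [hvdef]
  set κ : ℝ≥0∞ := 3 ^ (1 - p) / (2 ^ d) ^ (p / 2) with hκ
  refine le_sInf fun B hB => ?_
  have hnorm := lintegral_testFn (x₀ := x₀) (m := m) hp hv
  have hB' := hB (testFn x₀ m v) (aestronglyMeasurable_testFn v) (by
    rw [weightedNorm, hnorm]
    finiteness)
  rw [weightedNorm, hnorm] at hB'
  have hlow : (m : ℝ≥0∞) * ((m : ℝ≥0∞) ^ p * κ / 2) ≤ ∫⁻ x, squareFn D h p
      (scalarWeight n p (truncatedPowerWeight x₀ m)) (testFn x₀ m v) x ^ p := by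
    refine (le_setLIntegral_cornerCube fun i hi x hx => ?_).trans
      (setLIntegral_le_lintegral (cornerCube x₀ 0).toSet _)
    refine le_trans ?_ (le_squareFn_scalarWeight truncatedPowerWeight_pos hp h _ (hx₀ i) hx.1)
    have ha0 : ((2 : ℝ≥0∞) ^ d) ^ i ≠ 0 := by simp
    have hat : ((2 : ℝ≥0∞) ^ d) ^ i ≠ ∞ := by finiteness
    have h1 : (3 * ((2 : ℝ≥0∞) ^ d) ^ i) ^ (1 - p) ≤
        (truncatedPowerWeight x₀ m x : ℝ≥0∞) ^ (1 - p) := by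
      rw [← neg_sub p 1, ENNReal.rpow_neg, ENNReal.rpow_neg]
      refine ENNReal.inv_le_inv.2 (ENNReal.rpow_le_rpow ?_ (by linarith))
      exact_mod_cast truncatedPowerWeight_le hx
    have h2 := ENNReal.rpow_le_rpow (le_haarSq_testFn hD hh hx₀ hv hi) hp2
    refine le_trans (le_of_eq ?_) (mul_le_mul' h1 h2)
    rw [ENNReal.div_rpow_of_nonneg _ _ hp2, ← ENNReal.rpow_two, ← ENNReal.rpow_mul,
      show (2 : ℝ) * (p / 2) = p by ring, ENNReal.mul_rpow_of_nonneg _ _ hp0.le,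
      ENNReal.mul_rpow_of_ne_top (by simp) hat, hκ]
    have h3 : (((2 : ℝ≥0∞) ^ d) ^ i) ^ (1 - p) * (((2 : ℝ≥0∞) ^ d) ^ i) ^ p = (2 ^ d) ^ i := by
      rw [← ENNReal.rpow_add _ _ ha0 hat]
      simp
    simp only [div_eq_mul_inv]
    calc _ = 3 ^ (1 - p) * (m : ℝ≥0∞) ^ p * (((2 : ℝ≥0∞) ^ d) ^ (p / 2))⁻¹ * (2 ^ d) ^ i := by
          simp only [div_eq_mul_inv]; ring
      _ = 3 ^ (1 - p) * (m : ℝ≥0∞) ^ p * (((2 : ℝ≥0∞) ^ d) ^ (p / 2))⁻¹ *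
          ((((2 : ℝ≥0∞) ^ d) ^ i) ^ (1 - p) * (((2 : ℝ≥0∞) ^ d) ^ i) ^ p) := by rw [h3]
      _ = _ := by simp only [div_eq_mul_inv]; ring
  have h4 : ((m : ℝ≥0∞) ^ p * (κ / 6) * (3 * m)) ^ (1 / p) ≤ B * (3 * m) ^ (1 / p) := by
    refine le_trans (ENNReal.rpow_le_rpow (le_trans (le_of_eq ?_) hlow) h1p) (hB'.trans ?_)
    · have h6 : (κ / 6) * 3 = κ / 2 := by
        rw [show (6 : ℝ≥0∞) = 2 * 3 by norm_num, div_eq_mul_inv,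
          ENNReal.mul_inv (by simp) (by simp), mul_assoc, mul_assoc,
          ENNReal.inv_mul_cancel (by simp) (by simp), mul_one, div_eq_mul_inv]
      rw [mul_div_assoc, ← h6]
      ring
    · gcongr
      calc (1 : ℝ≥0∞) + 2 * m ≤ m + 2 * m := by gcongr
        _ = _ := by ring
  rw [ENNReal.mul_rpow_of_nonneg _ _ h1p, ENNReal.mul_rpow_of_nonneg _ _ h1p, ← ENNReal.rpow_mul,
    mul_one_div_cancel hp0.ne', ENNReal.rpow_one] at h4
  refine (ENNReal.mul_le_mul_iff_left ?_ (by finiteness)).1 h4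
  rw [Ne, ENNReal.rpow_eq_zero_iff_of_pos (by positivity)]
  exact mul_ne_zero (by simp) hm0

theorem exists_le_squareFnNorm (d n : ℕ) [NeZero d] (hn : 0 < n) (hp : 1 < p) :
    ∃ c : ℝ≥0, 0 < c ∧ ∀ D : Set (Cube d), IsDyadicGrid D →
      ∀ h : Cube d → Fin (2 ^ d - 1) → (Fin d → ℝ) → ℂ, IsHaarSystem D h →
      ∀ N : ℝ≥0, ∃ W : (Fin d → ℝ) → Matrix (Fin n) (Fin n) ℂ,
        IsMatrixWeight W ∧ apChar p W W < ∞ ∧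
        apWkChar (dual p) (fun x => matrixPow (W x) (-dual p / p)) < ∞ ∧
        (N : ℝ≥0∞) ≤ apWkChar (dual p) (fun x => matrixPow (W x) (-dual p / p)) ∧
        c * apChar p W W ^ (1 / p) *
          apWkChar (dual p) (fun x => matrixPow (W x) (-dual p / p)) ^ (1 / p) ≤
            squareFnNorm D h p W W := by
  have hp0 : 0 < p := by linarith
  have h1p : 0 ≤ 1 / p := by positivity
  set c₁ : ℝ≥0∞ := (3 ^ (1 - p) / (2 ^ d) ^ (p / 2) / 6) ^ (1 / p) with hc₁
  have h30 : (3 : ℝ≥0∞) ^ (1 - p) ≠ 0 := by simp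
  have h3t : (3 : ℝ≥0∞) ^ (1 - p) ≠ ∞ := by simp
  have hp2 : 0 ≤ p / 2 := by positivity
  have h2t : ((2 : ℝ≥0∞) ^ d) ^ (p / 2) ≠ ∞ := by finiteness
  have h20 : ((2 : ℝ≥0∞) ^ d) ^ (p / 2) ≠ 0 := by
    rw [Ne, ENNReal.rpow_eq_zero_iff_of_pos (by positivity)]
    simp
  have hc0 : c₁ ≠ 0 := by
    rw [hc₁, Ne, ENNReal.rpow_eq_zero_iff_of_pos (by positivity)]
    exact (ENNReal.div_pos (ENNReal.div_pos h30 h2t).ne' (by simp)).ne'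
  have hct : c₁ ≠ ∞ := ENNReal.rpow_ne_top_of_nonneg h1p
    (ENNReal.div_ne_top (ENNReal.div_ne_top h3t h20) (by simp))
  have h80 : (3 * 8 ^ d : ℝ≥0∞) ≠ 0 := by simp
  have h8t : (3 * 8 ^ d : ℝ≥0∞) ≠ ∞ := by finiteness
  refine ⟨(c₁ / (3 * 8 ^ d)).toNNReal, ENNReal.toNNReal_pos (ENNReal.div_pos hc0 h8t).ne'
    (ENNReal.div_ne_top hct h80), fun D hD h hh N => ?_⟩
  rw [ENNReal.coe_toNNReal (ENNReal.div_ne_top hct h80)]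
  obtain ⟨x₀, hx₀⟩ := hD.exists_cornerCube_mem
  -- The factor `6` matches the lower bound `m / 6` for the characteristic, and the summand `1`
  -- ensures `m ≥ 1`.
  obtain ⟨m, hmN⟩ := exists_nat_ge (6 * N + 1)
  have hm : 1 ≤ m := by
    have : (1 : ℝ≥0) ≤ m := le_add_self.trans hmN
    exact_mod_cast this
  have hmt := ENNReal.natCast_ne_top m
  set σ := truncatedPowerWeight x₀ m with hσdef
  have hσm : Measurable σ := measurable_truncatedPowerWeight
  have hσ : ∀ x, 0 < σ x := truncatedPowerWeight_pos
  set K : ℝ≥0∞ := 3 * m * 8 ^ d with hK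
  have hKt : K ≠ ∞ := by finiteness
  have hA1 : ∀ P : Cube d, ∀ x ∈ P.toSet, P.avg (fun y => (σ y : ℝ≥0∞)) ≤ K * σ x :=
    fun P x hx => avg_truncatedPowerWeight_le hm P hx
  have hap := apChar_scalarWeight_le (n := n) hσ hp hA1
  have hwk := apWkChar_scalarWeight_le (n := n) hσm hσ hp hKt hA1
  have hp1 : 0 ≤ p - 1 := by linarith
  refine ⟨scalarWeight n p σ, isMatrixWeight_scalarWeight hσm hσ,
    hap.trans_lt (ENNReal.rpow_lt_top_of_nonneg hp1 hKt), hwk.trans_lt hKt.lt_top, ?_, ?_⟩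
  · refine le_trans ?_ ((le_aInftyChar_truncatedPowerWeight (x₀ := x₀) hm).trans
      (le_apWkChar_scalarWeight hσm hσ hp hn))
    rw [ENNReal.le_div_iff_mul_le (Or.inl (by simp)) (Or.inl (by simp)), mul_comm]
    exact_mod_cast le_self_add.trans hmN
  · refine le_trans ?_ (le_squareFnNorm hn hp hm hD hh hx₀)
    -- The two characteristics are bounded by `K ^ (p - 1)` and `K`, so their `p`-th roots multiply
    -- to `K`, which is linear in `m` just like the lower bound for the norm.
    calc _ ≤ c₁ / (3 * 8 ^ d) * (K ^ (p - 1)) ^ (1 / p) * K ^ (1 / p) := by gcongr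
      _ = c₁ / (3 * 8 ^ d) * K := by
          rw [mul_assoc, ← ENNReal.mul_rpow_of_nonneg _ _ h1p]
          congr 1
          have : K ^ (p - 1) * K = K ^ p := by
            have := ENNReal.rpow_add_of_nonneg (x := K) (p - 1) 1 hp1 zero_le_one
            rw [ENNReal.rpow_one, sub_add_cancel] at this
            exact this.symm
          rw [this, ← ENNReal.rpow_mul, mul_one_div_cancel hp0.ne', ENNReal.rpow_one]
      _ = c₁ / (3 * 8 ^ d) * (3 * 8 ^ d) * m := by rw [hK]; ring
      _ = m * c₁ := by rw [ENNReal.div_mul_cancel h80 h8t, mul_comm]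

end

end MatrixSquare

end

/-! ### Assembly of the estimates and of sharpness -/

open MatrixSquare in
theorem theorem1p1 (d n : ℕ) (hd : 0 < d) (hn : 0 < n) (p : ℝ) (hp : 1 < p) :
    -- the estimates, with a constant depending only on `d`, `n`, `p`
    (∃ C : ℝ≥0, ∀ D : Set (Cube d), IsDyadicGrid D →
      ∀ h : Cube d → Fin (2 ^ d - 1) → (Fin d → ℝ) → ℂ, IsHaarSystem D h →
      ∀ U V : (Fin d → ℝ) → Matrix (Fin n) (Fin n) ℂ,
        IsMatrixWeight U → IsMatrixWeight V → apChar p U V < ∞ →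
        apWkChar (dual p) (fun x => matrixPow (V x) (-dual p / p)) < ∞ →
        (p ≤ 2 → squareFnNorm D h p U V ≤
          C * apChar p U V ^ (1 / p) *
            apWkChar (dual p) (fun x => matrixPow (V x) (-dual p / p)) ^ (1 / p)) ∧
        (2 < p → squareFnNorm D h p U V ≤
          C * apChar p U V ^ (1 / p) *
            apWkChar (dual p) (fun x => matrixPow (V x) (-dual p / p)) ^ (1 / p) *
            apWkChar p U ^ (1 / 2 - 1 / p))) ∧
    -- sharpness for `1 < p ≤ 2`, already for a single weight `U = V = W`
    (p ≤ 2 → ∃ c : ℝ≥0, 0 < c ∧ ∀ D : Set (Cube d), IsDyadicGrid D →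
      ∀ h : Cube d → Fin (2 ^ d - 1) → (Fin d → ℝ) → ℂ, IsHaarSystem D h →
      ∀ N : ℝ≥0, ∃ W : (Fin d → ℝ) → Matrix (Fin n) (Fin n) ℂ,
        IsMatrixWeight W ∧ apChar p W W < ∞ ∧
        apWkChar (dual p) (fun x => matrixPow (W x) (-dual p / p)) < ∞ ∧
        (N : ℝ≥0∞) ≤ apWkChar (dual p) (fun x => matrixPow (W x) (-dual p / p)) ∧
        c * apChar p W W ^ (1 / p) *
          apWkChar (dual p) (fun x => matrixPow (W x) (-dual p / p)) ^ (1 / p) ≤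
            squareFnNorm D h p W W) := by
  have : NeZero d := ⟨hd.ne'⟩
  refine ⟨?_, fun hp2 => ?_⟩
  · rcases le_or_gt p 2 with hp2 | hp2
    · obtain ⟨C, hC⟩ := squareFnNorm_le_of_le_two d n hn hp hp2
      exact ⟨C, fun D hD h hh U V hU hV hK hA =>
        ⟨fun _ => hC D hD h hh U V hU hV hK hA, fun h2 => absurd h2 hp2.not_gt⟩⟩
    · obtain ⟨C, hC⟩ := squareFnNorm_le_of_two_lt d n hn hp2
      exact ⟨C, fun D hD h hh U V hU hV hK hA =>
        ⟨fun h2 => absurd hp2 h2.not_gt, fun _ => hC D hD h hh U V hU hV hK hA⟩⟩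
  · exact exists_le_squareFnNorm d n hn hp
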